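/- **Conventions.** A half-edged ribbon graph (HERG) is a finite ribbon graph, not necessarily connected or orientable, some of whose vertex discs carry in addition half-ribbons (HRs), i.e. ribbons attached along one segment only. For a HERG $G$, $G\vee e$ is obtained by cutting the edge $e$ (replacing it by two HRs at its ends), $G/e$ by contracting $e$ (replacing $e$ and its end vertices by one disc for each boundary circle of their union). A boundary circle of $G$ is *closed* if it meets no HR, otherwise it is *external* (the external circles are the connected components of the boundary graph of $G$). An *HR move* displaces one HR along its boundary circle, or moves it from an external circle carrying another HR to a different external circle. HERGs are considered up to isomorphism and HR moves ("HR-classes"). Write $|V|,k,F_{\rm int},C_\partial,f$ for the numbers of vertices, connected components, closed circles, external circles, HRs; $r=|V|-k$, $n=|E|-r$, and $t=0$ or $1$ according to whether the surface is orientable or not. For elements of a commutative ring with $w^2=w$, $$\mathcal R(G;x,y,z,s,w,t)=\sum_{A}(x-1)^{r(G)-r(A)}(y-1)^{n(A)}z^{k(A)-F_{\rm int}(A)+n(A)}s^{C_\partial(A)}w^{t(A)}t^{f(A)},$$ the sum being over all HERGs $A$ obtained from $G$ by cutting a set of edges. A one-vertex HERG is the same as a signed chord diagram with half-chords (twisted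 loops are negative chords). If $G$ is a two-vertex HERG and $e\ne g$ are edges joining its two vertices, then $D_1=G/e$ and $D_2=G/g$ are *related* (by a rotation if $e,g$ are equally twisted, otherwise by a twist), and we put $D_1'=D_1\vee g$, $D_2'=D_2\vee e$. $D\sim D'$ means that $D,D'$ are connected by a sequence of rotations and twists. A *canonical diagram* $D_{ijklm}$ ($0\le m\le 2$) has $i$ chords, arranged side by side around the circle in the following order: $j$ pairs of crossing positive chords, $i-2j-m$ positive chords crossing no chord, $m$ negative chords crossing no chord; and it has $l$ half-chords, placed inside the isolated positive chords or outside all chords, such that $C_\partial=k$. (Several placements may have the same indices.) A subdiagram $A$ obtained from such a diagram by cutting chords has analogous numbers $i_A$ (chords), $j_A$ (crossing pairs), $k_A=C_\partial(A)$, $l_A=f(A)$, $m_A$ (negative chords). A set $\mathcal M$ of HR-classes is *minor closed* if it is closed under cutting edges, contracting edges and passing to a non-empty union of connected components. It is *closed under chord operations* if, whenever $D\in\mathcal M$ and $D\sim D_{ijklm}$, there is a finite sequence in $\mathcal M$ from $D$ to a canonical diagram with these indices in which any two consecutive diagrams are related by a single rotation or twist. **Theorem.** Let $\mathcal M$ be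 a minor closed set of HR-classes of HERGs, closed under chord operations, that contains $D_{10000}$, $D_{10001}$, $D_{21000}$ and $D_{001l0}$ for all $l\ge 1$. Let $F$ be a map from $\mathcal M$ to a commutative ring $\mathfrak R$ with unity such that $$F(D_1)-F(D_1')=F(D_2)-F(D_2')$$ whenever $D_1,D_2\in\mathcal M$ are related by a rotation or a twist as above. Let $s=F(D_{21000})$, $q=F(D_{10000})$, $r=F(D_{10001})$, $s_l=F(D_{001l0})$, and suppose there are $\alpha,x,u,v,w,o\in\mathfrak R$, $\alpha$ a unit, such that 1. for $G\in\mathcal M$, $F(G)=F(G\vee e)+F(G/e)$ if $e$ is regular (neither a bridge nor a loop), and $F(G)=\alpha^{-1}(x-1)F(G\vee e)+F(G/e)$ if $e$ is a bridge; 2. $F(G\sqcup H)=F(G)F(H)$ whenever $G$, $H$ are disjoint unions of one-vertex HERGs and $G,H,G\sqcup H\in\mathcal M$; and, with $$m_1=\alpha^{-1}(q-s_2),\quad m_2=\alpha^{-1}(r-s_2),\quad m_3=\alpha^{-1}\bigl(s-2\alpha^{-2}(q-s_2)s_1^2-s_4\bigr),$$ every canonical diagram $D=D_{ijklm}\in\mathcal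 M$ satisfies $$F(D)=\alpha\sum_{A}m_1^{\,i_A-2j_A-m_A}\,(uv)^{k_A}o^{\,l_A}\,m_2^{\,m_A}\,m_3^{\,j_A},$$ the sum being over all $A$ obtained from $D$ by cutting a set of chords; 3. $F(E)=\alpha^n$ if $E\in\mathcal M$ is an edgeless graph with $n$ vertices and no HRs; 4. $(q-s_2)^2u^2=\alpha[s-2\alpha^{-2}(q-s_2)s_1^2-s_4]$, $(q-s_2)uw=r-s_2$, $s_l=\alpha(uvo^l)$ for all $l\ge1$, and $w=w^2$. Then for all $G\in\mathcal M$ $$F(G)=\alpha^{k(G)}\,\mathcal R\bigl(G;x,\alpha^{-1}(q-s_2+\alpha),u,v,w,o\bigr).$$ -/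

import Mathlib

/-!
Half-edged ribbon graphs, their classes under moves of half-ribbons, the Bollobás-Riordan
polynomial of half-edged ribbon graphs, and chord diagrams.
-/

/-- A half-edged ribbon graph, encoded by the corners of its ribbons.  A ribbon end touches a vertex
disc along a segment; the two end points of that segment are the flags of the ribbon end.
* `v` sends a flag to the neighbouring flag along the free arc of the vertex boundary;
* `h` exchanges the two flags of a ribbon end;
* `e` follows the ribbon side (strand) that starts at the flag: for an edge it arrives at the
  corner at the other end of the edge, for a half-ribbon it runs along the half-ribbon, its free
  segment and back to the other flag, so that `e x = h x` exactly on the half-ribbons;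
* `isolated` is the number of vertices that carry no ribbon at all (and hence have no flags).
The cyclic order at a vertex is only recorded up to reversal (with the appropriate change of the
twists), that is, ribbon graphs are considered as surfaces with no chosen orientation. -/
structure HERG where
  Flag : Type
  [fin : Finite Flag]
  v : Flag → Flag
  h : Flag → Flag
  e : Flag → Flag
  isolated : ℕ
  v_v : ∀ x, v (v x) = x
  h_h : ∀ x, h (h x) = x
  e_e : ∀ x, e (e x) = x
  v_ne : ∀ x, v x ≠ x
  h_ne : ∀ x, h x ≠ x
  e_ne : ∀ x, e x ≠ x
  h_e : ∀ x, h (e x) = e (h x)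

namespace HERG

attribute [instance] HERG.fin

/-! ### Vertices, ribbons, faces, components -/

/-- The vertices with at least one ribbon end. -/
def Vertex (G : HERG) : Type := Quot fun x y : G.Flag => y = G.v x ∨ y = G.h x

/-- The ribbons: edges and half-ribbons. -/
def Ribbon (G : HERG) : Type := Quot fun x y : G.Flag => y = G.h x ∨ y = G.e x

/-- The boundary circles of the surface (those that are not the boundary of an isolated vertex),
each half-ribbon being pinched, so that a circle may run through free segments of half-ribbons. -/
def Face (G : HERG) : Type := Quot fun x y : G.Flag => y = G.v x ∨ y = G.e x

/-- The connected components that are not isolated vertices. -/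
def Component (G : HERG) : Type :=
  Quot fun x y : G.Flag => y = G.v x ∨ y = G.h x ∨ y = G.e x

def vertexOf (G : HERG) (x : G.Flag) : G.Vertex := Quot.mk _ x
def ribbonOf (G : HERG) (x : G.Flag) : G.Ribbon := Quot.mk _ x
def faceOf (G : HERG) (x : G.Flag) : G.Face := Quot.mk _ x

/-- The flag `x` belongs to an edge (and not to a half-ribbon). -/
def IsEdge (G : HERG) (x : G.Flag) : Prop := G.e x ≠ G.h x

/-- The edges. -/
def Edge (G : HERG) : Type := {ρ : G.Ribbon // ∃ x, G.ribbonOf x = ρ ∧ G.IsEdge x}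

/-- The additional half-ribbons. -/
def HalfRibbon (G : HERG) : Type := {ρ : G.Ribbon // ∃ x, G.ribbonOf x = ρ ∧ G.e x = G.h x}

/-- A boundary circle is external if it passes through a half-ribbon, and closed otherwise.
The external ones are the connected components of the boundary graph. -/
def IsExternal (G : HERG) (f : G.Face) : Prop := ∃ x, G.faceOf x = f ∧ G.e x = G.h x

instance (G : HERG) : Finite G.Ribbon := inferInstanceAs (Finite (Quot _))
instance (G : HERG) : Finite G.Edge := inferInstanceAs (Finite (Subtype _))
noncomputable instance (G : HERG) : Fintype G.Edge := Fintype.ofFinite _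

/-- `|V(G)|`. -/
noncomputable def numVertices (G : HERG) : ℕ := Nat.card G.Vertex + G.isolated
/-- `|E(G)|`. -/
noncomputable def numEdges (G : HERG) : ℕ := Nat.card G.Edge
/-- `k(G)`, the number of connected components. -/
noncomputable def numComponents (G : HERG) : ℕ := Nat.card G.Component + G.isolated
/-- `r(G)`, the rank. -/
noncomputable def rank (G : HERG) : ℕ := G.numVertices - G.numComponents
/-- `n(G)`, the nullity. -/
noncomputable def nullity (G : HERG) : ℕ := G.numEdges - G.rank
/-- `F_int(G)`, the number of closed faces. -/
noncomputable def numClosedFaces (G : HERG) : ℕ :=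
  Nat.card {f : G.Face // ¬ G.IsExternal f} + G.isolated
/-- `C_∂(G)`, the number of connected components of the boundary graph. -/
noncomputable def numBoundary (G : HERG) : ℕ := Nat.card {f : G.Face // G.IsExternal f}
/-- `f(G)`, the number of half-ribbons. -/
noncomputable def numHalfRibbons (G : HERG) : ℕ := Nat.card G.HalfRibbon

/-- The surface is orientable: the flags can be coloured with two colours such that each of the
three involutions changes the colour. -/
def Orientable (G : HERG) : Prop :=
  ∃ c : G.Flag → Bool, ∀ x, c (G.v x) = !c x ∧ c (G.h x) = !c x ∧ c (G.e x) = !c x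

open Classical in
/-- `t(G)`: `0` if `G` is orientable and `1` otherwise. -/
noncomputable def nonorientability (G : HERG) : ℕ := if G.Orientable then 0 else 1

/-! ### Cutting and spanning c-subgraphs -/

theorem ribbonOf_h (G : HERG) (x : G.Flag) : G.ribbonOf (G.h x) = G.ribbonOf x :=
  (Quot.sound (r := fun x y : G.Flag => y = G.h x ∨ y = G.e x) (Or.inl rfl)).symm

theorem ribbonOf_e (G : HERG) (x : G.Flag) : G.ribbonOf (G.e x) = G.ribbonOf x :=
  (Quot.sound (r := fun x y : G.Flag => y = G.h x ∨ y = G.e x) (Or.inr rfl)).symm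

open Classical in
/-- Keep the ribbons in `P` and cut every edge that is not in `P`: the edge is replaced by two
half-ribbons attached where the ends of the edge were. -/
noncomputable def keep (G : HERG) (P : Set G.Ribbon) : HERG where
  Flag := G.Flag
  v := G.v
  h := G.h
  e := fun x => if G.ribbonOf x ∈ P then G.e x else G.h x
  isolated := G.isolated
  v_v := G.v_v
  h_h := G.h_h
  e_e := by
    intro x
    by_cases hx : G.ribbonOf x ∈ P
    · simp [hx, ribbonOf_e, G.e_e]
    · simp [hx, ribbonOf_h, G.h_h]
  v_ne := G.v_ne
  h_ne := G.h_ne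
  e_ne := by
    intro x
    by_cases hx : G.ribbonOf x ∈ P
    · simpa [hx] using G.e_ne x
    · simpa [hx] using G.h_ne x
  h_e := by
    intro x
    by_cases hx : G.ribbonOf x ∈ P
    · simp [hx, ribbonOf_h, G.h_e]
    · simp [hx, ribbonOf_h]

/-- `G ∨ e`, the cut of the edge through the flag `x`. -/
noncomputable def cut (G : HERG) (x : G.Flag) : HERG := G.keep {ρ | ρ ≠ G.ribbonOf x}

/-- The spanning c-subgraph of `G` with edge set `A`. -/
noncomputable def spanning (G : HERG) (A : Finset G.Edge) : HERG := G.keep {ρ | ∃ a ∈ A, a.1 = ρ}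

/-! ### Contraction -/

/-- The flags of the ribbon through `x`. -/
def ribbonFlags (G : HERG) (x : G.Flag) : Set G.Flag :=
  {y | y = x ∨ y = G.h x ∨ y = G.e x ∨ y = G.h (G.e x)}

theorem e_mem_ribbonFlags (G : HERG) (x y : G.Flag) (hy : y ∈ G.ribbonFlags x) :
    G.e y ∈ G.ribbonFlags x := by
  rcases hy with rfl | rfl | rfl | rfl
  · exact Or.inr (Or.inr (Or.inl rfl))
  · exact Or.inr (Or.inr (Or.inr (G.h_e x).symm))
  · exact Or.inl (G.e_e x)
  · refine Or.inr (Or.inl ?_)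
    rw [← G.h_e, G.e_e]

theorem h_mem_ribbonFlags (G : HERG) (x y : G.Flag) (hy : y ∈ G.ribbonFlags x) :
    G.h y ∈ G.ribbonFlags x := by
  rcases hy with rfl | rfl | rfl | rfl
  · exact Or.inr (Or.inl rfl)
  · exact Or.inl (G.h_h x)
  · exact Or.inr (Or.inr (Or.inr rfl))
  · exact Or.inr (Or.inr (Or.inl (G.h_h _)))

theorem e_mem_ribbonFlags_iff (G : HERG) (x y : G.Flag) :
    G.e y ∈ G.ribbonFlags x ↔ y ∈ G.ribbonFlags x :=
  ⟨fun hy => by simpa [G.e_e] using G.e_mem_ribbonFlags x _ hy, G.e_mem_ribbonFlags x y⟩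

theorem h_mem_ribbonFlags_iff (G : HERG) (x y : G.Flag) :
    G.h y ∈ G.ribbonFlags x ↔ y ∈ G.ribbonFlags x :=
  ⟨fun hy => by simpa [G.h_h] using G.h_mem_ribbonFlags x _ hy, G.h_mem_ribbonFlags x y⟩

open Classical in
/-- The free arc at `y` after contraction of the ribbon through `x`: follow the vertex boundary
and, whenever a corner of the contracted ribbon is met, the side of that ribbon.  At most two sides
can be met before a flag outside the ribbon is reached. -/
noncomputable def contractArc (G : HERG) (x y : G.Flag) : G.Flag :=
  if G.v y ∉ G.ribbonFlags x then G.v y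
  else if G.v (G.e (G.v y)) ∉ G.ribbonFlags x then G.v (G.e (G.v y))
  else G.v (G.e (G.v (G.e (G.v y))))

theorem eq_of_mem_ribbonFlags (G : HERG) (x a b z : G.Flag) (ha : a ∈ G.ribbonFlags x)
    (hb : b ∈ G.ribbonFlags x) (hba : b ≠ a) (hbea : b ≠ G.e a) (hz : z ∈ G.ribbonFlags x) :
    z = a ∨ z = G.e a ∨ z = b ∨ z = G.e b := by
  have e1 := G.e_e
  have e2 := G.h_h
  have e3 := G.h_e
  rcases ha with rfl | rfl | rfl | rfl <;> rcases hb with rfl | rfl | rfl | rfl <;>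
    rcases hz with rfl | rfl | rfl | rfl <;> simp_all

theorem contractArc_cases (G : HERG) (x y : G.Flag) (hy : y ∉ G.ribbonFlags x) :
    G.contractArc x y ∉ G.ribbonFlags x ∧ G.contractArc x (G.contractArc x y) = y ∧
      G.contractArc x y ≠ y := by
  have vv := G.v_v
  have ee := G.e_e
  have vinj : ∀ {p q : G.Flag}, G.v p = G.v q → p = q := fun {p q} hpq => by
    rw [← vv p, hpq, vv]
  have einj : ∀ {p q : G.Flag}, G.e p = G.e q → p = q := fun {p q} hpq => by
    rw [← ee p, hpq, ee]
  by_cases h1 : G.v y ∈ G.ribbonFlags x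
  · by_cases h2 : G.v (G.e (G.v y)) ∈ G.ribbonFlags x
    · have hc : G.contractArc x y = G.v (G.e (G.v (G.e (G.v y)))) := by
        simp [contractArc, h1, h2]
      have hne1 : G.v (G.e (G.v y)) ≠ G.v y := fun hq =>
        hy (vinj hq ▸ G.e_mem_ribbonFlags x _ h1)
      have hne2 : G.v (G.e (G.v y)) ≠ G.e (G.v y) := G.v_ne _
      have h3 : G.v (G.e (G.v (G.e (G.v y)))) ∉ G.ribbonFlags x := by
        intro h3
        rcases G.eq_of_mem_ribbonFlags x _ _ _ h1 h2 hne1 hne2 h3 with hz | hz | hz | hz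
        · have := vinj hz
          exact hy (this ▸ G.e_mem_ribbonFlags x _ h2)
        · have h4 : G.e (G.v (G.e (G.v y))) = G.v (G.e (G.v y)) := vinj (by rw [hz, vv])
          exact G.e_ne _ h4
        · have h4 := einj (vinj hz)
          exact hne1 h4
        · exact G.v_ne _ hz
      have h4 : G.v (G.v (G.e (G.v (G.e (G.v y))))) ∈ G.ribbonFlags x := by
        rw [vv]; exact G.e_mem_ribbonFlags x _ h2
      have h5 : G.v (G.e (G.v (G.v (G.e (G.v (G.e (G.v y))))))) ∈ G.ribbonFlags x := by
        rw [vv, ee, vv]; exact G.e_mem_ribbonFlags x _ h1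
      rw [hc]
      refine ⟨h3, ?_, ?_⟩
      · rw [contractArc, if_neg (not_not.mpr h4), if_neg (not_not.mpr h5)]
        simp only [vv, ee]
      · intro hq
        have h6 : G.e (G.v (G.e (G.v y))) = G.v y := by rw [← vv (G.e _), hq]
        have h7 : G.v (G.e (G.v y)) = G.e (G.v y) := by rw [← ee (G.v (G.e _)), h6]
        exact G.v_ne _ h7
    · have hc : G.contractArc x y = G.v (G.e (G.v y)) := by
        simp [contractArc, h1, h2]
      rw [hc]
      refine ⟨h2, ?_, ?_⟩
      · have h4 : G.v (G.v (G.e (G.v y))) ∈ G.ribbonFlags x := by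
          rw [vv]; exact G.e_mem_ribbonFlags x _ h1
        have h5 : G.v (G.e (G.v (G.v (G.e (G.v y))))) ∉ G.ribbonFlags x := by
          rw [vv, ee, vv]; exact hy
        rw [contractArc, if_neg (not_not.mpr h4), if_pos h5]
        simp only [vv, ee]
      · intro hq
        have h6 : G.e (G.v y) = G.v y := by rw [← vv (G.e _), hq]
        exact G.e_ne _ h6
  · have hc : G.contractArc x y = G.v y := by simp [contractArc, h1]
    rw [hc]
    refine ⟨h1, ?_, G.v_ne y⟩
    simp [contractArc, vv, hy]

/-- `G / e`, the contraction of the edge through the flag `x`: the edge, together with its end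
vertices, is replaced by one disc for each boundary circle of the union of the edge and its end
vertices (one new vertex if the edge is not a loop or is a twisted loop, two new vertices if it is
an untwisted loop), the remaining ribbon ends staying where they are.  New vertices
without ribbon ends are the boundary circles that only run along the contracted edge. -/
noncomputable def contract (G : HERG) (x : G.Flag) : HERG where
  Flag := {y : G.Flag // y ∉ G.ribbonFlags x}
  v := fun y => ⟨G.contractArc x y, (G.contractArc_cases x y y.2).1⟩
  h := fun y => ⟨G.h y, fun hy => y.2 ((G.h_mem_ribbonFlags_iff x y).1 hy)⟩
  e := fun y => ⟨G.e y, fun hy => y.2 ((G.e_mem_ribbonFlags_iff x y).1 hy)⟩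
  isolated := G.isolated + Nat.card {f : G.Face // ∀ y, G.faceOf y = f → y ∈ G.ribbonFlags x}
  v_v := fun y => Subtype.ext (G.contractArc_cases x y y.2).2.1
  h_h := fun y => Subtype.ext (G.h_h y)
  e_e := fun y => Subtype.ext (G.e_e y)
  v_ne := fun y hy => (G.contractArc_cases x y y.2).2.2 (congrArg Subtype.val hy)
  h_ne := fun y hy => G.h_ne y (congrArg Subtype.val hy)
  e_ne := fun y hy => G.e_ne y (congrArg Subtype.val hy)
  h_e := fun y => Subtype.ext (G.h_e y)

/-! ### Kinds of edges, disjoint union -/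

/-- The edge through `x` is a loop: its two ends are at the same vertex. -/
def IsLoop (G : HERG) (x : G.Flag) : Prop := G.IsEdge x ∧ G.vertexOf x = G.vertexOf (G.e x)

/-- The edge through `x` is a bridge: its removal disconnects a component. -/
def IsBridge (G : HERG) (x : G.Flag) : Prop :=
  G.IsEdge x ∧ G.numComponents < (G.cut x).numComponents

/-- The edge through `x` is regular: it is neither a bridge nor a loop. -/
def IsRegular (G : HERG) (x : G.Flag) : Prop := G.IsEdge x ∧ ¬ G.IsBridge x ∧ ¬ G.IsLoop x

/-- `G` is a disjoint union of bouquets (one-vertex graphs): all its edges are loops. -/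
def IsBouquetUnion (G : HERG) : Prop := ∀ x, G.IsEdge x → G.IsLoop x

/-- `G ⊔ H`. -/
def disjointUnion (G H : HERG) : HERG where
  Flag := G.Flag ⊕ H.Flag
  v := Sum.map G.v H.v
  h := Sum.map G.h H.h
  e := Sum.map G.e H.e
  isolated := G.isolated + H.isolated
  v_v := by rintro (x | x) <;> simp [G.v_v, H.v_v]
  h_h := by rintro (x | x) <;> simp [G.h_h, H.h_h]
  e_e := by rintro (x | x) <;> simp [G.e_e, H.e_e]
  v_ne := by rintro (x | x) <;> simp [G.v_ne, H.v_ne]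
  h_ne := by rintro (x | x) <;> simp [G.h_ne, H.h_ne]
  e_ne := by rintro (x | x) <;> simp [G.e_ne, H.e_ne]
  h_e := by rintro (x | x) <;> simp [G.h_e, H.h_e]

/-! ### The polynomial -/

/-- The polynomial `𝓡_G(X, Y, Z, S, W, T)`, evaluated in a commutative ring (at an idempotent
`W = w`).  None of the subtractions of natural numbers is truncated. -/
noncomputable def brPoly {R : Type*} [CommRing R] (G : HERG) (x y z s w t : R) : R :=
  ∑ A : Finset G.Edge,
    (x - 1) ^ (G.rank - (G.spanning A).rank) * (y - 1) ^ (G.spanning A).nullity *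
      z ^ ((G.spanning A).numComponents + (G.spanning A).nullity - (G.spanning A).numClosedFaces) *
      s ^ (G.spanning A).numBoundary * w ^ (G.spanning A).nonorientability *
      t ^ (G.spanning A).numHalfRibbons

/-! ### Isomorphism and moves of half-ribbons -/

/-- Isomorphism of half-edged ribbon graphs. -/
def Iso (G H : HERG) : Prop :=
  G.isolated = H.isolated ∧ ∃ φ : G.Flag ≃ H.Flag,
    ∀ x, φ (G.v x) = H.v (φ x) ∧ φ (G.h x) = H.h (φ x) ∧ φ (G.e x) = H.e (φ x)

open Classical in
/-- Attach a new half-ribbon in the free arc between `y` and `G.v y`. -/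
noncomputable def insertHR (G : HERG) (y : G.Flag) : HERG where
  Flag := G.Flag ⊕ Bool
  v := Sum.elim
    (fun x => if x = y then Sum.inr false else if x = G.v y then Sum.inr true else Sum.inl (G.v x))
    (fun b => Sum.inl (if b then G.v y else y))
  h := Sum.map G.h not
  e := Sum.map G.e not
  isolated := G.isolated
  v_v := by
    have hv := G.v_ne y
    have hv' := G.v_v
    rintro (x | (_ | _))
    · by_cases h1 : x = y
      · simp [h1]
      · by_cases h2 : x = G.v y
        · subst h2; simp [hv]
        · have h3 : G.v x ≠ y := fun hh => h2 (by rw [← hh, hv'])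
          have h4 : G.v x ≠ G.v y := fun hh => h1 (by rw [← hv' x, hh, hv'])
          simp [h1, h2, h3, h4, hv']
    · simp
    · simp [hv]
  h_h := by rintro (x | x) <;> simp [G.h_h]
  e_e := by rintro (x | x) <;> simp [G.e_e]
  v_ne := by
    rintro (x | x)
    · have := G.v_ne x
      simp only [Sum.elim_inl]
      split_ifs <;> simp [this]
    · simp
  h_ne := by rintro (x | x) <;> simp [G.h_ne]
  e_ne := by rintro (x | x) <;> simp [G.e_ne]
  h_e := by rintro (x | x) <;> simp [G.h_e]

/-- A move of a half-ribbon: `K` is the graph without the half-ribbon that is moved, `y` its old and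
`y'` its new place.  Either both places are on the same boundary circle (displacement), or they are
on two boundary circles each of which carries another half-ribbon (jump from one component of the
boundary graph to another one, the former remaining a component of the boundary graph). -/
def HRMove (G G' : HERG) : Prop :=
  ∃ (K : HERG) (y y' : K.Flag), G.Iso (K.insertHR y) ∧ G'.Iso (K.insertHR y') ∧
    (K.faceOf y = K.faceOf y' ∨ (K.IsExternal (K.faceOf y) ∧ K.IsExternal (K.faceOf y')))

/-- HR-equivalence of (isomorphism classes of) half-edged ribbon graphs. -/
instance hrSetoid : Setoid HERG := Relation.EqvGen.setoid fun G G' => G.Iso G' ∨ HRMove G G'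

end HERG

/-- HR-equivalence classes of half-edged ribbon graphs. -/
def HRClass : Type 1 := Quotient HERG.hrSetoid

namespace HRClass

/-- The class of `G`. -/
def of (G : HERG) : HRClass := Quotient.mk _ G

/-- A set of classes is minor closed if it is closed under cutting an edge, contracting an
edge, and passing to (a nonempty union of) some connected components. -/
structure MinorClosed (M : Set HRClass) : Prop where
  cut : ∀ (G : HERG) (x : G.Flag), G.IsEdge x → of G ∈ M → of (G.cut x) ∈ M
  contract : ∀ (G : HERG) (x : G.Flag), G.IsEdge x → of G ∈ M → of (G.contract x) ∈ M
  component : ∀ G H : HERG, 0 < G.numVertices → of (G.disjointUnion H) ∈ M → of G ∈ M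

/-! ### Chord diagrams -/

/-- `Related D D' E E'`: there is a two-vertex graph `G` with two different edges (through
the flags `x` and `y`) joining the two vertices such that the chord diagrams `D` and `E` arise from
`G` by contracting the first and the second edge, respectively, and `D'` and `E'` arise from `D` and
`E` by cutting the chord that comes from the other edge.  If both edges have the same
twist then `D` and `E` are related by a rotation about that chord, otherwise by a twist. -/
def Related (D D' E E' : HRClass) : Prop :=
  ∃ (G : HERG) (x y : G.Flag) (hxy : y ∉ G.ribbonFlags x) (hyx : x ∉ G.ribbonFlags y),
    G.numVertices = 2 ∧ G.IsEdge x ∧ G.IsEdge y ∧ ¬ G.IsLoop x ∧ ¬ G.IsLoop y ∧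
    D = of (G.contract x) ∧ D' = of ((G.contract x).cut ⟨y, hxy⟩) ∧
    E = of (G.contract y) ∧ E' = of ((G.contract y).cut ⟨x, hyx⟩)

/-- `D` and `E` are related by a single rotation or twist. -/
def Step (D E : HRClass) : Prop := ∃ D' E', Related D D' E E'

/-- `R`-equivalence `D ∼ E`: the diagrams are related by a sequence of rotations and twists. -/
def REquiv (D E : HRClass) : Prop := Relation.ReflTransGen Step D E

end HRClass

open Classical in
/-- The place of the other end of the chord with an end at place `p` of a word (`p` itself for a
half-chord). -/
noncomputable def partner {C : Type} (w : List (Option C)) (p : Fin w.length) : Fin w.length :=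
  if h : w.get p ≠ none ∧ ∃! q, q ≠ p ∧ w.get q = w.get p then h.2.choose else p

theorem get_partner {C : Type} (w : List (Option C)) (p : Fin w.length) :
    w.get (partner w p) = w.get p := by
  unfold partner
  split_ifs with h
  · exact h.2.choose_spec.1.2
  · rfl

theorem partner_partner {C : Type} (w : List (Option C)) (p : Fin w.length) :
    partner w (partner w p) = p := by
  by_cases h : w.get p ≠ none ∧ ∃! q, q ≠ p ∧ w.get q = w.get p
  · have hq : partner w p = h.2.choose := by rw [partner, dif_pos h]
    have h1 := h.2.choose_spec.1
    have h2 := h.2.choose_spec.2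
    rw [← hq] at h1 h2
    have h' : w.get (partner w p) ≠ none ∧
        ∃! q, q ≠ partner w p ∧ w.get q = w.get (partner w p) := by
      refine ⟨h1.2 ▸ h.1, p, ⟨h1.1.symm, h1.2.symm⟩, ?_⟩
      rintro q ⟨hq1, hq2⟩
      by_contra hqp
      exact hq1 (h2 q ⟨hqp, hq2.trans h1.2⟩)
    rw [partner, dif_pos h']
    have h3 := h'.2.choose_spec
    by_contra hne
    exact h3.1.1 (h2 _ ⟨hne, h3.1.2.trans h1.2⟩)
  · have hq : partner w p = p := by rw [partner, dif_neg h]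
    rw [hq, hq]

open Classical in
/-- The one-vertex graph of the signed open chord diagram that is read off along the circle as the
cyclic word `w`: a letter `some c` is an end of the chord `c` (each chord of the diagram occurs
exactly twice), `none` is a half-chord, and the chords with `tw c = true` carry the sign `t`.  The
ribbon end at place `p` has the flags `(p, false)` and `(p, true)`, in the order of the circle. -/
noncomputable def chordDiagram {C : Type} (tw : C → Bool) (w : List (Option C)) : HERG where
  Flag := Fin w.length × Bool
  v := fun x => if x.2 then (finRotate _ x.1, false) else ((finRotate _).symm x.1, true)
  h := fun x => (x.1, !x.2)
  e := fun x =>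
    if partner w x.1 = x.1 then (x.1, !x.2)
    else (partner w x.1, if (w.get x.1).elim false tw then x.2 else !x.2)
  isolated := if w.length = 0 then 1 else 0
  v_v := by
    rintro ⟨p, _ | _⟩
    · exact Prod.ext (Equiv.apply_symm_apply _ _) rfl
    · exact Prod.ext (Equiv.symm_apply_apply _ _) rfl
  h_h := by rintro ⟨p, b⟩; simp
  e_e := by
    rintro ⟨p, b⟩
    by_cases h : partner w p = p
    · simp [h]
    · have h' : p ≠ partner w p := fun hh => h hh.symm
      have hg := get_partner w p
      simp only [h, h', if_false, partner_partner, hg]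
      split_ifs <;> simp
  v_ne := by rintro ⟨p, _ | _⟩ <;> simp
  h_ne := by rintro ⟨p, b⟩; simp
  e_ne := by
    rintro ⟨p, b⟩
    by_cases h : partner w p = p
    · simp [h]
    · simp [h]
  h_e := by
    rintro ⟨p, b⟩
    by_cases h : partner w p = p
    · simp [h]
    · simp only [h, if_false]
      split_ifs <;> simp

/-- Names for the chords of the canonical diagrams: the two chords of the `p`-th crossing pair, the
`p`-th isolated positive chord and the `p`-th isolated negative chord. -/
inductive Chord : Type
  | crossL (p : ℕ)
  | crossR (p : ℕ)
  | positive (p : ℕ)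
  | negative (p : ℕ)
  deriving DecidableEq

/-- The negative chords. -/
def Chord.tw : Chord → Bool
  | .negative _ => true
  | _ => false

/-- The word of the canonical diagram with `j` pairs of crossing positive chords, followed by
`ls.length` isolated positive chords, the `p`-th one of which encloses `ls[p]` half-chords, followed
by `m` isolated negative chords and the remaining `s` half-chords. -/
def canonicalWord (j : ℕ) (ls : List ℕ) (m s : ℕ) : List (Option Chord) :=
  (List.range j).flatMap
      (fun p => [some (.crossL p), some (.crossR p), some (.crossL p), some (.crossR p)]) ++
    ls.zipIdx.flatMap
      (fun a => some (.positive a.2) :: (List.replicate a.1 none ++ [some (.positive a.2)])) ++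
    (List.range m).flatMap (fun p => [some (.negative p), some (.negative p)]) ++
    List.replicate s none

/-- The chords of `canonicalWord j ls m s`, where `a = ls.length`. -/
def canonicalChords (j a m : ℕ) : Finset Chord :=
  (Finset.range j).image .crossL ∪ (Finset.range j).image .crossR ∪
    (Finset.range a).image .positive ∪ (Finset.range m).image .negative

/-- Cut the chords that are not in `A`: both ends of such a chord become half-chords. -/
def restrictWord (A : Finset Chord) (w : List (Option Chord)) : List (Option Chord) :=
  w.map fun c => c.filter fun d => decide (d ∈ A)

/-- The number of crossing pairs both chords of which are in `A`. -/
def numPairs (j : ℕ) (A : Finset Chord) : ℕ :=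
  ((Finset.range j).filter fun p => Chord.crossL p ∈ A ∧ Chord.crossR p ∈ A).card

/-- The number of negative chords in `A`. -/
def numNegative (A : Finset Chord) : ℕ := (A.filter fun c => c.tw = true).card

namespace HRClass

/-- The class of a canonical diagram. -/
noncomputable def canonical (j : ℕ) (ls : List ℕ) (m s : ℕ) : HRClass :=
  of (chordDiagram Chord.tw (canonicalWord j ls m s))

/-- `D` is a canonical diagram `D_{ijklm}`: it has `i` chords, `j` crossing pairs, `k` connected
components of the boundary, `l` half-chords and `m ≤ 2` negative chords. -/
def IsCanonical (D : HRClass) (i j k l m : ℕ) : Prop :=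
  ∃ (ls : List ℕ) (s : ℕ), D = canonical j ls m s ∧ m ≤ 2 ∧ i = 2 * j + ls.length + m ∧
    k = (chordDiagram Chord.tw (canonicalWord j ls m s)).numBoundary ∧ l = ls.sum + s

/-- `M` is closed under chord operations: whenever `D ∈ M` is `R`-equivalent to a diagram
`D_{ijklm}`, there is a finite sequence of diagrams in `M` that starts at `D`, ends at
`D_{ijklm}`, and in which consecutive diagrams are related by a rotation or a twist. -/
def ClosedUnderChordOperations (M : Set HRClass) : Prop :=
  ∀ (D : HRClass) (i j k l m : ℕ), D ∈ M → (∃ C, IsCanonical C i j k l m ∧ REquiv D C) →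
    ∃ C, IsCanonical C i j k l m ∧ Relation.ReflTransGen (fun A B => Step A B ∧ A ∈ M ∧ B ∈ M) D C

end HRClass

/-! ### Quotients of finite types -/

section Quotients

variable {α β : Type*}

/-! Write `P(G) = α^k(G) * 𝓡(G)` with the arguments of the theorem (`scaledPoly`). The equality `F =
P` on `M` is an induction on the number of edges plus the number of vertices: `P` obeys every rule
imposed on `F`, and these rules leave no freedom.

The polynomial is a state sum over sets of kept edges. For an edge that is not a loop, the states
without it are the states of the cut graph. The states with it are the states of the contracted
graph, because contracting a non-loop preserves components, closed and external circles,
half-ribbons, orientability and nullity. This gives the rules for regular edges and bridges at once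
(`scaledPoly_of_nonloop`). The sum descends to HR-classes because a circle broken by cutting leaves
only external pieces, between which half-ribbons may jump (`Movable.onFlags`). For two edges joining
the vertices of a two-vertex graph, `P(D) - P(D')` is the sum over the states that contain both
edges, which is symmetric in them (`brPoly_contract_sub_cut`, `scaledPoly_of_related`). Since `w` is
idempotent, `P` is multiplicative on unions of bouquets (`scaledPoly_disjointUnion`).

In the induction, a non-loop edge is cut and contracted, and a bouquet union with several vertices
is split into smaller ones. For a single vertex, `F - P` does not change under a rotation or twist
inside `M`, since the correction terms belong to smaller diagrams (`sub_eq_of_reflTransGen`). It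
therefore suffices to reach a canonical diagram in `M` and to compare `F` and `P` there. This needs
two facts.

The first is that every one-vertex graph is equivalent to a canonical diagram (`exists_canonical`).
A handle slide is a single rotation or twist (`slide_step`): pull the chord and its neighbouring
ribbon end out to a second vertex, joined by a new edge, and contract the chord instead of the new
edge. Slides then yield the classical normal form of a surface: negative chords are emptied,
crossing positive chords are separated from the rest, finished blocks are moved out of the way, and
three negative chords are traded for a crossing pair and one negative chord, which keeps at most two
of them (`exists_blocks_aux`). Closure of `M` under chord operations then gives a path inside `M`,
possibly to another placement of the half-chords with the same indices.

The second is the value of `P` on a canonical diagram. Every subdiagram again consists of `a`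
isolated positive chords, `j` crossing pairs and `m` negative chords, so it has `a + 1` boundary
circles (`Spells.numFaces`). Its weight therefore factors as `m₁^a (uv)^k o^l m₂^m m₃^j`, once the
relations (4) express `m₂` and `m₃` through `m₁`, `u` and `w` (`scaledPoly_canonical`). This is the
prescribed value of `F`. -/

theorem Quot.iff_of_mk_eq {r : α → α → Prop} (U : α → Prop) (h : ∀ a b, r a b → (U a ↔ U b))
    {a b : α} (hab : Quot.mk r a = Quot.mk r b) : U a ↔ U b :=
  iff_of_eq (congrArg (Quot.lift U fun a b hr => propext (h a b hr)) hab)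

/-- Mutually inverse (up to the relations) maps induce an equivalence of quotients. -/
def Quot.equivOfMaps {r : α → α → Prop} {s : β → β → Prop} (f : α → β) (g : β → α)
    (hf : ∀ a b, r a b → Quot.mk s (f a) = Quot.mk s (f b))
    (hg : ∀ a b, s a b → Quot.mk r (g a) = Quot.mk r (g b))
    (hgf : ∀ a, Quot.mk r (g (f a)) = Quot.mk r a)
    (hfg : ∀ b, Quot.mk s (f (g b)) = Quot.mk s b) : Quot r ≃ Quot s where
  toFun := Quot.lift (fun a => Quot.mk s (f a)) hf
  invFun := Quot.lift (fun b => Quot.mk r (g b)) hg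
  left_inv := by rintro ⟨a⟩; exact hgf a
  right_inv := by rintro ⟨b⟩; exact hfg b

theorem Quot.card_congr_rel {r s : α → α → Prop}
    (hrs : ∀ a b, r a b → Quot.mk s a = Quot.mk s b)
    (hsr : ∀ a b, s a b → Quot.mk r a = Quot.mk r b) :
    Nat.card (Quot r) = Nat.card (Quot s) :=
  Nat.card_congr (Quot.equivOfMaps id id hrs hsr (fun _ => rfl) fun _ => rfl)

theorem Quot.mk_eq_of_imp {r s : α → α → Prop}
    (hrs : ∀ a b, r a b → Quot.mk s a = Quot.mk s b) {a b : α} (h : Quot.mk r a = Quot.mk r b) :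
    Quot.mk s a = Quot.mk s b :=
  congrArg (Quot.lift (fun a => Quot.mk s a) hrs) h

/-- The coarser quotient is identified with the old classes other than that of `q`: the class of `q`
is sent to that of `p`, and all others stay. -/
theorem Quot.card_merge [Finite α] (r : α → α → Prop) (p q : α)
    (hpq : Quot.mk r p ≠ Quot.mk r q) :
    Nat.card (Quot r) = Nat.card (Quot fun a b => r a b ∨ (a = p ∧ b = q)) + 1 := by
  classical
  set r' : α → α → Prop := fun a b => r a b ∨ (a = p ∧ b = q) with hr'
  have key : Quot r' ≃ {c : Quot r // c ≠ Quot.mk r q} :=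
    { toFun := Quot.lift (fun a => if h : Quot.mk r a = Quot.mk r q then ⟨Quot.mk r p, hpq⟩
          else ⟨Quot.mk r a, h⟩) (by
        rintro a b (h | ⟨rfl, rfl⟩)
        · simp only [Quot.sound h]
        · simp [hpq])
      invFun := fun c => Quot.lift (fun a => Quot.mk r' a) (fun a b h => Quot.sound (Or.inl h)) c.1
      left_inv := by
        rintro ⟨a⟩
        by_cases h : Quot.mk r a = Quot.mk r q
        · simp only [h, dite_true]
          have h1 : Quot.mk r' a = Quot.mk r' q :=
            Quot.mk_eq_of_imp (fun a b h => Quot.sound (Or.inl h)) h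
          have h2 : Quot.mk r' p = Quot.mk r' q := Quot.sound (Or.inr ⟨rfl, rfl⟩)
          exact h2.trans h1.symm
        · simp only [h, dite_false]
      right_inv := by
        rintro ⟨⟨a⟩, h⟩
        exact dif_neg h }
  rw [Nat.card_congr key]
  have := Fintype.ofFinite (Quot r)
  have h0 : 0 < Nat.card (Quot r) := Nat.card_pos_iff.2 ⟨⟨Quot.mk r p⟩, inferInstance⟩
  rw [Nat.card_eq_fintype_card, Nat.card_eq_fintype_card, Fintype.card_subtype_compl,
    Fintype.card_subtype_eq]
  rw [Nat.card_eq_fintype_card] at h0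
  omega

theorem Quot.card_le_merge [Finite α] (r : α → α → Prop) (p q : α) :
    Nat.card (Quot r) ≤ Nat.card (Quot fun a b => r a b ∨ (a = p ∧ b = q)) + 1 := by
  by_cases hpq : Quot.mk r p = Quot.mk r q
  · have := Quot.card_congr_rel (r := r) (s := fun a b => r a b ∨ (a = p ∧ b = q))
      (fun a b h => Quot.sound (Or.inl h))
      (by rintro a b (h | ⟨rfl, rfl⟩); exacts [Quot.sound h, hpq])
    omega
  · exact (Quot.card_merge r p q hpq).le

theorem Quot.card_le_of_imp [Finite α] {r s : α → α → Prop}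
    (h : ∀ a b, r a b → Quot.mk s a = Quot.mk s b) :
    Nat.card (Quot s) ≤ Nat.card (Quot r) :=
  Nat.card_le_card_of_surjective (Quot.lift (fun a => Quot.mk s a) h)
    (by rintro ⟨a⟩; exact ⟨Quot.mk r a, rfl⟩)

/-- A finite set with a fixed-point free involution has even cardinality. -/
theorem even_ncard_of_involution [Finite α] (U : Set α) (f : α → α) (hf : ∀ x ∈ U, f x ∈ U)
    (hff : ∀ x ∈ U, f (f x) = x) (hne : ∀ x ∈ U, f x ≠ x) : Even U.ncard := by
  classical
  have := Fintype.ofFinite α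
  have h : ∑ _x ∈ U.toFinset, (1 : ZMod 2) = 0 :=
    Finset.sum_involution (fun x _ => f x) (fun _ _ => by decide)
      (fun x hx _ => hne x (by simpa using hx)) (fun x hx => by simpa using hf x (by simpa using hx))
      (fun x hx => hff x (by simpa using hx))
  rw [Set.ncard_eq_toFinset_card', ← ZMod.natCast_eq_zero_iff_even]
  simpa using h

end Quotients

/-! ### Ribbons as sets of four or two flags -/

namespace HERG

theorem v_inj (G : HERG) {x y : G.Flag} : G.v x = G.v y ↔ x = y :=
  ⟨fun h => by rw [← G.v_v x, h, G.v_v], fun h => h ▸ rfl⟩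
theorem h_inj (G : HERG) {x y : G.Flag} : G.h x = G.h y ↔ x = y :=
  ⟨fun h => by rw [← G.h_h x, h, G.h_h], fun h => h ▸ rfl⟩
theorem e_inj (G : HERG) {x y : G.Flag} : G.e x = G.e y ↔ x = y :=
  ⟨fun h => by rw [← G.e_e x, h, G.e_e], fun h => h ▸ rfl⟩

theorem isEdge_h (G : HERG) (x : G.Flag) : G.IsEdge (G.h x) ↔ G.IsEdge x := by
  rw [IsEdge, IsEdge, ← G.h_e, Ne, Ne, h_inj]

theorem isEdge_e (G : HERG) (x : G.Flag) : G.IsEdge (G.e x) ↔ G.IsEdge x := by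
  rw [IsEdge, IsEdge, G.e_e, Ne, Ne, G.h_e, ← G.e_inj, G.e_e, eq_comm]

theorem mem_ribbonFlags_self (G : HERG) (x : G.Flag) : x ∈ G.ribbonFlags x := Or.inl rfl

theorem ribbonOf_eq_iff (G : HERG) (x y : G.Flag) :
    G.ribbonOf y = G.ribbonOf x ↔ y ∈ G.ribbonFlags x := by
  constructor
  · intro h
    refine (Quot.iff_of_mk_eq (fun z => z ∈ G.ribbonFlags x) ?_ h).2 (G.mem_ribbonFlags_self x)
    rintro a b (rfl | rfl)
    · exact (G.h_mem_ribbonFlags_iff x a).symm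
    · exact (G.e_mem_ribbonFlags_iff x a).symm
  · rintro (rfl | rfl | rfl | rfl) <;> simp [ribbonOf_h, ribbonOf_e]

theorem isEdge_of_mem_ribbonFlags (G : HERG) {x y : G.Flag} (hy : y ∈ G.ribbonFlags x) :
    G.IsEdge y ↔ G.IsEdge x := by
  rcases hy with rfl | rfl | rfl | rfl <;> simp [isEdge_h, isEdge_e]

theorem ribbonFlags_ncard (G : HERG) (x : G.Flag) (hx : G.IsEdge x) :
    (G.ribbonFlags x).ncard = 4 := by
  classical
  have h1 := G.h_ne x
  have h2 := G.e_ne x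
  have h3 : G.e x ≠ G.h x := hx
  have h4 : G.h (G.e x) ≠ x := fun h => h3 (by rw [← G.h_h (G.e x), h])
  have h5 : G.h (G.e x) ≠ G.h x := fun h => h2 (G.h_inj.1 h)
  have h6 : G.h (G.e x) ≠ G.e x := G.h_ne _
  have : G.ribbonFlags x = ((({x, G.h x, G.e x, G.h (G.e x)} : Finset G.Flag)) : Set G.Flag) := by
    ext y; simp [ribbonFlags]
  rw [this, Set.ncard_coe_finset, Finset.card_insert_of_notMem, Finset.card_insert_of_notMem,
    Finset.card_insert_of_notMem, Finset.card_singleton] <;> simp_all [eq_comm]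

theorem ribbonFlags_ncard_half (G : HERG) (x : G.Flag) (hx : G.e x = G.h x) :
    (G.ribbonFlags x).ncard = 2 := by
  classical
  have : G.ribbonFlags x = {x, G.h x} := by
    ext y; simp [ribbonFlags, hx, G.h_h]; tauto
  rw [this, Set.ncard_pair (G.h_ne x).symm]

/-- Fibre the flags over their ribbons. Counting edges and half-ribbons thereby becomes counting
flags, which behave well under bijections, whereas ribbons are a quotient. -/
theorem card_subtype_ribbons (G : HERG) (p : G.Flag → Prop) (n : ℕ)
    (hp : ∀ x, p x → ∀ y ∈ G.ribbonFlags x, p y)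
    (hn : ∀ x, p x → (G.ribbonFlags x).ncard = n) :
    n * Nat.card {ρ : G.Ribbon // ∃ x, G.ribbonOf x = ρ ∧ p x} = Nat.card {x // p x} := by
  classical
  let f : {x // p x} → {ρ : G.Ribbon // ∃ x, G.ribbonOf x = ρ ∧ p x} :=
    fun x => ⟨G.ribbonOf x.1, x.1, rfl, x.2⟩
  rw [← Nat.card_congr (Equiv.sigmaFiberEquiv f)]
  have := Fintype.ofFinite {ρ : G.Ribbon // ∃ x, G.ribbonOf x = ρ ∧ p x}
  rw [Nat.card_sigma, Finset.sum_const_nat (m := n)]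
  · rw [Finset.card_univ, Nat.card_eq_fintype_card, mul_comm]
  · rintro ⟨ρ, x, rfl, hx⟩ -
    rw [← hn x hx, ← Nat.card_coe_set_eq]
    refine Nat.card_congr ⟨fun z => ⟨z.1.1, (G.ribbonOf_eq_iff _ _).1 (congrArg Subtype.val z.2)⟩,
      fun z => ⟨⟨z.1, hp x hx _ z.2⟩, Subtype.ext ((G.ribbonOf_eq_iff _ _).2 z.2)⟩,
      fun _ => rfl, fun _ => rfl⟩

theorem four_mul_numEdges (G : HERG) : 4 * G.numEdges = Nat.card {x // G.IsEdge x} :=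
  G.card_subtype_ribbons _ 4 (fun _ hx _ hy => (G.isEdge_of_mem_ribbonFlags hy).2 hx)
    G.ribbonFlags_ncard

theorem two_mul_numHalfRibbons (G : HERG) :
    2 * G.numHalfRibbons = Nat.card {x // G.e x = G.h x} :=
  G.card_subtype_ribbons _ 2
    (fun _ hx _ hy => not_not.1 fun h => (G.isEdge_of_mem_ribbonFlags hy).1 h hx)
    G.ribbonFlags_ncard_half

/-! ### Spanning subgraphs by sets of flags -/

/-- The set of flags of a set of edges. -/
def IsEdgeSet (G : HERG) (S : Set G.Flag) : Prop :=
  ∀ x ∈ S, G.h x ∈ S ∧ G.e x ∈ S ∧ G.IsEdge x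

/-- Cut all the edges that have no flag in `S`. -/
noncomputable def onFlags (G : HERG) (S : Set G.Flag) : HERG := G.keep (G.ribbonOf '' S)

theorem IsEdgeSet.h_mem_iff {G : HERG} {S : Set G.Flag} (hS : G.IsEdgeSet S) (x : G.Flag) :
    G.h x ∈ S ↔ x ∈ S := ⟨fun h => by simpa [G.h_h] using (hS _ h).1, fun h => (hS _ h).1⟩

theorem IsEdgeSet.e_mem_iff {G : HERG} {S : Set G.Flag} (hS : G.IsEdgeSet S) (x : G.Flag) :
    G.e x ∈ S ↔ x ∈ S := ⟨fun h => by simpa [G.e_e] using (hS _ h).2.1, fun h => (hS _ h).2.1⟩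

theorem IsEdgeSet.ribbonFlags_subset {G : HERG} {S : Set G.Flag} (hS : G.IsEdgeSet S) {x y : G.Flag}
    (hy : y ∈ G.ribbonFlags x) : y ∈ S ↔ x ∈ S := by
  rcases hy with rfl | rfl | rfl | rfl <;> simp [hS.h_mem_iff, hS.e_mem_iff]

theorem IsEdgeSet.ribbonOf_mem {G : HERG} {S : Set G.Flag} (hS : G.IsEdgeSet S) (x : G.Flag) :
    G.ribbonOf x ∈ G.ribbonOf '' S ↔ x ∈ S := by
  constructor
  · rintro ⟨y, hy, hyx⟩
    exact (hS.ribbonFlags_subset ((G.ribbonOf_eq_iff _ _).1 hyx)).1 hy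
  · exact fun h => ⟨x, h, rfl⟩

theorem onFlags_e_of_mem (G : HERG) {S : Set G.Flag} {x : G.Flag} (hx : x ∈ S) :
    (G.onFlags S).e x = G.e x := if_pos ⟨x, hx, rfl⟩

theorem onFlags_e_of_notMem {G : HERG} {S : Set G.Flag} (hS : G.IsEdgeSet S) {x : G.Flag}
    (hx : x ∉ S) : (G.onFlags S).e x = G.h x := if_neg (mt (hS.ribbonOf_mem x).1 hx)

open Classical in
theorem onFlags_e {G : HERG} {S : Set G.Flag} (hS : G.IsEdgeSet S) (x : G.Flag) :
    (G.onFlags S).e x = if x ∈ S then G.e x else G.h x := by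
  split_ifs with h
  · exact G.onFlags_e_of_mem h
  · exact onFlags_e_of_notMem hS h

theorem isEdge_onFlags {G : HERG} {S : Set G.Flag} (hS : G.IsEdgeSet S) (x : G.Flag) :
    (G.onFlags S).IsEdge x ↔ x ∈ S := by
  by_cases h : x ∈ S
  · exact iff_of_true (by unfold IsEdge; rw [G.onFlags_e_of_mem h]; exact (hS x h).2.2) h
  · refine iff_of_false (fun h' => h' ?_) h
    rw [onFlags_e_of_notMem hS h]; rfl

/-- The sets of flags of the sets of edges. -/
noncomputable def edgeSets (G : HERG) : Finset (Set G.Flag) := (Set.toFinite {S | G.IsEdgeSet S}).toFinset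

@[simp] theorem mem_edgeSets (G : HERG) (S : Set G.Flag) : S ∈ G.edgeSets ↔ G.IsEdgeSet S := by
  simp [edgeSets]

/-- The weight of a spanning subgraph `A` of `G` in the polynomial of `G`. -/
noncomputable def weight {R : Type*} [CommRing R] (ρ : ℕ) (A : HERG) (x y z s w t : R) : R :=
  (x - 1) ^ (ρ - A.rank) * (y - 1) ^ A.nullity *
      z ^ (A.numComponents + A.nullity - A.numClosedFaces) *
      s ^ A.numBoundary * w ^ A.nonorientability * t ^ A.numHalfRibbons

/-- States are indexed by sets of flags instead of sets of ribbons: flags can be transported along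
contraction, cut, insertion and disjoint union by plain images and preimages. -/
theorem brPoly_eq_sum {R : Type*} [CommRing R] (G : HERG) (x y z s w t : R) :
    G.brPoly x y z s w t = ∑ S ∈ G.edgeSets, weight G.rank (G.onFlags S) x y z s w t := by
  classical
  refine Finset.sum_bij' (fun A _ => {z | ∃ a ∈ A, a.1 = G.ribbonOf z})
    (fun S _ => Finset.univ.filter fun a => a.1 ∈ G.ribbonOf '' S) ?_ (fun _ _ => Finset.mem_univ _)
    ?_ ?_ ?_
  · intro A _
    rw [mem_edgeSets]
    rintro z ⟨a, ha, haz⟩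
    refine ⟨⟨a, ha, by rw [haz, ribbonOf_h]⟩, ⟨a, ha, by rw [haz, ribbonOf_e]⟩, ?_⟩
    obtain ⟨y, hy, hy'⟩ := a.2
    exact (G.isEdge_of_mem_ribbonFlags ((G.ribbonOf_eq_iff _ _).1 (haz.symm.trans hy.symm))).2 hy'
  · intro A _
    ext a
    simp only [Finset.mem_filter, Finset.mem_univ, true_and, Set.mem_image, Set.mem_ofPred_eq]
    constructor
    · rintro ⟨z, ⟨b, hb, hbz⟩, hz⟩
      have : b = a := Subtype.ext (hbz.trans hz)
      exact this ▸ hb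
    · intro ha
      obtain ⟨y, hy, -⟩ := a.2
      exact ⟨y, ⟨a, ha, hy.symm⟩, hy⟩
  · intro S hS
    rw [mem_edgeSets] at hS
    ext z
    simp only [Finset.mem_filter, Finset.mem_univ, true_and, Set.mem_ofPred_eq]
    constructor
    · rintro ⟨a, ha, haz⟩
      exact (hS.ribbonOf_mem z).1 (haz ▸ ha)
    · intro hz
      exact ⟨⟨G.ribbonOf z, z, rfl, (hS z hz).2.2⟩, ⟨z, hz, rfl⟩, rfl⟩
  · intro A _
    have : G.spanning A = G.onFlags {z | ∃ a ∈ A, a.1 = G.ribbonOf z} := by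
      unfold spanning onFlags
      congr 1
      ext ρ
      constructor
      · rintro ⟨a, ha, rfl⟩
        obtain ⟨y, hy, -⟩ := a.2
        exact ⟨y, ⟨a, ha, hy.symm⟩, hy⟩
      · rintro ⟨z, ⟨a, ha, haz⟩, rfl⟩
        exact ⟨a, ha, haz⟩
    rw [← this]; rfl

end HERG

namespace HERG

/-! ### Numerical invariants and isomorphisms -/

/-- The numbers that enter the polynomial coincide. -/
structure SameNumbers (A B : HERG) : Prop where
  vertices : A.numVertices = B.numVertices
  components : A.numComponents = B.numComponents
  edges : A.numEdges = B.numEdges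
  closedFaces : A.numClosedFaces = B.numClosedFaces
  boundary : A.numBoundary = B.numBoundary
  nonorientability : A.nonorientability = B.nonorientability
  halfRibbons : A.numHalfRibbons = B.numHalfRibbons

theorem SameNumbers.rank {A B : HERG} (h : SameNumbers A B) : A.rank = B.rank := by
  unfold HERG.rank; rw [h.vertices, h.components]

theorem SameNumbers.nullity {A B : HERG} (h : SameNumbers A B) : A.nullity = B.nullity := by
  unfold HERG.nullity; rw [h.edges, h.rank]

theorem SameNumbers.weight {R : Type*} [CommRing R] {A B : HERG} (h : SameNumbers A B) (ρ : ℕ)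
    (x y z s w t : R) : weight ρ A x y z s w t = HERG.weight ρ B x y z s w t := by
  unfold HERG.weight
  rw [h.rank, h.nullity, h.components, h.closedFaces, h.boundary, h.nonorientability,
    h.halfRibbons]

theorem nonorientability_congr {A B : HERG} (h : A.Orientable ↔ B.Orientable) :
    A.nonorientability = B.nonorientability := by
  unfold nonorientability
  by_cases hA : A.Orientable
  · rw [if_pos hA, if_pos (h.1 hA)]
  · rw [if_neg hA, if_neg (mt h.2 hA)]

theorem Iso.sameNumbers {G H : HERG} (hGH : G.Iso H) : SameNumbers G H := by
  obtain ⟨hi, φ, hφ⟩ := hGH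
  have hv := fun x => (hφ x).1
  have hh := fun x => (hφ x).2.1
  have he := fun x => (hφ x).2.2
  let ψ : G.Face ≃ H.Face := Quot.congr φ fun a b => by
    simp only [← hv, ← he, φ.apply_eq_iff_eq]
  have hext : ∀ f, G.IsExternal f ↔ H.IsExternal (ψ f) := by
    intro f
    constructor
    · rintro ⟨x, rfl, hx⟩
      exact ⟨φ x, rfl, by rw [← he, ← hh, hx]⟩
    · rintro ⟨x, hx, hx'⟩
      refine ⟨φ.symm x, ψ.injective ?_, φ.injective ?_⟩
      · rw [← hx]
        change H.faceOf (φ (φ.symm x)) = _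
        rw [φ.apply_symm_apply]
      · rw [he, hh, φ.apply_symm_apply, hx']
  refine ⟨?_, ?_, ?_, ?_, ?_, ?_, ?_⟩
  · unfold numVertices
    rw [hi]
    congr 1
    exact Nat.card_congr (Quot.congr φ fun a b => by simp only [← hv, ← hh, φ.apply_eq_iff_eq])
  · unfold numComponents
    rw [hi]
    congr 1
    exact Nat.card_congr (Quot.congr φ fun a b => by
      simp only [← hv, ← hh, ← he, φ.apply_eq_iff_eq])
  · have h1 := G.four_mul_numEdges
    have h2 := H.four_mul_numEdges
    have h3 : Nat.card {x // G.IsEdge x} = Nat.card {x // H.IsEdge x} :=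
      Nat.card_congr (φ.subtypeEquiv fun x => by
        unfold IsEdge; rw [← he, ← hh, Ne, Ne, φ.apply_eq_iff_eq])
    omega
  · unfold numClosedFaces
    rw [hi]
    congr 1
    exact Nat.card_congr (ψ.subtypeEquiv fun f => not_congr (hext f))
  · exact Nat.card_congr (ψ.subtypeEquiv hext)
  · refine nonorientability_congr ⟨?_, ?_⟩
    · rintro ⟨c, hc⟩
      refine ⟨fun x => c (φ.symm x), fun x => ?_⟩
      obtain ⟨y, rfl⟩ := φ.surjective x
      simpa [← hv, ← hh, ← he] using hc y
    · rintro ⟨c, hc⟩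
      refine ⟨fun x => c (φ x), fun x => ?_⟩
      simpa [hv, hh, he] using hc (φ x)
  · have h1 := G.two_mul_numHalfRibbons
    have h2 := H.two_mul_numHalfRibbons
    have h3 : Nat.card {x // G.e x = G.h x} = Nat.card {x // H.e x = H.h x} :=
      Nat.card_congr (φ.subtypeEquiv fun x => by rw [← he, ← hh, φ.apply_eq_iff_eq])
    omega

/-- A map of flags that preserves `h` and `e`. -/
structure RibbonMap (G H : HERG) (φ : G.Flag → H.Flag) : Prop where
  h : ∀ x, φ (G.h x) = H.h (φ x)
  e : ∀ x, φ (G.e x) = H.e (φ x)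
  inj : Function.Injective φ

theorem RibbonMap.isEdge {G H : HERG} {φ : G.Flag → H.Flag} (hφ : RibbonMap G H φ) (x : G.Flag) :
    H.IsEdge (φ x) ↔ G.IsEdge x := by
  unfold IsEdge; rw [← hφ.h, ← hφ.e, hφ.inj.ne_iff]

theorem RibbonMap.image {G H : HERG} {φ : G.Flag → H.Flag} (hφ : RibbonMap G H φ)
    {S : Set G.Flag} (hS : G.IsEdgeSet S) : H.IsEdgeSet (φ '' S) := by
  rintro _ ⟨x, hx, rfl⟩
  exact ⟨⟨_, (hS x hx).1, hφ.h x⟩, ⟨_, (hS x hx).2.1, hφ.e x⟩, (hφ.isEdge x).2 (hS x hx).2.2⟩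

theorem RibbonMap.preimage {G H : HERG} {φ : G.Flag → H.Flag} (hφ : RibbonMap G H φ)
    {S : Set H.Flag} (hS : H.IsEdgeSet S) : G.IsEdgeSet (φ ⁻¹' S) := by
  intro x hx
  refine ⟨?_, ?_, (hφ.isEdge x).1 (hS _ hx).2.2⟩
  · rw [Set.mem_preimage, hφ.h]; exact (hS _ hx).1
  · rw [Set.mem_preimage, hφ.e]; exact (hS _ hx).2.1

theorem RibbonMap.onFlags_e {G H : HERG} {φ : G.Flag → H.Flag} (hφ : RibbonMap G H φ)
    {S : Set G.Flag} (hS : G.IsEdgeSet S) (x : G.Flag) :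
    φ ((G.onFlags S).e x) = (H.onFlags (φ '' S)).e (φ x) := by
  classical
  rw [HERG.onFlags_e hS, HERG.onFlags_e (hφ.image hS), hφ.inj.mem_set_image]
  split_ifs
  exacts [hφ.e x, hφ.h x]

/-- If all edges of `H` come from `G` then the edge sets correspond to each other. -/
theorem RibbonMap.sum_edgeSets {R : Type*} [AddCommMonoid R] {G H : HERG} {φ : G.Flag → H.Flag}
    (hφ : RibbonMap G H φ) (hr : ∀ y, H.IsEdge y → y ∈ Set.range φ) (f : Set H.Flag → R) :
    ∑ S ∈ H.edgeSets, f S = ∑ S ∈ G.edgeSets, f (φ '' S) := by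
  have key : ∀ S ∈ H.edgeSets, φ '' (φ ⁻¹' S) = S := fun S hS =>
    Set.image_preimage_eq_of_subset fun y hy => hr y (((mem_edgeSets _ _).1 hS) y hy).2.2
  refine Finset.sum_bij' (fun S _ => φ ⁻¹' S) (fun S _ => φ '' S)
    (fun S hS => (mem_edgeSets _ _).2 (hφ.preimage ((mem_edgeSets _ _).1 hS)))
    (fun S hS => (mem_edgeSets _ _).2 (hφ.image ((mem_edgeSets _ _).1 hS)))
    key (fun S _ => Set.preimage_image_eq S hφ.inj) (fun S hS => by rw [key S hS])

theorem Iso.brPoly_eq {R : Type*} [CommRing R] {G H : HERG} (hGH : G.Iso H) (x y z s w t : R) :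
    G.brPoly x y z s w t = H.brPoly x y z s w t := by
  have hr := hGH.sameNumbers.rank
  obtain ⟨hi, φ, hφ⟩ := hGH
  have hm : RibbonMap G H φ := ⟨fun x => (hφ x).2.1, fun x => (hφ x).2.2, φ.injective⟩
  rw [brPoly_eq_sum, brPoly_eq_sum, hm.sum_edgeSets fun y _ => φ.surjective y, hr]
  refine Finset.sum_congr rfl fun S hS => SameNumbers.weight (Iso.sameNumbers ?_) _ _ _ _ _ _ _
  exact ⟨hi, φ, fun x => ⟨(hφ x).1, (hφ x).2.1, hm.onFlags_e ((mem_edgeSets _ _).1 hS) x⟩⟩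

/-! ### Insertion of half-ribbons -/

theorem insertHR_v_of_ne (K : HERG) {y x : K.Flag} (h1 : x ≠ y) (h2 : x ≠ K.v y) :
    (K.insertHR y).v (Sum.inl x) = Sum.inl (K.v x) := by
  simp [insertHR, h1, h2]

theorem insertHR_v_self (K : HERG) (y : K.Flag) :
    (K.insertHR y).v (Sum.inl y) = Sum.inr false := by
  simp [insertHR]

theorem insertHR_v_v (K : HERG) (y : K.Flag) :
    (K.insertHR y).v (Sum.inl (K.v y)) = Sum.inr true := by
  simp [insertHR, K.v_ne]

section

variable (K : HERG) (y : K.Flag) {r : K.Flag → K.Flag → Prop}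
  {r' : (K.insertHR y).Flag → (K.insertHR y).Flag → Prop}

/-- Inserting a half-ribbon does not change the orbits. -/
def insertQuotEquiv (hr : ∀ a, r a (K.v a))
    (hr' : ∀ a, r' a ((K.insertHR y).v a)) (h1 : ∀ a b, r a b → b = K.v a ∨ r' (.inl a) (.inl b))
    (h2 : ∀ a b, r' a b → b = (K.insertHR y).v a ∨ (∃ c d, a = .inl c ∧ b = .inl d ∧ r c d) ∨
      ∃ i, a = .inr i ∧ b = .inr (!i))
    (h3 : r' (.inr false) (.inr true)) : Quot r ≃ Quot r' := by
  -- In the inverse direction both flags of the new half-ribbon are sent to `y`.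
  refine Quot.equivOfMaps Sum.inl (Sum.elim id fun _ => y) ?_ ?_ (fun _ => rfl) ?_
  · intro a b hab
    -- The arc from `y` to `K.v y` is interrupted, but the detour through the new half-ribbon still
    -- connects its end points.
    have hy : Quot.mk r' (.inl y) = Quot.mk r' (.inl (K.v y)) := by
      have e1 := Quot.sound (hr' (.inl y))
      have e2 := Quot.sound (hr' (.inl (K.v y)))
      rw [insertHR_v_self] at e1
      rw [insertHR_v_v] at e2
      exact e1.trans ((Quot.sound h3).trans e2.symm)
    rcases h1 a b hab with rfl | h
    · by_cases ha : a = y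
      · rw [ha]; exact hy
      · by_cases hb : a = K.v y
        · rw [hb, K.v_v]; exact hy.symm
        · have e1 := Quot.sound (hr' (.inl a))
          rwa [insertHR_v_of_ne K ha hb] at e1
    · exact Quot.sound h
  · intro a b hab
    rcases h2 a b hab with rfl | ⟨c, d, rfl, rfl, h⟩ | ⟨i, rfl, rfl⟩
    · rcases a with a | i
      · by_cases ha : a = y
        · rw [ha, insertHR_v_self]; rfl
        · by_cases hb : a = K.v y
          · rw [hb, insertHR_v_v]; exact (Quot.sound (hr y)).symm
          · rw [insertHR_v_of_ne K ha hb]; exact Quot.sound (hr a)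
      · cases i
        · rfl
        · exact Quot.sound (hr y)
    · exact Quot.sound h
    · rfl
  · rintro (a | i)
    · rfl
    · have e1 := Quot.sound (hr' (.inl y))
      rw [insertHR_v_self] at e1
      cases i
      · exact e1
      · exact e1.trans (Quot.sound h3)

end

theorem numVertices_insertHR (K : HERG) (y : K.Flag) :
    (K.insertHR y).numVertices = K.numVertices := by
  refine congrArg (· + K.isolated) (Nat.card_congr (insertQuotEquiv K y ?_ ?_ ?_ ?_ ?_)).symm
  · exact fun a => Or.inl rfl
  · exact fun a => Or.inl rfl
  · rintro a b (rfl | rfl)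
    exacts [Or.inl rfl, Or.inr (Or.inr rfl)]
  · rintro (a | a) b (rfl | rfl)
    · exact Or.inl rfl
    · exact Or.inr (Or.inl ⟨a, K.h a, rfl, rfl, Or.inr rfl⟩)
    · exact Or.inl rfl
    · exact Or.inr (Or.inr ⟨a, rfl, rfl⟩)
  · exact Or.inr rfl

theorem numComponents_insertHR (K : HERG) (y : K.Flag) :
    (K.insertHR y).numComponents = K.numComponents := by
  refine congrArg (· + K.isolated) (Nat.card_congr (insertQuotEquiv K y ?_ ?_ ?_ ?_ ?_)).symm
  · exact fun a => Or.inl rfl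
  · exact fun a => Or.inl rfl
  · rintro a b (rfl | rfl | rfl)
    exacts [Or.inl rfl, Or.inr (Or.inr (Or.inl rfl)), Or.inr (Or.inr (Or.inr rfl))]
  · rintro (a | a) b (rfl | rfl | rfl)
    · exact Or.inl rfl
    · exact Or.inr (Or.inl ⟨a, K.h a, rfl, rfl, Or.inr (Or.inl rfl)⟩)
    · exact Or.inr (Or.inl ⟨a, K.e a, rfl, rfl, Or.inr (Or.inr rfl)⟩)
    · exact Or.inl rfl
    · exact Or.inr (Or.inr ⟨a, rfl, rfl⟩)
    · exact Or.inr (Or.inr ⟨a, rfl, rfl⟩)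
  · exact Or.inr (Or.inl rfl)

/-- The faces of `K` and of `K` with an additional half-ribbon. -/
def insertFaceEquiv (K : HERG) (y : K.Flag) : K.Face ≃ (K.insertHR y).Face := by
  refine insertQuotEquiv K y ?_ ?_ ?_ ?_ ?_
  · exact fun a => Or.inl rfl
  · exact fun a => Or.inl rfl
  · rintro a b (rfl | rfl)
    exacts [Or.inl rfl, Or.inr (Or.inr rfl)]
  · rintro (a | a) b (rfl | rfl)
    · exact Or.inl rfl
    · exact Or.inr (Or.inl ⟨a, K.e a, rfl, rfl, Or.inr rfl⟩)
    · exact Or.inl rfl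
    · exact Or.inr (Or.inr ⟨a, rfl, rfl⟩)
  · exact Or.inr rfl

theorem insertFaceEquiv_faceOf (K : HERG) (y x : K.Flag) :
    insertFaceEquiv K y (K.faceOf x) = (K.insertHR y).faceOf (.inl x) := rfl

/-- Only the circle that receives the half-ribbon can change its type, from closed to external. -/
theorem isExternal_insertFaceEquiv (K : HERG) (y : K.Flag) (f : K.Face) :
    (K.insertHR y).IsExternal (insertFaceEquiv K y f) ↔ f = K.faceOf y ∨ K.IsExternal f := by
  have hf : (K.insertHR y).faceOf (.inr false) = (K.insertHR y).faceOf (.inl y) :=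
    Quot.sound (Or.inl rfl)
  have ht : (K.insertHR y).faceOf (.inr true) = (K.insertHR y).faceOf (.inr false) :=
    Quot.sound (Or.inr rfl)
  constructor
  · rintro ⟨a | i, hx, hx'⟩
    · refine Or.inr ⟨a, (insertFaceEquiv K y).injective hx, Sum.inl_injective hx'⟩
    · refine Or.inl ((insertFaceEquiv K y).injective ?_)
      rw [← hx, insertFaceEquiv_faceOf]
      cases i
      exacts [hf, ht.trans hf]
  · rintro (rfl | ⟨a, rfl, ha⟩)
    · exact ⟨.inr false, hf, rfl⟩
    · exact ⟨.inl a, rfl, congrArg Sum.inl ha⟩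

/-- The detour through the new half-ribbon changes the colour three times, the arc that it replaces
once; the parity is the same. -/
theorem orientable_insertHR (K : HERG) (y : K.Flag) :
    (K.insertHR y).Orientable ↔ K.Orientable := by
  constructor
  · rintro ⟨c, hc⟩
    refine ⟨fun x => c (.inl x), fun x => ⟨?_, (hc (.inl x)).2.1, (hc (.inl x)).2.2⟩⟩
    have e1 := (hc (.inl y)).1
    have e2 := (hc (.inl (K.v y))).1
    have e3 := (hc (.inr false)).2.1
    rw [insertHR_v_self] at e1
    rw [insertHR_v_v] at e2
    change c (.inr true) = _ at e3
    have e4 : c (.inl (K.v y)) = !c (.inl y) := by rw [e3, e1] at e2; simpa using e2.symm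
    by_cases ha : x = y
    · rw [ha]; exact e4
    · by_cases hb : x = K.v y
      · rw [hb, K.v_v]
        change c (.inl y) = !c (.inl (K.v y))
        rw [e4, Bool.not_not]
      · have := (hc (.inl x)).1
        rwa [insertHR_v_of_ne K ha hb] at this
  · rintro ⟨c, hc⟩
    refine ⟨Sum.elim c (fun b => if b then c y else !c y), ?_⟩
    rintro (x | i)
    · refine ⟨?_, (hc x).2.1, (hc x).2.2⟩
      by_cases ha : x = y
      · rw [ha, insertHR_v_self]; rfl
      · by_cases hb : x = K.v y
        · rw [hb, insertHR_v_v]; simp [(hc y).1]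
        · rw [insertHR_v_of_ne K ha hb]; exact (hc x).1
    · cases i <;> simp [insertHR, (hc y).1]

theorem numEdges_insertHR (K : HERG) (y : K.Flag) : (K.insertHR y).numEdges = K.numEdges := by
  have h1 := K.four_mul_numEdges
  have h2 := (K.insertHR y).four_mul_numEdges
  have h3 : Nat.card {x // K.IsEdge x} = Nat.card {x // (K.insertHR y).IsEdge x} := by
    refine Nat.card_congr ⟨fun x => ⟨.inl x.1, fun h => x.2 (Sum.inl_injective h)⟩,
      fun x => match x with
        | ⟨.inl a, ha⟩ => ⟨a, fun h => ha (congrArg Sum.inl h)⟩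
        | ⟨.inr i, hi⟩ => (hi rfl).elim, fun x => rfl, ?_⟩
    rintro ⟨a | i, hi⟩
    exacts [rfl, (hi rfl).elim]
  omega

theorem numHalfRibbons_insertHR (K : HERG) (y : K.Flag) :
    (K.insertHR y).numHalfRibbons = K.numHalfRibbons + 1 := by
  have h1 := K.two_mul_numHalfRibbons
  have h2 := (K.insertHR y).two_mul_numHalfRibbons
  have h3 : Nat.card {x // (K.insertHR y).e x = (K.insertHR y).h x} =
      Nat.card ({x // K.e x = K.h x} ⊕ Bool) := by
    refine Nat.card_congr ⟨fun x => match x with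
        | ⟨.inl a, ha⟩ => .inl ⟨a, Sum.inl_injective ha⟩
        | ⟨.inr i, _⟩ => .inr i,
      Sum.elim (fun x => ⟨.inl x.1, congrArg Sum.inl x.2⟩) (fun i => ⟨.inr i, rfl⟩), ?_, ?_⟩
    · rintro ⟨a | i, hi⟩ <;> rfl
    · rintro (a | i) <;> rfl
  rw [Nat.card_sum] at h3
  simp at h3
  omega

/-- The condition on the old and the new place of a half-ribbon that is moved. -/
def Movable (K : HERG) (y y' : K.Flag) : Prop :=
  K.faceOf y = K.faceOf y' ∨ (K.IsExternal (K.faceOf y) ∧ K.IsExternal (K.faceOf y'))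

/-- The circles of both graphs are those of `K`. The external ones also agree: either the same
circle receives the half-ribbon, or the receiving circles were external already. -/
theorem sameNumbers_insertHR (K : HERG) {y y' : K.Flag} (h : K.Movable y y') :
    SameNumbers (K.insertHR y) (K.insertHR y') := by
  have hext : ∀ f : K.Face, (K.insertHR y).IsExternal (insertFaceEquiv K y f) ↔
      (K.insertHR y').IsExternal (insertFaceEquiv K y' f) := by
    intro f
    rw [isExternal_insertFaceEquiv, isExternal_insertFaceEquiv]
    rcases h with h | ⟨h1, h2⟩
    · rw [h]
    · constructor
      · rintro (rfl | h); exacts [Or.inr h1, Or.inr h]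
      · rintro (rfl | h); exacts [Or.inr h2, Or.inr h]
  let ψ := (insertFaceEquiv K y).symm.trans (insertFaceEquiv K y')
  have hψ : ∀ f, (K.insertHR y).IsExternal f ↔ (K.insertHR y').IsExternal (ψ f) := by
    intro f
    simpa [ψ] using hext ((insertFaceEquiv K y).symm f)
  exact ⟨by simp only [numVertices_insertHR], by simp only [numComponents_insertHR],
    by simp only [numEdges_insertHR],
    congrArg (· + K.isolated) (Nat.card_congr (ψ.subtypeEquiv fun f => not_congr (hψ f))),
    Nat.card_congr (ψ.subtypeEquiv hψ),
    nonorientability_congr (by simp only [orientable_insertHR]),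
    by simp only [numHalfRibbons_insertHR]⟩

/-- A circle that is closed after cutting passes no cut ribbon, so it is a complete circle of `K`
and contains everything that shared a circle with `y` there. -/
theorem isExternal_of_isExternal_onFlags {K : HERG} {y y' : K.Flag} {S : Set K.Flag}
    (hS : K.IsEdgeSet S) (h : K.faceOf y = K.faceOf y')
    (hy : ¬ (K.onFlags S).IsExternal ((K.onFlags S).faceOf y)) :
    (K.onFlags S).faceOf y = (K.onFlags S).faceOf y' := by
  have key : ∀ a : K.Flag, (K.onFlags S).faceOf a = (K.onFlags S).faceOf y → a ∈ S := by
    intro a ha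
    by_contra hn
    exact hy ⟨a, ha, onFlags_e_of_notMem hS hn⟩
  refine ((Quot.iff_of_mk_eq (fun a => (K.onFlags S).faceOf a = (K.onFlags S).faceOf y) ?_ h).1
    rfl).symm
  have hv : ∀ a : K.Flag, (K.onFlags S).faceOf a = (K.onFlags S).faceOf (K.v a) :=
    fun a => Quot.sound (Or.inl rfl)
  have he : ∀ a ∈ S, (K.onFlags S).faceOf a = (K.onFlags S).faceOf (K.e a) :=
    fun a ha => Quot.sound (Or.inr (K.onFlags_e_of_mem ha).symm)
  rintro a b (rfl | rfl)
  · rw [hv a]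
  · constructor
    · intro ha; rw [← he a (key a ha), ha]
    · intro ha; rw [he a ((hS.e_mem_iff a).1 (key _ ha)), ha]

theorem IsExternal.onFlags {K : HERG} {y : K.Flag} {S : Set K.Flag}
    (hS : K.IsEdgeSet S) (h : K.IsExternal (K.faceOf y)) :
    (K.onFlags S).IsExternal ((K.onFlags S).faceOf y) := by
  by_contra hy
  obtain ⟨a, ha, ha'⟩ := h
  refine hy ⟨a, (isExternal_of_isExternal_onFlags hS ha.symm hy).symm, ?_⟩
  rw [onFlags_e_of_notMem hS fun h => (hS a h).2.2 ha']; rfl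

/-- If the common circle of `y` and `y'` survives the cutting as a closed circle, both places are
still on it. Otherwise both now lie on external circles, and the displacement turns into a jump.
Hence moves pass to all spanning subgraphs. -/
theorem Movable.onFlags {K : HERG} {y y' : K.Flag} (h : K.Movable y y') {S : Set K.Flag}
    (hS : K.IsEdgeSet S) : (K.onFlags S).Movable y y' := by
  rcases h with h | ⟨h, h'⟩
  · by_cases hy : (K.onFlags S).IsExternal ((K.onFlags S).faceOf y)
    · by_cases hy' : (K.onFlags S).IsExternal ((K.onFlags S).faceOf y')
      · exact Or.inr ⟨hy, hy'⟩
      · exact Or.inl (isExternal_of_isExternal_onFlags hS h.symm hy').symm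
    · exact Or.inl (isExternal_of_isExternal_onFlags hS h hy)
  · exact Or.inr ⟨h.onFlags hS, h'.onFlags hS⟩

theorem ribbonMap_insertHR (K : HERG) (y : K.Flag) : RibbonMap K (K.insertHR y) Sum.inl :=
  ⟨fun _ => rfl, fun _ => rfl, Sum.inl_injective⟩

theorem onFlags_insertHR_iso (K : HERG) (y : K.Flag) {S : Set K.Flag} (hS : K.IsEdgeSet S) :
    ((K.insertHR y).onFlags (Sum.inl '' S)).Iso ((K.onFlags S).insertHR y) := by
  refine ⟨rfl, Equiv.refl _, fun a => ⟨rfl, rfl, ?_⟩⟩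
  have hm := K.ribbonMap_insertHR y
  rcases a with a | i
  · exact (hm.onFlags_e hS a).symm
  · exact onFlags_e_of_notMem (hm.image hS) (by rintro ⟨a, -, ha⟩; cases ha)

/-- Insertion creates no edges and commutes with cutting, so the states of the two graphs correspond
and have equal weights term by term. -/
theorem brPoly_insertHR {R : Type*} [CommRing R] (K : HERG) {y y' : K.Flag} (h : K.Movable y y')
    (x₁ x₂ x₃ x₄ x₅ x₆ : R) : (K.insertHR y).brPoly x₁ x₂ x₃ x₄ x₅ x₆ =
      (K.insertHR y').brPoly x₁ x₂ x₃ x₄ x₅ x₆ := by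
  have hr : ∀ y : K.Flag, ∀ z, (K.insertHR y).IsEdge z → z ∈ Set.range Sum.inl := by
    rintro y (a | i) hz
    exacts [⟨a, rfl⟩, (hz rfl).elim]
  rw [brPoly_eq_sum, brPoly_eq_sum, (K.ribbonMap_insertHR y).sum_edgeSets (hr y),
    (K.ribbonMap_insertHR y').sum_edgeSets (hr y'), (K.sameNumbers_insertHR h).rank]
  refine Finset.sum_congr rfl fun S hS => ?_
  have hS' := (mem_edgeSets _ _).1 hS
  rw [(K.onFlags_insertHR_iso y hS').sameNumbers.weight,
    (K.onFlags_insertHR_iso y' hS').sameNumbers.weight,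
    ((K.onFlags S).sameNumbers_insertHR (h.onFlags hS')).weight]

theorem eq_of_hrEquiv {X : Sort*} (f : HERG → X) (h1 : ∀ G H : HERG, G.Iso H → f G = f H)
    (h2 : ∀ (K : HERG) (y y' : K.Flag), K.Movable y y' → f (K.insertHR y) = f (K.insertHR y'))
    {G H : HERG} (h : HRClass.of G = HRClass.of H) : f G = f H := by
  have h' : Relation.EqvGen (fun G G' : HERG => G.Iso G' ∨ HRMove G G') G H := Quotient.exact h
  clear h
  induction h' with
  | rel G H h =>
    rcases h with h | ⟨K, y, y', hG, hH, hm⟩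
    · exact h1 _ _ h
    · rw [h1 _ _ hG, h1 _ _ hH, h2 K y y' hm]
  | refl G => rfl
  | symm G H h ih => exact ih.symm
  | trans G H K h h' ih ih' => exact ih.trans ih'

theorem Iso.of_eq {G H : HERG} (h : G.Iso H) : HRClass.of G = HRClass.of H :=
  Quotient.sound (Relation.EqvGen.rel _ _ (Or.inl h))

theorem numComponents_eq_of_class {G H : HERG} (h : HRClass.of G = HRClass.of H) :
    G.numComponents = H.numComponents :=
  eq_of_hrEquiv numComponents (fun _ _ h => h.sameNumbers.components)
    (fun K _ _ h => (K.sameNumbers_insertHR h).components) h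

theorem numVertices_eq_of_class {G H : HERG} (h : HRClass.of G = HRClass.of H) :
    G.numVertices = H.numVertices :=
  eq_of_hrEquiv numVertices (fun _ _ h => h.sameNumbers.vertices)
    (fun K _ _ h => (K.sameNumbers_insertHR h).vertices) h

theorem numEdges_eq_of_class {G H : HERG} (h : HRClass.of G = HRClass.of H) :
    G.numEdges = H.numEdges :=
  eq_of_hrEquiv numEdges (fun _ _ h => h.sameNumbers.edges)
    (fun K _ _ h => (K.sameNumbers_insertHR h).edges) h

theorem brPoly_eq_of_class {R : Type*} [CommRing R] (x y z s w t : R) {G H : HERG}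
    (h : HRClass.of G = HRClass.of H) : G.brPoly x y z s w t = H.brPoly x y z s w t :=
  eq_of_hrEquiv (fun G => G.brPoly x y z s w t) (fun _ _ h => h.brPoly_eq _ _ _ _ _ _)
    (fun K _ _ h => K.brPoly_insertHR h _ _ _ _ _ _) h

end HERG

/-! ### Quotients and subsets -/

section Quotients

variable {α : Type*}

theorem Quot.sound_symm {r : α → α → Prop} {a b : α} (h : r a b) : Quot.mk r b = Quot.mk r a :=
  (Quot.sound h).symm

/-- A walk along `s` that starts at `a` is a walk along `r` as long as it is in `S`, and the
`r`-class of `a` never leaves `S`. -/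
theorem Quot.class_subset_congr {r s : α → α → Prop} {S : Set α}
    (h1 : ∀ a b, a ∈ S → s a b → r a b) (h2 : ∀ a b, b ∈ S → s a b → r a b)
    {a : α} (ha : ∀ b, Quot.mk r b = Quot.mk r a → b ∈ S) {b : α}
    (hb : Quot.mk s b = Quot.mk s a) : Quot.mk r b = Quot.mk r a := by
  refine (Quot.iff_of_mk_eq (fun b => Quot.mk r b = Quot.mk r a) ?_ hb).2 rfl
  intro b c hbc
  constructor
  · intro h; rw [← h]; exact (Quot.sound (h1 _ _ (ha _ h) hbc)).symm
  · intro h; rw [← h]; exact Quot.sound (h2 _ _ (ha _ h) hbc)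

/-- The number of classes inside `S` only depends on the relation near `S`. -/
theorem Quot.card_classes_inside_congr {r s : α → α → Prop} {S : Set α}
    (h1 : ∀ a b, a ∈ S → (r a b ↔ s a b)) (h2 : ∀ a b, b ∈ S → (r a b ↔ s a b)) :
    Nat.card {f : Quot r // ∀ y, Quot.mk r y = f → y ∈ S} =
      Nat.card {f : Quot s // ∀ y, Quot.mk s y = f → y ∈ S} := by
  have key : ∀ {r s : α → α → Prop}, (∀ a b, a ∈ S → (r a b ↔ s a b)) →
      (∀ a b, b ∈ S → (r a b ↔ s a b)) → ∀ a, (∀ b, Quot.mk r b = Quot.mk r a → b ∈ S) →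
      ∀ b, Quot.mk s b = Quot.mk s a → Quot.mk r b = Quot.mk r a :=
    fun h1 h2 a ha b hb => Quot.class_subset_congr (fun a b h => (h1 a b h).2)
      (fun a b h => (h2 a b h).2) ha hb
  have k1 := key h1 h2
  have k2 := key (fun a b h => (h1 a b h).symm) (fun a b h => (h2 a b h).symm)
  have out1 : ∀ f : {f : Quot r // ∀ y, Quot.mk r y = f → y ∈ S}, ∀ y,
      Quot.mk s y = Quot.mk s f.1.out → y ∈ S := fun f y hy =>
    f.2 y ((k1 _ (fun b hb => f.2 b (hb.trans (Quot.out_eq _))) y hy).trans (Quot.out_eq _))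
  have out2 : ∀ f : {f : Quot s // ∀ y, Quot.mk s y = f → y ∈ S}, ∀ y,
      Quot.mk r y = Quot.mk r f.1.out → y ∈ S := fun f y hy =>
    f.2 y ((k2 _ (fun b hb => f.2 b (hb.trans (Quot.out_eq _))) y hy).trans (Quot.out_eq _))
  refine Nat.card_congr ⟨fun f => ⟨Quot.mk s f.1.out, out1 f⟩, fun f => ⟨Quot.mk r f.1.out, out2 f⟩,
    fun f => Subtype.ext ?_, fun f => Subtype.ext ?_⟩
  · refine (k1 f.1.out (fun b hb => f.2 b (hb.trans (Quot.out_eq _))) _ (Quot.out_eq _)).trans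
      (Quot.out_eq _)
  · refine (k2 f.1.out (fun b hb => f.2 b (hb.trans (Quot.out_eq _))) _ (Quot.out_eq _)).trans
      (Quot.out_eq _)

end Quotients

namespace HERG

theorem v_contract (G : HERG) (x : G.Flag) (y : (G.contract x).Flag) :
    ((G.contract x).v y).1 = G.contractArc x y.1 := rfl

/-! ### Orbits after contraction -/

section Orbits

variable (G : HERG) (x : G.Flag) (r : G.Flag → G.Flag → Prop)

/-- The arcs of the vertices, the sides of the ribbon through `x`, and further relations. -/
def bigRel (a b : G.Flag) : Prop := b = G.v a ∨ (a ∈ G.ribbonFlags x ∧ b = G.e a) ∨ r a b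

/-- The corresponding relation after contraction of the ribbon through `x`. -/
def smallRel (a b : (G.contract x).Flag) : Prop := b = (G.contract x).v a ∨ r a.1 b.1

variable {G x r}

theorem bigRel_mk_of_smallRel {a b : (G.contract x).Flag} (h : G.smallRel x r a b) :
    Quot.mk (G.bigRel x r) a.1 = Quot.mk (G.bigRel x r) b.1 := by
  have hv : ∀ a, Quot.mk (G.bigRel x r) (G.v a) = Quot.mk (G.bigRel x r) a :=
    fun a => Quot.sound_symm (Or.inl rfl)
  have he : ∀ a ∈ G.ribbonFlags x, Quot.mk (G.bigRel x r) (G.e a) = Quot.mk (G.bigRel x r) a :=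
    fun a ha => Quot.sound_symm (Or.inr (Or.inl ⟨ha, rfl⟩))
  rcases h with rfl | h
  · rw [v_contract]
    unfold contractArc
    split_ifs with h1 h2
    · rw [hv, he _ h2, hv, he _ h1, hv]
    · rw [hv, he _ h1, hv]
    · rw [hv]
  · exact Quot.sound (Or.inr (Or.inr h))

/-- The proof confines the orbit of `a` before contraction. The set `U` consists of the surviving
flags in the class of `a` and of the ribbon flags passed by the arcs that start at them; an arc
follows at most two sides. `U` is invariant under the generators of `bigRel`, and outside the ribbon
it is just the class of `a`. -/
theorem smallRel_mk_eq (hr : ∀ a b, r a b → a ∉ G.ribbonFlags x ∧ b ∉ G.ribbonFlags x)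
    {a b : (G.contract x).Flag}
    (h : Quot.mk (G.bigRel x r) b.1 = Quot.mk (G.bigRel x r) a.1) :
    Quot.mk (G.smallRel x r) b = Quot.mk (G.smallRel x r) a := by
  set S := G.ribbonFlags x with hS
  have eS : ∀ y, G.e y ∈ S ↔ y ∈ S := G.e_mem_ribbonFlags_iff x
  let I : G.Flag → Prop := fun y => ∃ hy : y ∉ S,
    Quot.mk (G.smallRel x r) ⟨y, hy⟩ = Quot.mk (G.smallRel x r) a
  let U : G.Flag → Prop := fun z => I z ∨ (z ∈ S ∧ ∃ y, I y ∧ G.v y ∈ S ∧ (z = G.v y ∨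
    z = G.e (G.v y) ∨ (G.v (G.e (G.v y)) ∈ S ∧
      (z = G.v (G.e (G.v y)) ∨ z = G.e (G.v (G.e (G.v y)))))))
  have harc : ∀ y, I y → I (G.contractArc x y) := by
    rintro y ⟨hy, hy'⟩
    refine ⟨(G.contractArc_cases x y hy).1, ?_⟩
    rw [← hy']
    exact Quot.sound_symm (Or.inl rfl)
  have hUv : ∀ z, U z → U (G.v z) := by
    rintro z (hz | ⟨hz, y, hy, hvy, hz'⟩)
    · by_cases h1 : G.v z ∈ S
      · exact Or.inr ⟨h1, z, hz, h1, Or.inl rfl⟩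
      · have := harc z hz
        rw [contractArc, if_pos h1] at this
        exact Or.inl this
    · rcases hz' with rfl | rfl | ⟨h2, rfl | rfl⟩
      · rw [G.v_v]; exact Or.inl hy
      · by_cases h2 : G.v (G.e (G.v y)) ∈ S
        · exact Or.inr ⟨h2, y, hy, hvy, Or.inr (Or.inr ⟨h2, Or.inl rfl⟩)⟩
        · have := harc y hy
          rw [contractArc, if_neg (not_not.2 hvy), if_pos h2] at this
          exact Or.inl this
      · rw [G.v_v]
        exact Or.inr ⟨(eS _).2 hvy, y, hy, hvy, Or.inr (Or.inl rfl)⟩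
      · have := harc y hy
        rw [contractArc, if_neg (not_not.2 hvy), if_neg (not_not.2 h2)] at this
        exact Or.inl this
  have hUe : ∀ z ∈ S, U z → U (G.e z) := by
    rintro z hzS (⟨hz, -⟩ | ⟨hz, y, hy, hvy, hz'⟩)
    · exact (hz hzS).elim
    · refine Or.inr ⟨(eS z).2 hz, y, hy, hvy, ?_⟩
      rcases hz' with rfl | rfl | ⟨h2, rfl | rfl⟩
      · exact Or.inr (Or.inl rfl)
      · rw [G.e_e]; exact Or.inl rfl
      · exact Or.inr (Or.inr ⟨h2, Or.inr rfl⟩)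
      · rw [G.e_e]; exact Or.inr (Or.inr ⟨h2, Or.inl rfl⟩)
  have hIr : ∀ y z, r y z → (I y ↔ I z) := by
    intro y z hyz
    obtain ⟨hy, hz⟩ := hr y z hyz
    have e1 : Quot.mk (G.smallRel x r) ⟨y, hy⟩ = Quot.mk (G.smallRel x r) ⟨z, hz⟩ :=
      Quot.sound (Or.inr hyz)
    exact ⟨fun ⟨_, h⟩ => ⟨hz, e1.symm.trans h⟩, fun ⟨_, h⟩ => ⟨hy, e1.trans h⟩⟩
  have hUI : ∀ z, z ∉ S → (U z ↔ I z) := fun z hz =>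
    ⟨fun h => h.elim id fun h => (hz h.1).elim, Or.inl⟩
  have hU : U b.1 := by
    refine (Quot.iff_of_mk_eq U ?_ h).2 (Or.inl ⟨a.2, rfl⟩)
    rintro y z (rfl | ⟨hy, rfl⟩ | hyz)
    · exact ⟨hUv y, fun h => by simpa [G.v_v] using hUv _ h⟩
    · exact ⟨hUe y hy, fun h => by simpa [G.e_e] using hUe _ ((eS y).2 hy) h⟩
    · obtain ⟨hy, hz⟩ := hr y z hyz
      rw [hUI y hy, hUI z hz]
      exact hIr y z hyz
  exact ((hUI b.1 b.2).1 hU).2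

/-- The orbits after contraction are the orbits that leave the contracted ribbon. -/
noncomputable def smallQuotEquiv
    (hr : ∀ a b, r a b → a ∉ G.ribbonFlags x ∧ b ∉ G.ribbonFlags x) :
    Quot (G.smallRel x r) ≃ {f : Quot (G.bigRel x r) //
      ¬ ∀ y, Quot.mk (G.bigRel x r) y = f → y ∈ G.ribbonFlags x} :=
  Equiv.ofBijective
    (fun f => ⟨Quot.lift (fun a : (G.contract x).Flag => Quot.mk (G.bigRel x r) a.1)
      (fun _ _ h => bigRel_mk_of_smallRel h) f, by
        obtain ⟨a⟩ := f
        exact fun h => a.2 (h a.1 rfl)⟩)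
    (by
      constructor
      · rintro ⟨a⟩ ⟨b⟩ hab
        exact smallRel_mk_eq hr (congrArg Subtype.val hab)
      · rintro ⟨f, hf⟩
        push Not at hf
        obtain ⟨y, rfl, hy⟩ := hf
        exact ⟨Quot.mk _ ⟨y, hy⟩, rfl⟩)

/-- The orbits that disappear lie inside the contracted ribbon. There `r` is void and only `v` and
`e` act, so these orbits are faces whatever `r` is, and their number is what `contract` adds to
`isolated`. The choices `e`, `h` and both for `r`, away from the ribbon, give the counts of faces,
vertices and components. -/
theorem card_smallRel (hr : ∀ a b, r a b → a ∉ G.ribbonFlags x ∧ b ∉ G.ribbonFlags x) :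
    Nat.card (Quot (G.smallRel x r)) +
      Nat.card {f : G.Face // ∀ y, G.faceOf y = f → y ∈ G.ribbonFlags x} =
      Nat.card (Quot (G.bigRel x r)) := by
  have h1 : Nat.card {f : G.Face // ∀ y, G.faceOf y = f → y ∈ G.ribbonFlags x} =
      Nat.card {f : Quot (G.bigRel x r) //
        ∀ y, Quot.mk (G.bigRel x r) y = f → y ∈ G.ribbonFlags x} := by
    refine Quot.card_classes_inside_congr ?_ ?_
    · intro a b ha
      have := fun h => (hr a b h).1 ha
      simp only [bigRel]
      tauto
    · intro a b hb
      have := fun h => (hr a b h).2 hb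
      have he := G.e_mem_ribbonFlags_iff x a
      simp only [bigRel]
      constructor
      · rintro (h | rfl)
        · exact Or.inl h
        · exact Or.inr (Or.inl ⟨he.1 hb, rfl⟩)
      · tauto
  classical
  rw [h1, Nat.card_congr (smallQuotEquiv hr), add_comm, ← Nat.card_sum]
  exact Nat.card_congr (Equiv.sumCompl _)

end Orbits

/-! ### The numbers of a contraction -/

theorem card_face_contract (G : HERG) (x : G.Flag) :
    Nat.card (G.contract x).Face + (G.contract x).isolated = Nat.card G.Face + G.isolated := by
  let r : G.Flag → G.Flag → Prop := fun a b => a ∉ G.ribbonFlags x ∧ b = G.e a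
  have hr : ∀ a b, r a b → a ∉ G.ribbonFlags x ∧ b ∉ G.ribbonFlags x := by
    rintro a b ⟨h, rfl⟩
    exact ⟨h, mt (G.e_mem_ribbonFlags_iff x a).1 h⟩
  have h0 := card_smallRel hr
  have h1 : Nat.card (G.contract x).Face = Nat.card (Quot (G.smallRel x r)) := by
    refine Quot.card_congr_rel ?_ ?_
    · rintro a b (rfl | rfl)
      exacts [Quot.sound (Or.inl rfl), Quot.sound (Or.inr ⟨a.2, rfl⟩)]
    · rintro a b (rfl | ⟨-, h⟩)
      exacts [Quot.sound (Or.inl rfl), Quot.sound (Or.inr (Subtype.ext h))]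
  have h2 : Nat.card G.Face = Nat.card (Quot (G.bigRel x r)) := by
    refine Quot.card_congr_rel ?_ ?_
    · rintro a b (rfl | rfl)
      · exact Quot.sound (Or.inl rfl)
      · by_cases ha : a ∈ G.ribbonFlags x
        exacts [Quot.sound (Or.inr (Or.inl ⟨ha, rfl⟩)), Quot.sound (Or.inr (Or.inr ⟨ha, rfl⟩))]
    · rintro a b (rfl | ⟨-, rfl⟩ | ⟨-, rfl⟩)
      exacts [Quot.sound (Or.inl rfl), Quot.sound (Or.inr rfl), Quot.sound (Or.inr rfl)]
  have h3 : (G.contract x).isolated = G.isolated +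
    Nat.card {f : G.Face // ∀ y, G.faceOf y = f → y ∈ G.ribbonFlags x} := rfl
  omega

/-- No external circle is lost: it contains a flag of a half-ribbon, and such a flag cannot belong
to the contracted edge. -/
theorem numBoundary_contract (G : HERG) (x : G.Flag) (hx : G.IsEdge x) :
    (G.contract x).numBoundary = G.numBoundary := by
  let r : G.Flag → G.Flag → Prop := fun a b => a ∉ G.ribbonFlags x ∧ b = G.e a
  have hr : ∀ a b, r a b → a ∉ G.ribbonFlags x ∧ b ∉ G.ribbonFlags x := by
    rintro a b ⟨h, rfl⟩
    exact ⟨h, mt (G.e_mem_ribbonFlags_iff x a).1 h⟩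
  have hf1 : ∀ a b : (G.contract x).Flag, (G.contract x).faceOf a = (G.contract x).faceOf b →
      G.faceOf a.1 = G.faceOf b.1 := by
    intro a b h
    refine congrArg (Quot.lift (fun a : (G.contract x).Flag => G.faceOf a.1) ?_) h
    rintro a b (rfl | rfl)
    · refine Quot.mk_eq_of_imp (r := G.bigRel x r) ?_ (bigRel_mk_of_smallRel (Or.inl rfl))
      rintro a b (rfl | ⟨-, rfl⟩ | ⟨-, rfl⟩)
      exacts [Quot.sound (Or.inl rfl), Quot.sound (Or.inr rfl), Quot.sound (Or.inr rfl)]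
    · exact Quot.sound (Or.inr rfl)
  have hf2 : ∀ a b : (G.contract x).Flag, G.faceOf a.1 = G.faceOf b.1 →
      (G.contract x).faceOf a = (G.contract x).faceOf b := by
    intro a b h
    refine Quot.mk_eq_of_imp (r := G.smallRel x r) ?_ (smallRel_mk_eq hr ?_)
    · rintro a b (rfl | ⟨-, h⟩)
      exacts [Quot.sound (Or.inl rfl), Quot.sound (Or.inr (Subtype.ext h))]
    · refine Quot.mk_eq_of_imp (r := fun x y : G.Flag => y = G.v x ∨ y = G.e x) ?_ h
      rintro a b (rfl | rfl)
      · exact Quot.sound (Or.inl rfl)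
      · by_cases ha : a ∈ G.ribbonFlags x
        exacts [Quot.sound (Or.inr (Or.inl ⟨ha, rfl⟩)), Quot.sound (Or.inr (Or.inr ⟨ha, rfl⟩))]
  refine Nat.card_congr (Equiv.ofBijective (fun f =>
    ⟨Quot.lift (fun a : (G.contract x).Flag => G.faceOf a.1)
      (fun a b h => hf1 a b (Quot.sound h)) f.1, ?_⟩) ⟨?_, ?_⟩)
  · obtain ⟨_, a, rfl, ha⟩ := f
    exact ⟨a.1, rfl, congrArg Subtype.val ha⟩
  · rintro ⟨⟨a⟩, ha⟩ ⟨⟨b⟩, hb⟩ hab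
    exact Subtype.ext (hf2 a b (congrArg Subtype.val hab))
  · rintro ⟨_, a, rfl, ha⟩
    have ha' : a ∉ G.ribbonFlags x :=
      fun h => ((G.isEdge_of_mem_ribbonFlags h).2 hx) ha
    exact ⟨⟨(G.contract x).faceOf ⟨a, ha'⟩, ⟨a, ha'⟩, rfl, Subtype.ext ha⟩, rfl⟩

instance (G : HERG) : Finite G.Face := inferInstanceAs (Finite (Quot _))
instance (G : HERG) : Finite G.Vertex := inferInstanceAs (Finite (Quot _))
instance (G : HERG) : Finite G.Component := inferInstanceAs (Finite (Quot _))

/-- All boundary circles, closed or external. -/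
noncomputable def numFaces (G : HERG) : ℕ := Nat.card G.Face + G.isolated

theorem numClosedFaces_add_numBoundary (G : HERG) :
    G.numClosedFaces + G.numBoundary = G.numFaces := by
  classical
  unfold numClosedFaces numBoundary numFaces
  rw [add_right_comm, ← Nat.card_sum, add_comm (Nat.card _)]
  rw [Nat.card_congr ((Equiv.sumComm _ _).trans (Equiv.sumCompl G.IsExternal)), add_comm]

theorem numClosedFaces_contract (G : HERG) (x : G.Flag) (hx : G.IsEdge x) :
    (G.contract x).numClosedFaces = G.numClosedFaces := by
  have h1 := G.numClosedFaces_add_numBoundary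
  have h2 := (G.contract x).numClosedFaces_add_numBoundary
  have h3 := G.card_face_contract x
  have h4 := G.numBoundary_contract x hx
  unfold numFaces at h1 h2
  omega

theorem numEdges_contract (G : HERG) (x : G.Flag) (hx : G.IsEdge x) :
    (G.contract x).numEdges + 1 = G.numEdges := by
  classical
  have h1 := G.four_mul_numEdges
  have h2 := (G.contract x).four_mul_numEdges
  have h3 := G.ribbonFlags_ncard x hx
  have h4 : Nat.card {y // G.IsEdge y} =
      Nat.card ({y // (G.contract x).IsEdge y} ⊕ G.ribbonFlags x) := by
    refine Nat.card_congr ⟨fun y => if h : y.1 ∈ G.ribbonFlags x then .inr ⟨y.1, h⟩ else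
      .inl ⟨⟨y.1, h⟩, fun h' => y.2 (congrArg Subtype.val h')⟩,
      Sum.elim (fun y => ⟨y.1.1, fun h => y.2 (Subtype.ext h)⟩)
        (fun y => ⟨y.1, (G.isEdge_of_mem_ribbonFlags y.2).2 hx⟩), ?_, ?_⟩
    · rintro ⟨y, hy⟩
      by_cases h : y ∈ G.ribbonFlags x <;> simp [h]
    · rintro (⟨⟨y, hy⟩, hy'⟩ | ⟨y, hy⟩)
      · simp [hy]
      · simp [hy]
  rw [Nat.card_sum, Nat.card_coe_set_eq] at h4
  omega

theorem numHalfRibbons_contract (G : HERG) (x : G.Flag) (hx : G.IsEdge x) :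
    (G.contract x).numHalfRibbons = G.numHalfRibbons := by
  have h1 := G.two_mul_numHalfRibbons
  have h2 := (G.contract x).two_mul_numHalfRibbons
  have h4 : Nat.card {y // G.e y = G.h y} =
      Nat.card {y // (G.contract x).e y = (G.contract x).h y} :=
    Nat.card_congr ⟨fun y => ⟨⟨y.1, fun h => ((G.isEdge_of_mem_ribbonFlags h).2 hx) y.2⟩,
      Subtype.ext y.2⟩, fun y => ⟨y.1.1, congrArg Subtype.val y.2⟩, fun _ => rfl, fun _ => rfl⟩
  omega

/-! ### Contraction of an edge that is not a loop -/

section NonLoop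

variable {G : HERG} {x : G.Flag}

theorem vertexOf_v (G : HERG) (x : G.Flag) : G.vertexOf (G.v x) = G.vertexOf x :=
  Quot.sound_symm (Or.inl rfl)
theorem vertexOf_h (G : HERG) (x : G.Flag) : G.vertexOf (G.h x) = G.vertexOf x :=
  Quot.sound_symm (Or.inr rfl)

theorem eq_or_eq_h_of_vertexOf_eq (hx : G.vertexOf x ≠ G.vertexOf (G.e x)) {y z : G.Flag}
    (hy : y ∈ G.ribbonFlags x) (hz : z ∈ G.ribbonFlags x) (h : G.vertexOf y = G.vertexOf z) :
    y = z ∨ y = G.h z := by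
  rcases hy with rfl | rfl | rfl | rfl <;> rcases hz with rfl | rfl | rfl | rfl <;>
    (try simp only [vertexOf_h] at h) <;> first | exact (hx h).elim | exact (hx h.symm).elim |
      simp [G.h_h]

/-- The relation of `x` and `h x` on a vertex that survives the removal of the ribbon end. -/
theorem mk_h_eq (hx : G.vertexOf x ≠ G.vertexOf (G.e x)) {z : G.Flag}
    (hz : z ∈ G.ribbonFlags x) {s : G.Flag → G.Flag → Prop} (hv : ∀ a, s a (G.v a))
    (hh : ∀ a, a ∉ G.ribbonFlags x → s a (G.h a)) : Quot.mk s (G.h z) = Quot.mk s z := by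
  let r : G.Flag → G.Flag → Prop := fun a b => b = G.v a ∨ (a ∉ G.ribbonFlags x ∧ b = G.h a)
  refine Quot.mk_eq_of_imp (r := r) ?_ ?_
  · rintro a b (rfl | ⟨ha, rfl⟩)
    exacts [Quot.sound (hv a), Quot.sound (hh a ha)]
  -- Parity: otherwise `z` is the only flag of the ribbon in its orbit under `v` and the remaining
  -- `h`. Then `v` pairs off the whole orbit and `h` pairs off the orbit without `z`, so two
  -- consecutive numbers are even.
  by_contra hne
  let U : Set G.Flag := {y | Quot.mk r y = Quot.mk r z}
  have hUv : ∀ y ∈ U, G.v y ∈ U := fun y hy =>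
    (Quot.sound (r := r) (Or.inl rfl)).symm.trans hy
  have hUz : ∀ y ∈ U, y ∈ G.ribbonFlags x → y = z := by
    intro y hy hyx
    have h1 : G.vertexOf y = G.vertexOf z := by
      refine Quot.mk_eq_of_imp (r := r) ?_ hy
      rintro a b (rfl | ⟨ha, rfl⟩)
      exacts [Quot.sound (Or.inl rfl), Quot.sound (Or.inr rfl)]
    rcases eq_or_eq_h_of_vertexOf_eq hx hyx hz h1 with h | h
    · exact h
    · exact (hne (h ▸ hy)).elim
  have e1 : Even U.ncard := even_ncard_of_involution U G.v hUv (fun y _ => G.v_v y)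
    fun y _ => G.v_ne y
  have e2 : Even (U \ {z}).ncard := by
    refine even_ncard_of_involution _ G.h ?_ (fun y _ => G.h_h y) fun y _ => G.h_ne y
    rintro y ⟨hy, hyz⟩
    have hyx : y ∉ G.ribbonFlags x := fun h => hyz (hUz y hy h)
    refine ⟨(Quot.sound (r := r) (Or.inr ⟨hyx, rfl⟩)).symm.trans hy, fun h => hyx ?_⟩
    rw [← G.h_mem_ribbonFlags_iff, show G.h y = z from h]
    exact hz
  rw [Set.ncard_sdiff_singleton_of_mem (show z ∈ U from rfl)] at e2
  have h0 : 0 < U.ncard := (Set.ncard_pos).2 ⟨z, rfl⟩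
  obtain ⟨a, ha⟩ := e1
  obtain ⟨b, hb⟩ := e2
  omega

/-- Before contraction, adding the sides of the ribbon to the vertex relation merges the two
different end vertices. Dropping `h` on the ribbon itself loses nothing, because by `mk_h_eq` the
two flags of a ribbon end are still connected the other way round the vertex. -/
theorem numVertices_contract (hx : G.vertexOf x ≠ G.vertexOf (G.e x)) :
    (G.contract x).numVertices + 1 = G.numVertices := by
  let r : G.Flag → G.Flag → Prop := fun a b => a ∉ G.ribbonFlags x ∧ b = G.h a
  have hr : ∀ a b, r a b → a ∉ G.ribbonFlags x ∧ b ∉ G.ribbonFlags x := by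
    rintro a b ⟨h, rfl⟩
    exact ⟨h, mt (G.h_mem_ribbonFlags_iff x a).1 h⟩
  have h0 := card_smallRel hr
  have h1 : Nat.card (G.contract x).Vertex = Nat.card (Quot (G.smallRel x r)) := by
    refine Quot.card_congr_rel ?_ ?_
    · rintro a b (rfl | rfl)
      exacts [Quot.sound (Or.inl rfl), Quot.sound (Or.inr ⟨a.2, rfl⟩)]
    · rintro a b (rfl | ⟨-, h⟩)
      exacts [Quot.sound (Or.inl rfl), Quot.sound (Or.inr (Subtype.ext h))]
  have h2 := Quot.card_merge (fun a b : G.Flag => b = G.v a ∨ b = G.h a) x (G.e x) hx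
  have h3 : Nat.card (Quot (G.bigRel x r)) =
      Nat.card (Quot fun a b => (b = G.v a ∨ b = G.h a) ∨ (a = x ∧ b = G.e x)) := by
    refine Quot.card_congr_rel ?_ ?_
    · rintro a b (rfl | ⟨ha, rfl⟩ | ⟨-, rfl⟩)
      · exact Quot.sound (Or.inl (Or.inl rfl))
      · have k1 : ∀ z, Quot.mk (fun a b => (b = G.v a ∨ b = G.h a) ∨ (a = x ∧ b = G.e x)) (G.h z) =
          Quot.mk _ z := fun z => Quot.sound_symm (Or.inl (Or.inr rfl))
        have k2 : Quot.mk (fun a b => (b = G.v a ∨ b = G.h a) ∨ (a = x ∧ b = G.e x)) x =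
          Quot.mk _ (G.e x) := Quot.sound (Or.inr ⟨rfl, rfl⟩)
        rcases ha with rfl | rfl | rfl | rfl
        · exact k2
        · rw [← G.h_e, k1, k1]; exact k2
        · rw [G.e_e]; exact k2.symm
        · rw [G.h_e, G.e_e, ← G.h_e, k1, k1]; exact k2.symm
      · exact Quot.sound (Or.inl (Or.inr rfl))
    · rintro a b ((rfl | rfl) | ⟨rfl, rfl⟩)
      · exact Quot.sound (Or.inl rfl)
      · by_cases ha : a ∈ G.ribbonFlags x
        · exact (mk_h_eq hx ha (fun a => Or.inl rfl)
            (fun a ha => Or.inr (Or.inr ⟨ha, rfl⟩))).symm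
        · exact Quot.sound (Or.inr (Or.inr ⟨ha, rfl⟩))
      · exact Quot.sound (Or.inr (Or.inl ⟨G.mem_ribbonFlags_self _, rfl⟩))
  have h4 : (G.contract x).isolated = G.isolated +
    Nat.card {f : G.Face // ∀ y, G.faceOf y = f → y ∈ G.ribbonFlags x} := rfl
  have h5 : Nat.card G.Vertex = Nat.card (Quot fun a b : G.Flag => b = G.v a ∨ b = G.h a) := rfl
  unfold numVertices
  omega

theorem numComponents_contract (hx : G.vertexOf x ≠ G.vertexOf (G.e x)) :
    (G.contract x).numComponents = G.numComponents := by
  let r : G.Flag → G.Flag → Prop := fun a b => a ∉ G.ribbonFlags x ∧ (b = G.h a ∨ b = G.e a)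
  have hr : ∀ a b, r a b → a ∉ G.ribbonFlags x ∧ b ∉ G.ribbonFlags x := by
    rintro a b ⟨h, rfl | rfl⟩
    exacts [⟨h, mt (G.h_mem_ribbonFlags_iff x a).1 h⟩, ⟨h, mt (G.e_mem_ribbonFlags_iff x a).1 h⟩]
  have h0 := card_smallRel hr
  have h1 : Nat.card (G.contract x).Component = Nat.card (Quot (G.smallRel x r)) := by
    refine Quot.card_congr_rel ?_ ?_
    · rintro a b (rfl | rfl | rfl)
      exacts [Quot.sound (Or.inl rfl), Quot.sound (Or.inr ⟨a.2, Or.inl rfl⟩),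
        Quot.sound (Or.inr ⟨a.2, Or.inr rfl⟩)]
    · rintro a b (rfl | ⟨-, h | h⟩)
      exacts [Quot.sound (Or.inl rfl), Quot.sound (Or.inr (Or.inl (Subtype.ext h))),
        Quot.sound (Or.inr (Or.inr (Subtype.ext h)))]
  have h3 : Nat.card (Quot (G.bigRel x r)) = Nat.card G.Component := by
    refine Quot.card_congr_rel ?_ ?_
    · rintro a b (rfl | ⟨ha, rfl⟩ | ⟨-, rfl | rfl⟩)
      exacts [Quot.sound (Or.inl rfl), Quot.sound (Or.inr (Or.inr rfl)),
        Quot.sound (Or.inr (Or.inl rfl)), Quot.sound (Or.inr (Or.inr rfl))]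
    · rintro a b (rfl | rfl | rfl)
      · exact Quot.sound (Or.inl rfl)
      · by_cases ha : a ∈ G.ribbonFlags x
        · exact (mk_h_eq hx ha (fun a => Or.inl rfl)
            (fun a ha => Or.inr (Or.inr ⟨ha, Or.inl rfl⟩))).symm
        · exact Quot.sound (Or.inr (Or.inr ⟨ha, Or.inl rfl⟩))
      · by_cases ha : a ∈ G.ribbonFlags x
        · exact Quot.sound (Or.inr (Or.inl ⟨ha, rfl⟩))
        · exact Quot.sound (Or.inr (Or.inr ⟨ha, Or.inr rfl⟩))
  have h4 : (G.contract x).isolated = G.isolated +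
    Nat.card {f : G.Face // ∀ y, G.faceOf y = f → y ∈ G.ribbonFlags x} := rfl
  unfold numComponents
  omega

/-- The two arcs next to a ribbon end have different colours. -/
theorem colour_ne (hx : G.vertexOf x ≠ G.vertexOf (G.e x)) {z : G.Flag}
    (hz : z ∈ G.ribbonFlags x) (hvz : G.v z ∉ G.ribbonFlags x) (c : G.Flag → Bool)
    (hh : ∀ y ∉ G.ribbonFlags x, c (G.h y) = !c y)
    (hv : ∀ y ∉ G.ribbonFlags x, G.v y ∉ G.ribbonFlags x → c (G.v y) = !c y) :
    G.v (G.h z) ∉ G.ribbonFlags x ∧ c (G.v (G.h z)) = !c (G.v z) := by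
  have hz' : G.h z ∈ G.ribbonFlags x := (G.h_mem_ribbonFlags_iff x z).2 hz
  have key : ∀ y ∈ G.ribbonFlags x, G.vertexOf y = G.vertexOf z → y = z ∨ y = G.h z :=
    fun y hy h => eq_or_eq_h_of_vertexOf_eq hx hy hz h
  have h1 : G.v (G.h z) ∉ G.ribbonFlags x := by
    intro h
    rcases key _ h (by rw [vertexOf_v, vertexOf_h]) with h2 | h2
    · rw [← h2, G.v_v] at hvz; exact hvz hz'
    · exact G.v_ne _ h2
  refine ⟨h1, ?_⟩
  by_contra hne
  have hc : c (G.v (G.h z)) = c (G.v z) := by simpa using hne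
  -- Count the remaining flags at the vertex by colour. The map `h` matches the two colours. If the
  -- two arcs at the ribbon end led to flags of the same colour, `v` would inject the opposite
  -- colour into that colour with `G.v z` left out.
  let T : Bool → Set G.Flag :=
    fun b => {y | G.vertexOf y = G.vertexOf z ∧ y ∉ G.ribbonFlags x ∧ c y = b}
  have hT : ∀ b, (T b).ncard ≤ (T !b).ncard := by
    intro b
    refine Set.ncard_le_ncard_of_injOn G.h ?_ (fun a _ b _ h => G.h_inj.1 h)
    rintro y ⟨hy1, hy2, rfl⟩
    exact ⟨by rw [vertexOf_h, hy1], mt (G.h_mem_ribbonFlags_iff x y).1 hy2, hh y hy2⟩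
  have hT2 : (T !c (G.v z)).ncard ≤ (T (c (G.v z)) \ {G.v z}).ncard := by
    refine Set.ncard_le_ncard_of_injOn G.v ?_ (fun a _ b _ h => G.v_inj.1 h)
    rintro y ⟨hy1, hy2, hy3⟩
    have hvy : G.v y ∉ G.ribbonFlags x := by
      intro h
      rcases key _ h (by rw [vertexOf_v, hy1]) with h2 | h2
      · rw [← h2, G.v_v] at hy3; simp at hy3
      · rw [← hc, ← h2, G.v_v] at hy3; simp at hy3
    refine ⟨⟨by rw [vertexOf_v, hy1], hvy, by rw [hv y hy2 hvy, hy3, Bool.not_not]⟩, ?_⟩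
    intro h
    rw [Set.mem_singleton_iff, G.v_inj] at h
    exact hy2 (h ▸ hz)
  have hmem : G.v z ∈ T (c (G.v z)) := ⟨vertexOf_v G z, hvz, rfl⟩
  have h0 : 0 < (T (c (G.v z))).ncard := (Set.ncard_pos).2 ⟨_, hmem⟩
  rw [Set.ncard_sdiff_singleton_of_mem hmem] at hT2
  have := hT (c (G.v z))
  omega

/-- A colouring after contraction extends over the removed ribbon. The four ribbon flags receive
colours alternating under `h` and `e`; `colour_ne` gives compatibility with the two arcs at one end,
and the contracted arc along a side gives compatibility between the two ends. Conversely, a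
contracted arc alternates an odd number of times, so colourings restrict. -/
theorem orientable_contract (hx : G.vertexOf x ≠ G.vertexOf (G.e x)) :
    (G.contract x).Orientable ↔ G.Orientable := by
  classical
  constructor
  · rintro ⟨c, hc⟩
    have hxS := G.mem_ribbonFlags_self x
    have heS := (G.e_mem_ribbonFlags_iff x x).2 hxS
    let c₀ : G.Flag → Bool := fun z => if h : z ∉ G.ribbonFlags x then c ⟨z, h⟩ else true
    have hc0 : ∀ z (h : z ∉ G.ribbonFlags x), c₀ z = c ⟨z, h⟩ := fun z h => dif_pos h
    have hh : ∀ y ∉ G.ribbonFlags x, c₀ (G.h y) = !c₀ y := by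
      intro y hy
      rw [hc0 _ hy, hc0 _ (mt (G.h_mem_ribbonFlags_iff x y).1 hy)]
      exact (hc ⟨y, hy⟩).2.1
    have he : ∀ y ∉ G.ribbonFlags x, c₀ (G.e y) = !c₀ y := by
      intro y hy
      rw [hc0 _ hy, hc0 _ (mt (G.e_mem_ribbonFlags_iff x y).1 hy)]
      exact (hc ⟨y, hy⟩).2.2
    have harc : ∀ y ∉ G.ribbonFlags x, c₀ (G.contractArc x y) = !c₀ y := by
      intro y hy
      rw [hc0 _ hy, hc0 _ (G.contractArc_cases x y hy).1]
      exact (hc ⟨y, hy⟩).1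
    have hv : ∀ y ∉ G.ribbonFlags x, G.v y ∉ G.ribbonFlags x → c₀ (G.v y) = !c₀ y := by
      intro y hy hvy
      have := harc y hy
      rwa [contractArc, if_pos hvy] at this
    have hA := fun z hz hvz => colour_ne (z := z) hx hz hvz c₀ hh hv
    have hB : ∀ z ∈ G.ribbonFlags x, G.v z ∉ G.ribbonFlags x → G.v (G.e z) ∉ G.ribbonFlags x →
        c₀ (G.v (G.e z)) = !c₀ (G.v z) := by
      intro z hz hvz hez
      have := harc _ hvz
      rwa [contractArc, G.v_v, if_neg (not_not.2 hz), if_pos hez] at this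
    -- The colour of `x`, forced by the arc at `x`. If this arc returns to the ribbon, the end at
    -- `x` is alone on its vertex and the other end decides; if that is alone too, any value works.
    let β : Bool := if G.v x ∉ G.ribbonFlags x then !c₀ (G.v x) else c₀ (G.v (G.e x))
    let c₁ : G.Flag → Bool := fun z => if z ∉ G.ribbonFlags x then c₀ z else
      if z = x ∨ z = G.h (G.e x) then β else !β
    have hex : G.e x ≠ G.h x := fun h => hx (by rw [h, vertexOf_h])
    have n1 : c₁ x = β := by simp [c₁, hxS]
    have n3 : c₁ (G.h x) = !β := by
      have : G.h x ≠ G.h (G.e x) := fun h => G.e_ne x (G.h_inj.1 h).symm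
      simp [c₁, this, G.h_ne, (G.h_mem_ribbonFlags_iff x x).2 hxS]
    have n4 : c₁ (G.e x) = !β := by
      simp [c₁, G.e_ne, (G.h_ne (G.e x)).symm, heS]
    have n5 : c₁ (G.h (G.e x)) = β := by
      simp [c₁, (G.h_mem_ribbonFlags_iff x _).2 heS]
    have hout : ∀ z ∉ G.ribbonFlags x, c₁ z = c₀ z := fun z hz => if_pos hz
    have hhS : ∀ z ∈ G.ribbonFlags x, c₁ (G.h z) = !c₁ z := by
      rintro z (rfl | rfl | rfl | rfl) <;> simp [n1, n3, n4, n5, G.h_h]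
    have heS' : ∀ z ∈ G.ribbonFlags x, c₁ (G.e z) = !c₁ z := by
      rintro z (rfl | rfl | rfl | rfl) <;>
        simp [n1, n3, n4, n5, G.e_e, ← G.h_e]
    have hvS : ∀ z ∈ G.ribbonFlags x, G.v z ∉ G.ribbonFlags x → c₁ (G.v z) = !c₁ z := by
      intro z hz hvz
      rw [hout _ hvz]
      have hb1 : G.v x ∉ G.ribbonFlags x → β = !c₀ (G.v x) := fun h => if_pos h
      have hb2 : G.v (G.e x) ∉ G.ribbonFlags x → β = c₀ (G.v (G.e x)) := by
        intro h
        by_cases h' : G.v x ∉ G.ribbonFlags x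
        · rw [hb1 h', hB x hxS h' h]
        · exact if_neg h'
      rcases hz with rfl | rfl | rfl | rfl
      · rw [n1, hb1 hvz, Bool.not_not]
      · obtain ⟨h1, h2⟩ := hA _ ((G.h_mem_ribbonFlags_iff x x).2 hxS) hvz
        rw [G.h_h] at h1 h2
        rw [n3, hb1 h1, h2]; simp
      · rw [n4, hb2 hvz, Bool.not_not]
      · obtain ⟨h1, h2⟩ := hA _ ((G.h_mem_ribbonFlags_iff x _).2 heS) hvz
        rw [G.h_h] at h1 h2
        rw [n5, hb2 h1, h2]; simp
    refine ⟨c₁, fun z => ⟨?_, ?_, ?_⟩⟩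
    · by_cases hz : z ∈ G.ribbonFlags x
      · by_cases hvz : G.v z ∈ G.ribbonFlags x
        · rcases eq_or_eq_h_of_vertexOf_eq hx hvz hz (vertexOf_v G z) with h | h
          · exact (G.v_ne z h).elim
          · rw [h]; exact hhS z hz
        · exact hvS z hz hvz
      · by_cases hvz : G.v z ∈ G.ribbonFlags x
        · have := hvS _ hvz (by rwa [G.v_v])
          rw [G.v_v] at this
          rw [this, Bool.not_not]
        · rw [hout _ hz, hout _ hvz]; exact hv z hz hvz
    · by_cases hz : z ∈ G.ribbonFlags x
      · exact hhS z hz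
      · rw [hout _ hz, hout _ (mt (G.h_mem_ribbonFlags_iff x z).1 hz)]; exact hh z hz
    · by_cases hz : z ∈ G.ribbonFlags x
      · exact heS' z hz
      · rw [hout _ hz, hout _ (mt (G.e_mem_ribbonFlags_iff x z).1 hz)]; exact he z hz
  · rintro ⟨c, hc⟩
    refine ⟨fun z => c z.1, fun z => ⟨?_, (hc z.1).2.1, (hc z.1).2.2⟩⟩
    change c (G.contractArc x z.1) = !c z.1
    unfold contractArc
    split_ifs <;> simp [(hc _).1, (hc _).2.2]

end NonLoop

end HERG

namespace HERG

/-! ### Contraction and spanning subgraphs -/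

section ContractSums

variable {G : HERG} {x : G.Flag}

theorem ribbonFlags_onFlags {T : Set G.Flag} (hx : x ∈ T) :
    (G.onFlags T).ribbonFlags x = G.ribbonFlags x := by
  unfold ribbonFlags
  rw [onFlags_e_of_mem G hx]
  rfl

open Classical in
theorem contractArc_onFlags {T : Set G.Flag} (hT : G.IsEdgeSet T) (hx : x ∈ T) (y : G.Flag) :
    (G.onFlags T).contractArc x y = G.contractArc x y := by
  have he : ∀ z ∈ G.ribbonFlags x, (G.onFlags T).e z = G.e z :=
    fun z hz => onFlags_e_of_mem G ((hT.ribbonFlags_subset hz).2 hx)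
  unfold contractArc
  rw [ribbonFlags_onFlags hx]
  change (if G.v y ∉ G.ribbonFlags x then G.v y
    else if G.v ((G.onFlags T).e (G.v y)) ∉ G.ribbonFlags x then G.v ((G.onFlags T).e (G.v y))
    else G.v ((G.onFlags T).e (G.v ((G.onFlags T).e (G.v y))))) = _
  by_cases h1 : G.v y ∈ G.ribbonFlags x
  · rw [if_neg (not_not.2 h1), if_neg (not_not.2 h1), he _ h1]
    by_cases h2 : G.v (G.e (G.v y)) ∈ G.ribbonFlags x
    · rw [if_neg (not_not.2 h2), if_neg (not_not.2 h2), he _ h2]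
    · rw [if_pos h2, if_pos h2]
  · rw [if_pos h1, if_pos h1]

theorem ribbonMap_contract (G : HERG) (x : G.Flag) :
    RibbonMap (G.contract x) G Subtype.val :=
  ⟨fun _ => rfl, fun _ => rfl, Subtype.val_injective⟩

/-- Contracting an edge commutes with cutting others. The number of new isolated vertices agrees
because it only depends on `e` on the contracted ribbon, which is kept. -/
theorem contract_onFlags_iso {T : Set G.Flag} (hT : G.IsEdgeSet T) (hx : x ∈ T) :
    ((G.contract x).onFlags (Subtype.val ⁻¹' T)).Iso ((G.onFlags T).contract x) := by
  have hr := ribbonFlags_onFlags (G := G) hx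
  refine ⟨?_, Equiv.subtypeEquivRight fun y => by rw [hr]; rfl, fun y => ⟨?_, ?_, ?_⟩⟩
  · change G.isolated + _ = G.isolated + _
    rw [hr]
    congr 1
    have hz : ∀ z ∈ G.ribbonFlags x, G.e z = (G.onFlags T).e z :=
      fun z hz => (onFlags_e_of_mem G ((hT.ribbonFlags_subset hz).2 hx)).symm
    refine Quot.card_classes_inside_congr (r := fun x y : G.Flag => y = G.v x ∨ y = G.e x)
      (s := fun x y : G.Flag => y = G.v x ∨ y = (G.onFlags T).e x) ?_ ?_
    · intro a b ha
      rw [hz a ha]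
    · intro a b hb
      constructor
      · rintro (h | rfl)
        · exact Or.inl h
        · exact Or.inr (hz a ((G.e_mem_ribbonFlags_iff x a).1 hb))
      · rintro (h | rfl)
        · exact Or.inl h
        · refine Or.inr (hz a ?_).symm
          rw [← hr] at hb ⊢
          exact ((G.onFlags T).e_mem_ribbonFlags_iff x a).1 hb
  · exact Subtype.ext (contractArc_onFlags hT hx y.1).symm
  · exact Subtype.ext rfl
  · refine Subtype.ext ?_
    have hm := G.ribbonMap_contract x
    change (((G.contract x).onFlags (Subtype.val ⁻¹' T)).e y).1 = (G.onFlags T).e y.1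
    by_cases hy : y.1 ∈ T
    · rw [onFlags_e_of_mem _ hy]
      exact congrArg Subtype.val (onFlags_e_of_mem (G.contract x) (S := Subtype.val ⁻¹' T) hy)
    · rw [onFlags_e_of_notMem hT hy]
      exact congrArg Subtype.val (onFlags_e_of_notMem (hm.preimage hT) hy)

open Classical in
theorem sum_edgeSets_contract {R : Type*} [AddCommMonoid R] (hx : G.IsEdge x)
    (f : Set (G.contract x).Flag → R) :
    ∑ S ∈ (G.contract x).edgeSets, f S =
      ∑ T ∈ G.edgeSets with x ∈ T, f (Subtype.val ⁻¹' T) := by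
  have hm := G.ribbonMap_contract x
  refine Finset.sum_bij' (fun S _ => Subtype.val '' S ∪ G.ribbonFlags x)
    (fun T _ => Subtype.val ⁻¹' T) ?_ ?_ ?_ ?_ ?_
  · intro S hS
    rw [mem_edgeSets] at hS
    rw [Finset.mem_filter, mem_edgeSets]
    refine ⟨?_, Or.inr (G.mem_ribbonFlags_self x)⟩
    rintro y (hy | hy)
    · obtain ⟨h1, h2, h3⟩ := hm.image hS y hy
      exact ⟨Or.inl h1, Or.inl h2, h3⟩
    · exact ⟨Or.inr ((G.h_mem_ribbonFlags_iff x y).2 hy),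
        Or.inr ((G.e_mem_ribbonFlags_iff x y).2 hy), (G.isEdge_of_mem_ribbonFlags hy).2 hx⟩
  · intro T hT
    rw [Finset.mem_filter, mem_edgeSets] at hT
    exact (mem_edgeSets _ _).2 (hm.preimage hT.1)
  · intro S _
    ext y
    constructor
    · rintro (⟨z, hz, hzy⟩ | hy)
      · exact Subtype.ext hzy ▸ hz
      · exact (y.2 hy).elim
    · exact fun hy => Or.inl ⟨y, hy, rfl⟩
  · intro T hT
    rw [Finset.mem_filter, mem_edgeSets] at hT
    ext y
    constructor
    · rintro (⟨z, hz, rfl⟩ | hy)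
      · exact hz
      · exact (hT.1.ribbonFlags_subset hy).2 hT.2
    · intro hy
      by_cases h : y ∈ G.ribbonFlags x
      · exact Or.inr h
      · exact Or.inl ⟨⟨y, h⟩, hy, rfl⟩
  · intro S _
    congr 1
    ext y
    constructor
    · exact fun hy => Or.inl ⟨y, hy, rfl⟩
    · rintro (⟨z, hz, hzy⟩ | hy)
      · exact Subtype.ext hzy ▸ hz
      · exact (y.2 hy).elim

theorem numComponents_le_numVertices (G : HERG) : G.numComponents ≤ G.numVertices := by
  unfold numComponents numVertices
  refine Nat.add_le_add_right (Quot.card_le_of_imp (α := G.Flag) ?_) _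
  rintro a b (rfl | rfl)
  exacts [Quot.sound (Or.inl rfl), Quot.sound (Or.inr (Or.inl rfl))]

theorem numComponents_le_onFlags {T : Set G.Flag} (hT : G.IsEdgeSet T) :
    G.numComponents ≤ (G.onFlags T).numComponents := by
  classical
  refine Nat.add_le_add_right (Quot.card_le_of_imp (α := G.Flag) ?_) _
  rintro a b (rfl | rfl | rfl)
  · exact Quot.sound (Or.inl rfl)
  · exact Quot.sound (Or.inr (Or.inl rfl))
  · rw [onFlags_e hT]
    split_ifs
    exacts [Quot.sound (Or.inr (Or.inr rfl)), Quot.sound (Or.inr (Or.inl rfl))]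

/-- In the graph and in the state alike, contraction removes one vertex and keeps the components, so
both ranks drop by one and their difference stays. The state also loses one edge, so its nullity
stays, as do its circles, half-ribbons and orientability. -/
theorem weight_contract {R : Type*} [CommRing R] (hx : G.vertexOf x ≠ G.vertexOf (G.e x))
    {T : Set G.Flag} (hT : G.IsEdgeSet T) (hxT : x ∈ T) (x₁ x₂ x₃ x₄ x₅ x₆ : R) :
    weight (G.contract x).rank ((G.contract x).onFlags (Subtype.val ⁻¹' T)) x₁ x₂ x₃ x₄ x₅ x₆ =
      weight G.rank (G.onFlags T) x₁ x₂ x₃ x₄ x₅ x₆ := by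
  have hx' : (G.onFlags T).vertexOf x ≠ (G.onFlags T).vertexOf ((G.onFlags T).e x) := by
    rw [onFlags_e_of_mem G hxT]; exact hx
  have hxe : (G.onFlags T).IsEdge x := (isEdge_onFlags hT x).2 hxT
  rw [(contract_onFlags_iso hT hxT).sameNumbers.weight]
  have k1 := numComponents_contract hx
  have k2 := numComponents_contract hx'
  have v1 := numVertices_contract hx
  have v2 := numVertices_contract hx'
  have n1 := numEdges_contract _ _ hxe
  have f1 := numClosedFaces_contract _ _ hxe
  have b1 := numBoundary_contract _ _ hxe
  have r1 := numHalfRibbons_contract _ _ hxe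
  have o1 := nonorientability_congr (orientable_contract hx')
  have l2 := ((G.onFlags T).contract x).numComponents_le_numVertices
  have v3 : (G.onFlags T).numVertices = G.numVertices := rfl
  have e1 : ((G.onFlags T).contract x).nullity = (G.onFlags T).nullity := by
    unfold nullity rank; omega
  have e2 : (G.contract x).rank - ((G.onFlags T).contract x).rank =
      G.rank - (G.onFlags T).rank := by
    have := numComponents_le_onFlags hT
    unfold rank; omega
  unfold weight
  rw [e1, e2, f1, b1, r1, o1, k2]

end ContractSums

/-! ### Cutting and spanning subgraphs -/

section CutSums

variable {G : HERG} {x : G.Flag}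

open Classical in
theorem cut_e (G : HERG) (x y : G.Flag) :
    (G.cut x).e y = if y ∈ G.ribbonFlags x then G.h y else G.e y := by
  have := G.ribbonOf_eq_iff x y
  by_cases h : y ∈ G.ribbonFlags x
  · rw [if_pos h]
    exact if_neg fun h' => h' (this.2 h)
  · rw [if_neg h]
    exact if_pos fun h' => h (this.1 h')

theorem cut_e_of_notMem {y : G.Flag} (h : y ∉ G.ribbonFlags x) : (G.cut x).e y = G.e y :=
  (cut_e G x y).trans (if_neg h)

theorem isEdge_cut (G : HERG) (x y : G.Flag) :
    (G.cut x).IsEdge y ↔ G.IsEdge y ∧ y ∉ G.ribbonFlags x := by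
  unfold IsEdge
  rw [cut_e]
  split_ifs with h
  · exact iff_of_false (fun h' => h' rfl) fun h' => h'.2 h
  · exact ⟨fun h' => ⟨h', h⟩, fun h' => h'.1⟩

theorem isEdgeSet_cut (T : Set G.Flag) :
    (G.cut x).IsEdgeSet T ↔ G.IsEdgeSet T ∧ x ∉ T := by
  constructor
  · intro h
    have key : ∀ y ∈ T, y ∉ G.ribbonFlags x := fun y hy => ((isEdge_cut G x y).1 (h y hy).2.2).2
    refine ⟨fun y hy => ⟨(h y hy).1, ?_, ((isEdge_cut G x y).1 (h y hy).2.2).1⟩,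
      fun hx => key x hx (G.mem_ribbonFlags_self x)⟩
    have := (h y hy).2.1
    rwa [cut_e, if_neg (key y hy)] at this
  · rintro ⟨h, hx⟩ y hy
    have key : y ∉ G.ribbonFlags x := fun h' => hx ((h.ribbonFlags_subset h').1 hy)
    refine ⟨(h y hy).1, ?_, (isEdge_cut G x y).2 ⟨(h y hy).2.2, key⟩⟩
    exact Eq.mpr (congrArg (· ∈ T) (cut_e_of_notMem key)) (h y hy).2.1

theorem cut_onFlags_iso {T : Set G.Flag} (hT : G.IsEdgeSet T) (hx : x ∉ T) :
    ((G.cut x).onFlags T).Iso (G.onFlags T) := by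
  refine ⟨rfl, Equiv.refl _, fun y => ⟨rfl, rfl, ?_⟩⟩
  change ((G.cut x).onFlags T).e y = (G.onFlags T).e y
  by_cases h : y ∈ T
  · have key : y ∉ G.ribbonFlags x := fun h' => hx ((hT.ribbonFlags_subset h').1 h)
    rw [onFlags_e_of_mem _ h, onFlags_e_of_mem (G.cut x) h]
    exact cut_e_of_notMem key
  · rw [onFlags_e_of_notMem hT h, onFlags_e_of_notMem ((isEdgeSet_cut T).2 ⟨hT, hx⟩) h]
    rfl

open Classical in
theorem sum_edgeSets_cut {R : Type*} [AddCommMonoid R] (f : Set G.Flag → R) :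
    ∑ T ∈ (G.cut x).edgeSets, f T = ∑ T ∈ G.edgeSets with x ∉ T, f T := by
  refine Finset.sum_congr (Finset.ext fun T : Set G.Flag => ?_) fun _ _ => rfl
  refine (mem_edgeSets (G.cut x) T).trans ((isEdgeSet_cut T).trans ?_)
  exact ((Finset.mem_filter (p := fun T : Set G.Flag => x ∉ T) (s := G.edgeSets)).trans
    (and_congr_left fun _ => mem_edgeSets G T)).symm

theorem numComponents_le_cut (G : HERG) (x : G.Flag) :
    G.numComponents ≤ (G.cut x).numComponents := by
  classical
  refine Nat.add_le_add_right (Quot.card_le_of_imp (α := G.Flag) ?_) _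
  rintro a b (rfl | rfl | rfl)
  · exact Quot.sound (Or.inl rfl)
  · exact Quot.sound (Or.inr (Or.inl rfl))
  · rw [cut_e]
    split_ifs
    exacts [Quot.sound (Or.inr (Or.inl rfl)), Quot.sound (Or.inr (Or.inr rfl))]

/-- A single link from `x` to `G.e x` restores the components of `G`, and one link merges at most
two classes. -/
theorem numComponents_cut_le (G : HERG) (x : G.Flag) :
    (G.cut x).numComponents ≤ G.numComponents + 1 := by
  classical
  let r : G.Flag → G.Flag → Prop := fun a b => b = G.v a ∨ b = G.h a ∨ b = (G.cut x).e a
  have h1 := Quot.card_le_merge r x (G.e x)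
  have h2 : Nat.card (Quot fun a b => r a b ∨ (a = x ∧ b = G.e x)) ≤ Nat.card G.Component := by
    refine Quot.card_le_of_imp (α := G.Flag) ?_
    have kh : ∀ z, Quot.mk (fun a b => r a b ∨ (a = x ∧ b = G.e x)) (G.h z) = Quot.mk _ z :=
      fun z => Quot.sound_symm (Or.inl (Or.inr (Or.inl rfl)))
    have kx : Quot.mk (fun a b => r a b ∨ (a = x ∧ b = G.e x)) x = Quot.mk _ (G.e x) :=
      Quot.sound (Or.inr ⟨rfl, rfl⟩)
    rintro a b (rfl | rfl | rfl)
    · exact Quot.sound (Or.inl (Or.inl rfl))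
    · exact (kh a).symm
    · by_cases ha : a ∈ G.ribbonFlags x
      · rcases ha with rfl | rfl | rfl | rfl
        · exact kx
        · rw [← G.h_e, kh, kh]; exact kx
        · rw [G.e_e]; exact kx.symm
        · rw [G.h_e, G.e_e, ← G.h_e, kh, kh]; exact kx.symm
      · exact Quot.sound (Or.inl (Or.inr (Or.inr (by rw [cut_e, if_neg ha]))))
  have h3 : (G.cut x).numComponents = Nat.card (Quot r) + G.isolated := rfl
  unfold numComponents at *
  omega

theorem numEdges_cut (G : HERG) (x : G.Flag) (hx : G.IsEdge x) :
    (G.cut x).numEdges + 1 = G.numEdges := by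
  classical
  have h1 := G.four_mul_numEdges
  have h2 := (G.cut x).four_mul_numEdges
  have h3 := G.ribbonFlags_ncard x hx
  have h4 : Nat.card {y // G.IsEdge y} =
      Nat.card ({y // (G.cut x).IsEdge y} ⊕ G.ribbonFlags x) := by
    refine Nat.card_congr ⟨fun y => if h : y.1 ∈ G.ribbonFlags x then .inr ⟨y.1, h⟩ else
      .inl ⟨y.1, (isEdge_cut G x y.1).2 ⟨y.2, h⟩⟩,
      Sum.elim (fun y => ⟨y.1, ((isEdge_cut G x y.1).1 y.2).1⟩)
        (fun y => ⟨y.1, (G.isEdge_of_mem_ribbonFlags y.2).2 hx⟩), ?_, ?_⟩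
    · rintro ⟨y, hy⟩
      by_cases h : y ∈ G.ribbonFlags x <;> simp [h]
    · rintro (⟨y, hy⟩ | ⟨y, hy⟩)
      · simp [((isEdge_cut G x y).1 hy).2]
      · simp [hy]
  rw [Nat.card_sum, Nat.card_coe_set_eq] at h4
  omega

/-- Split the states according to whether they contain the edge. For those that do not, only the
reference rank changes, by the number of components that the cut creates. This number is the extra
exponent of `x₁ - 1`, which treats bridges and regular edges together. -/
theorem brPoly_eq_of_nonloop {R : Type*} [CommRing R] (hx : G.vertexOf x ≠ G.vertexOf (G.e x))
    (x₁ x₂ x₃ x₄ x₅ x₆ : R) :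
    G.brPoly x₁ x₂ x₃ x₄ x₅ x₆ =
      (x₁ - 1) ^ ((G.cut x).numComponents - G.numComponents) *
        (G.cut x).brPoly x₁ x₂ x₃ x₄ x₅ x₆ + (G.contract x).brPoly x₁ x₂ x₃ x₄ x₅ x₆ := by
  classical
  have hxe : G.IsEdge x := fun h => hx (by rw [h, vertexOf_h])
  rw [brPoly_eq_sum, brPoly_eq_sum, brPoly_eq_sum, sum_edgeSets_contract hxe,
    ← Finset.sum_filter_add_sum_filter_not _ (fun T => x ∈ T), add_comm]
  congr 1
  · rw [Finset.mul_sum]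
    refine Eq.trans ?_ (sum_edgeSets_cut (x := x) (fun T =>
      (x₁ - 1) ^ ((G.cut x).numComponents - G.numComponents) *
        weight (G.cut x).rank ((G.cut x).onFlags T) x₁ x₂ x₃ x₄ x₅ x₆)).symm
    refine Finset.sum_congr rfl fun T hT => ?_
    rw [Finset.mem_filter, mem_edgeSets] at hT
    obtain ⟨hT, hxT⟩ := hT
    have hi := (cut_onFlags_iso hT hxT).sameNumbers
    rw [hi.weight]
    have k1 := numComponents_le_cut G x
    have k2 := numComponents_le_onFlags ((isEdgeSet_cut (x := x) T).2 ⟨hT, hxT⟩)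
    have k3 := hi.components
    have k4 := (G.onFlags T).numComponents_le_numVertices
    have v3 : (G.onFlags T).numVertices = G.numVertices := rfl
    have v4 : (G.cut x).numVertices = G.numVertices := rfl
    have e1 : G.rank - (G.onFlags T).rank = ((G.cut x).numComponents - G.numComponents) +
        ((G.cut x).rank - (G.onFlags T).rank) := by
      unfold rank; omega
    unfold weight
    rw [e1, pow_add]
    ring
  · refine Finset.sum_congr rfl fun T hT => ?_
    rw [Finset.mem_filter, mem_edgeSets] at hT
    rw [weight_contract hx hT.1 hT.2]

theorem numComponents_eq_one (h : G.numVertices = 1) : G.numComponents = 1 := by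
  have h1 := G.numComponents_le_numVertices
  have h2 : 0 < G.numComponents := by
    unfold numComponents
    unfold numVertices at h
    rcases Nat.eq_zero_or_pos G.isolated with h0 | h0
    · have : Nonempty G.Vertex := by
        by_contra hne
        rw [not_nonempty_iff] at hne
        simp [h0] at h
      obtain ⟨⟨x⟩⟩ := this
      have : 0 < Nat.card G.Component := Nat.card_pos_iff.2 ⟨⟨Quot.mk _ x⟩, inferInstance⟩
      omega
    · omega
  omega

/-- The contributions of the spanning subgraphs that contain both edges. -/
theorem brPoly_contract_sub_cut {R : Type*} [CommRing R] (hV : G.numVertices = 2)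
    (hx : G.vertexOf x ≠ G.vertexOf (G.e x)) {y : G.Flag} (hxy : y ∉ G.ribbonFlags x)
    (x₁ x₂ x₃ x₄ x₅ x₆ : R) [DecidablePred fun T : Set G.Flag => x ∈ T ∧ y ∈ T] :
    (G.contract x).brPoly x₁ x₂ x₃ x₄ x₅ x₆ -
      ((G.contract x).cut ⟨y, hxy⟩).brPoly x₁ x₂ x₃ x₄ x₅ x₆ =
    ∑ T ∈ G.edgeSets with x ∈ T ∧ y ∈ T, weight G.rank (G.onFlags T) x₁ x₂ x₃ x₄ x₅ x₆ := by
  classical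
  have hxe : G.IsEdge x := fun h => hx (by rw [h, vertexOf_h])
  have hV1 : (G.contract x).numVertices = 1 := by
    have := numVertices_contract hx
    omega
  have hV2 : ((G.contract x).cut ⟨y, hxy⟩).numVertices = 1 := hV1
  have hr : ((G.contract x).cut ⟨y, hxy⟩).rank = (G.contract x).rank := by
    unfold rank
    rw [numComponents_eq_one hV1, numComponents_eq_one hV2, hV1, hV2]
  rw [brPoly_eq_sum, brPoly_eq_sum, hr, sub_eq_iff_eq_add']
  refine Eq.trans (Finset.sum_filter_add_sum_filter_not _
    (fun T : Set (G.contract x).Flag => (⟨y, hxy⟩ : (G.contract x).Flag) ∉ T) _).symm ?_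
  congr 1
  · refine Eq.trans ?_ (sum_edgeSets_cut (G := G.contract x) (x := ⟨y, hxy⟩) (fun T =>
      weight (G.contract x).rank (((G.contract x).cut ⟨y, hxy⟩).onFlags T)
        x₁ x₂ x₃ x₄ x₅ x₆)).symm
    refine Finset.sum_congr rfl fun T hT => ?_
    rw [Finset.mem_filter, mem_edgeSets] at hT
    rw [(cut_onFlags_iso hT.1 hT.2).sameNumbers.weight]
  · rw [Finset.sum_filter, sum_edgeSets_contract hxe, Finset.sum_filter, Finset.sum_filter]
    refine Finset.sum_congr rfl fun T hT => ?_
    rw [mem_edgeSets] at hT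
    by_cases hxT : x ∈ T
    · rw [if_pos hxT]
      by_cases hy : y ∈ T
      · exact (if_pos (fun h => h hy)).trans
          ((weight_contract hx hT hxT _ _ _ _ _ _).trans (if_pos ⟨hxT, hy⟩).symm)
      · exact (if_neg (fun h => h hy)).trans (if_neg fun h => hy h.2).symm
    · rw [if_neg hxT, if_neg fun h => hxT h.1]

end CutSums

/-- The polynomial of the theorem on universality. -/
noncomputable def scaledPoly {R : Type*} [CommRing R] (α x y z s w t : R) (G : HERG) : R :=
  α ^ G.numComponents * G.brPoly x y z s w t

theorem scaledPoly_eq_of_class {R : Type*} [CommRing R] (α x y z s w t : R) {G H : HERG}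
    (h : HRClass.of G = HRClass.of H) :
    scaledPoly α x y z s w t G = scaledPoly α x y z s w t H := by
  unfold scaledPoly
  rw [numComponents_eq_of_class h, brPoly_eq_of_class _ _ _ _ _ _ h]

theorem isLoop_iff {G : HERG} {x : G.Flag} (hx : G.IsEdge x) :
    ¬ G.IsLoop x ↔ G.vertexOf x ≠ G.vertexOf (G.e x) := by
  simp [IsLoop, hx]

/-- Both differences are sums over the states that contain both edges, and all four graphs have one
component, so the power of `α` is the same. -/
theorem scaledPoly_of_related {R : Type*} [CommRing R] (α x y z s w t : R) {G D D' E E' : HERG}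
    {a b : G.Flag} (hab : b ∉ G.ribbonFlags a) (hba : a ∉ G.ribbonFlags b)
    (hV : G.numVertices = 2) (ha : G.vertexOf a ≠ G.vertexOf (G.e a))
    (hb : G.vertexOf b ≠ G.vertexOf (G.e b)) (hD : HRClass.of D = HRClass.of (G.contract a))
    (hD' : HRClass.of D' = HRClass.of ((G.contract a).cut ⟨b, hab⟩))
    (hE : HRClass.of E = HRClass.of (G.contract b))
    (hE' : HRClass.of E' = HRClass.of ((G.contract b).cut ⟨a, hba⟩)) :
    scaledPoly α x y z s w t D - scaledPoly α x y z s w t D' =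
      scaledPoly α x y z s w t E - scaledPoly α x y z s w t E' := by
  classical
  rw [scaledPoly_eq_of_class _ _ _ _ _ _ _ hD, scaledPoly_eq_of_class _ _ _ _ _ _ _ hD',
    scaledPoly_eq_of_class _ _ _ _ _ _ _ hE, scaledPoly_eq_of_class _ _ _ _ _ _ _ hE']
  have h1 : (G.contract a).numVertices = 1 := by
    have := numVertices_contract ha; omega
  have h2 : (G.contract b).numVertices = 1 := by
    have := numVertices_contract hb; omega
  have h3 : ((G.contract a).cut ⟨b, hab⟩).numVertices = 1 := h1
  have h4 : ((G.contract b).cut ⟨a, hba⟩).numVertices = 1 := h2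
  unfold scaledPoly
  rw [numComponents_eq_one h1, numComponents_eq_one h2, numComponents_eq_one h3,
    numComponents_eq_one h4, ← mul_sub, ← mul_sub, brPoly_contract_sub_cut hV ha hab,
    brPoly_contract_sub_cut hV hb hba]
  simp only [and_comm]

/-- The universal form of the rules for contraction and cut. -/
theorem scaledPoly_of_nonloop {R : Type*} [CommRing R] (α : Rˣ) (x y z s w t : R) {G : HERG}
    {a : G.Flag} (ha : G.vertexOf a ≠ G.vertexOf (G.e a)) :
    scaledPoly (α : R) x y z s w t G =
      ((↑α⁻¹ : R) * (x - 1)) ^ ((G.cut a).numComponents - G.numComponents) *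
        scaledPoly (α : R) x y z s w t (G.cut a) +
      scaledPoly (α : R) x y z s w t (G.contract a) := by
  unfold scaledPoly
  rw [brPoly_eq_of_nonloop ha, numComponents_contract ha, mul_add]
  congr 1
  have h1 := numComponents_le_cut G a
  obtain ⟨d, hd⟩ := Nat.exists_eq_add_of_le h1
  rw [hd, Nat.add_sub_cancel_left, pow_add, mul_pow]
  have : (↑α⁻¹ : R) ^ d * (α : R) ^ d = 1 := by rw [← mul_pow, Units.inv_mul, one_pow]
  calc _ = (((↑α⁻¹ : R) ^ d * (α : R) ^ d)) * ((α : R) ^ G.numComponents * ((x - 1) ^ d *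
        (G.cut a).brPoly x y z s w t)) := by rw [this, one_mul]
    _ = _ := by ring

end HERG

namespace HERG

/-! ### Recognising contractions -/

/-- The condition `hface` says that no boundary circle runs only along the contracted ribbon, so
that the contraction creates no isolated vertex. -/
theorem iso_contract {G H : HERG} {x : G.Flag} (ψ : H.Flag → G.Flag)
    (hinj : Function.Injective ψ) (hmem : ∀ w, ψ w ∉ G.ribbonFlags x)
    (hsurj : ∀ u, u ∉ G.ribbonFlags x → ∃ w, ψ w = u) (hh : ∀ w, ψ (H.h w) = G.h (ψ w))
    (he : ∀ w, ψ (H.e w) = G.e (ψ w)) (hv : ∀ w, G.contractArc x (ψ w) = ψ (H.v w))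
    (hi : H.isolated = G.isolated)
    (hface : ∀ s ∈ G.ribbonFlags x, ∃ u, u ∉ G.ribbonFlags x ∧ G.faceOf u = G.faceOf s) :
    H.Iso (G.contract x) := by
  refine ⟨?_, Equiv.ofBijective (fun w => ⟨ψ w, hmem w⟩) ⟨?_, ?_⟩, fun w => ⟨?_, ?_, ?_⟩⟩
  · have : IsEmpty {f : G.Face // ∀ y, G.faceOf y = f → y ∈ G.ribbonFlags x} := by
      refine ⟨?_⟩
      rintro ⟨⟨s⟩, hf⟩
      obtain ⟨u, hu, hus⟩ := hface s (hf s rfl)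
      exact hu (hf u hus)
    change _ = G.isolated + Nat.card {f : G.Face // ∀ y, G.faceOf y = f → y ∈ G.ribbonFlags x}
    simp [hi]
  · exact fun a b hab => hinj (congrArg Subtype.val hab)
  · rintro ⟨u, hu⟩
    obtain ⟨w, rfl⟩ := hsurj u hu
    exact ⟨w, rfl⟩
  · exact Subtype.ext (hv w).symm
  · exact Subtype.ext (hh w)
  · exact Subtype.ext (he w)

section Arcs

variable {G : HERG} {x a s s' c : G.Flag}

/-- The subscripts of this lemma and of the next two count the sides of the contracted ribbon that
the arc follows. -/
theorem contractArc_eq₀ (h1 : G.v a = c) (h2 : c ∉ G.ribbonFlags x) : G.contractArc x a = c := by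
  subst h1; exact if_pos h2

theorem contractArc_eq₁ (h1 : G.v a = s) (h2 : s ∈ G.ribbonFlags x) (h3 : G.v (G.e s) = c)
    (h4 : c ∉ G.ribbonFlags x) : G.contractArc x a = c := by
  subst h1 h3; exact (if_neg (not_not.2 h2)).trans (if_pos h4)

theorem contractArc_eq₂ (h1 : G.v a = s) (h2 : s ∈ G.ribbonFlags x) (h3 : G.v (G.e s) = s')
    (h4 : s' ∈ G.ribbonFlags x) (h5 : G.v (G.e s') = c) : G.contractArc x a = c := by
  subst h1 h3 h5; exact (if_neg (not_not.2 h2)).trans (if_neg (not_not.2 h4))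

end Arcs

/-! ### Splitting a vertex -/

section Split

open Classical in
/-- Join the two arcs at `s` and at `t` of the vertex boundaries by a new untwisted edge whose
contraction gives back `G`. -/
noncomputable def split (G : HERG) (s t : G.Flag) (h1 : t ≠ s) (h2 : t ≠ G.v s) : HERG where
  Flag := G.Flag ⊕ (Bool × Bool)
  v := Sum.elim
    (fun w => if w = s then .inr (false, false) else if w = G.v s then .inr (true, false) else
      if w = t then .inr (false, true) else if w = G.v t then .inr (true, true) else .inl (G.v w))
    (fun i => .inl (if i.2 then (if i.1 then G.v t else t) else (if i.1 then G.v s else s)))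
  h := Sum.map G.h fun i => (i.1, !i.2)
  e := Sum.map G.e fun i => (!i.1, i.2)
  isolated := G.isolated
  v_v := by
    have hv := G.v_v
    have hs := G.v_ne s
    have ht := G.v_ne t
    have h3 : G.v t ≠ s := fun h => h2 (by rw [← h, hv])
    have h4 : G.v t ≠ G.v s := fun h => h1 (G.v_inj.1 h)
    rintro (w | ⟨_ | _, _ | _⟩)
    · by_cases e1 : w = s
      · simp [e1]
      · by_cases e2 : w = G.v s
        · subst e2; simp [hs]
        · by_cases e3 : w = t
          · subst e3; simp [e1, e2]
          · by_cases e4 : w = G.v t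
            · subst e4; simp [e1, e2, e3]
            · have e5 : G.v w ≠ s := fun h => e2 (by rw [← h, hv])
              have e6 : G.v w ≠ t := fun h => e4 (by rw [← h, hv])
              simp [e1, e2, e3, e4, e5, e6, G.v_inj, hv]
    all_goals simp [hs, ht, h1, h2, h3, h4]
  h_h := by rintro (w | ⟨i, j⟩) <;> simp [G.h_h]
  e_e := by rintro (w | ⟨i, j⟩) <;> simp [G.e_e]
  v_ne := by
    rintro (w | ⟨i, j⟩)
    · have := G.v_ne w
      simp only [Sum.elim_inl]
      split_ifs <;> simp [this]
    · simp
  h_ne := by rintro (w | ⟨i, j⟩) <;> simp [G.h_ne]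
  e_ne := by rintro (w | ⟨i, j⟩) <;> simp [G.e_ne]
  h_e := by rintro (w | ⟨i, j⟩) <;> simp [G.h_e]

variable {G : HERG} {s t : G.Flag} {h1 : t ≠ s} {h2 : t ≠ G.v s}

/-- The new flag `(i, j)` belongs to the end `i` of the new edge: the end `false` lies between `s`
and `t`, the end `true` between `G.v s` and `G.v t`. -/
theorem split_v_s : (G.split s t h1 h2).v (.inl s) = .inr (false, false) := if_pos rfl
theorem split_v_vs : (G.split s t h1 h2).v (.inl (G.v s)) = .inr (true, false) := by
  simp [split, G.v_ne]
theorem split_v_t : (G.split s t h1 h2).v (.inl t) = .inr (false, true) := by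
  simp [split, h1, h2]
theorem split_v_vt : (G.split s t h1 h2).v (.inl (G.v t)) = .inr (true, true) := by
  have h3 : G.v t ≠ s := fun h => h2 (by rw [← h, G.v_v])
  simp [split, h1, h3, G.v_ne, G.v_inj]
theorem split_v_of_ne {w : G.Flag} (e1 : w ≠ s) (e2 : w ≠ G.v s) (e3 : w ≠ t)
    (e4 : w ≠ G.v t) : (G.split s t h1 h2).v (.inl w) = .inl (G.v w) := by
  simp [split, e1, e2, e3, e4]

theorem split_ribbonFlags_inr (u : G.Flag ⊕ (Bool × Bool)) :
    u ∈ (G.split s t h1 h2).ribbonFlags (.inr (false, false)) ↔ ∃ i, u = .inr i := by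
  constructor
  · rintro (rfl | rfl | rfl | rfl) <;> exact ⟨_, rfl⟩
  · rintro ⟨⟨_ | _, _ | _⟩, rfl⟩
    exacts [Or.inl rfl, Or.inr (Or.inl rfl), Or.inr (Or.inr (Or.inl rfl)),
      Or.inr (Or.inr (Or.inr rfl))]

theorem split_ribbonFlags_inl (y : G.Flag) (u : G.Flag ⊕ (Bool × Bool)) :
    u ∈ (G.split s t h1 h2).ribbonFlags (.inl y) ↔ ∃ w ∈ G.ribbonFlags y, u = .inl w := by
  constructor
  · rintro (rfl | rfl | rfl | rfl)
    exacts [⟨_, Or.inl rfl, rfl⟩, ⟨_, Or.inr (Or.inl rfl), rfl⟩,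
      ⟨_, Or.inr (Or.inr (Or.inl rfl)), rfl⟩, ⟨_, Or.inr (Or.inr (Or.inr rfl)), rfl⟩]
  · rintro ⟨w, rfl | rfl | rfl | rfl, rfl⟩
    exacts [Or.inl rfl, Or.inr (Or.inl rfl), Or.inr (Or.inr (Or.inl rfl)),
      Or.inr (Or.inr (Or.inr rfl))]

theorem split_contract_iso :
    G.Iso ((G.split s t h1 h2).contract (.inr (false, false))) := by
  have hS := split_ribbonFlags_inr (G := G) (h1 := h1) (h2 := h2)
  have hn : ∀ w, (Sum.inl w : G.Flag ⊕ (Bool × Bool)) ∉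
      (G.split s t h1 h2).ribbonFlags (.inr (false, false)) := by
    intro w hw
    obtain ⟨i, hi⟩ := (hS _).1 hw
    cases hi
  refine iso_contract (fun w => .inl w) Sum.inl_injective hn ?_ (fun _ => rfl) (fun _ => rfl)
    ?_ rfl ?_
  · rintro (w | i) hu
    · exact ⟨w, rfl⟩
    · exact (hu ((hS _).2 ⟨i, rfl⟩)).elim
  · intro w
    by_cases e1 : w = s
    · subst e1
      exact contractArc_eq₁ split_v_s ((hS _).2 ⟨_, rfl⟩) rfl (hn _)
    · by_cases e2 : w = G.v s
      · subst e2
        refine (contractArc_eq₁ split_v_vs ((hS _).2 ⟨_, rfl⟩) rfl (hn _)).trans ?_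
        rw [G.v_v]; rfl
      · by_cases e3 : w = t
        · subst e3
          exact contractArc_eq₁ split_v_t ((hS _).2 ⟨_, rfl⟩) rfl (hn _)
        · by_cases e4 : w = G.v t
          · subst e4
            refine (contractArc_eq₁ split_v_vt ((hS _).2 ⟨_, rfl⟩) rfl (hn _)).trans ?_
            rw [G.v_v]; rfl
          · exact contractArc_eq₀ (split_v_of_ne e1 e2 e3 e4) (hn _)
  · intro u hu
    obtain ⟨i, rfl⟩ := (hS _).1 hu
    exact ⟨_, hn _, Quot.sound_symm (Or.inl rfl)⟩

end Split

/-! ### Handle slides -/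

/-- The same ribbons attached in a different order. -/
def reorder (G : HERG) (v' : G.Flag → G.Flag) (hv : ∀ x, v' (v' x) = x) (hne : ∀ x, v' x ≠ x) :
    HERG :=
  { G with v := v', v_v := hv, v_ne := hne }

section Slide

variable {D : HERG} {y : D.Flag}

open Classical in
/-- The flags of a handle slide over the ribbon of `y` in the split graph. -/
noncomputable def slideMap (D : HERG) (y w : D.Flag) : D.Flag ⊕ (Bool × Bool) :=
  if w = y then .inr (true, true) else if w = D.h y then .inr (true, false) else
    if w = D.e y then .inr (false, true) else if w = D.h (D.e y) then .inr (false, false)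
    else .inl w

theorem slideMap_injective (D : HERG) (y : D.Flag) : Function.Injective (slideMap D y) := by
  refine Function.LeftInverse.injective (g := Sum.elim id fun i =>
    if i.1 then (if i.2 then y else D.h y) else (if i.2 then D.e y else D.h (D.e y))) ?_
  intro w
  unfold slideMap
  split_ifs with h1 h2 h3 h4 <;> simp_all

set_option maxHeartbeats 1000000 in
/-- A handle slide of the ribbon end next to `y` along the side of the ribbon that starts
at `y` is a rotation or a twist. -/
theorem slide_step (hy : D.IsEdge y) (hV : D.numVertices = 1) (hb : D.v y ∉ D.ribbonFlags y)
    (hz : D.v (D.h (D.v y)) ≠ D.h y) (hze : D.v (D.h (D.v y)) ≠ D.e y)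
    (v' : D.Flag → D.Flag) (hv' : ∀ x, v' (v' x) = x) (hne' : ∀ x, v' x ≠ x)
    (s1 : v' y = D.v (D.h (D.v y))) (s2 : v' (D.h (D.v y)) = D.e y)
    (s3 : v' (D.v y) = D.v (D.e y))
    (s4 : ∀ w, w ≠ y → w ≠ D.v y → w ≠ D.h (D.v y) → w ≠ D.v (D.h (D.v y)) → w ≠ D.e y →
      w ≠ D.v (D.e y) → v' w = D.v w) :
    HRClass.Step (HRClass.of D) (HRClass.of (D.reorder v' hv' hne')) := by
  have vv := D.v_v
  have hh := D.h_h
  have ee := D.e_e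
  set b := D.v y with hbdef
  set z := D.v (D.h b) with hzdef
  have b1 : b ≠ y := D.v_ne y
  have b2 : b ≠ D.h y := fun h => hb (Or.inr (Or.inl h))
  have b3 : b ≠ D.e y := fun h => hb (Or.inr (Or.inr (Or.inl h)))
  have b4 : b ≠ D.h (D.e y) := fun h => hb (Or.inr (Or.inr (Or.inr h)))
  have hb' : D.h b ∉ D.ribbonFlags y := mt (D.h_mem_ribbonFlags_iff y b).1 hb
  have c1 : D.h b ≠ y := fun h => hb' (Or.inl h)
  have c2 : D.h b ≠ D.h y := fun h => hb' (Or.inr (Or.inl h))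
  have c3 : D.h b ≠ D.e y := fun h => hb' (Or.inr (Or.inr (Or.inl h)))
  have c4 : D.h b ≠ D.h (D.e y) := fun h => hb' (Or.inr (Or.inr (Or.inr h)))
  have y1 : D.h y ≠ y := D.h_ne y
  have y2 : D.e y ≠ y := D.e_ne y
  have y3 : D.e y ≠ D.h y := hy
  have y4 : D.h (D.e y) ≠ y := fun h => y3 (by rw [← h, hh, h])
  have y5 : D.h (D.e y) ≠ D.h y := fun h => y2 (D.h_inj.1 h)
  have y6 : D.h (D.e y) ≠ D.e y := D.h_ne _
  have yp : y ≠ D.v (D.h y) := fun h => b2 ((congrArg D.v h).trans (vv _))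
  have z1 : z ≠ y := fun h => (D.h_ne b) (by rw [← vv (D.h b), ← hzdef, h])
  have zb : z ≠ b := fun h => c1 (D.v_inj.1 h)
  have zb' : z ≠ D.h b := D.v_ne _
  have hs1 : D.h b ≠ D.v (D.h y) := fun h => hz (by rw [hzdef, h, vv])
  -- The new vertex carries only the end of the ribbon at `y`, its neighbour `b`, and one end of the
  -- new edge. Contracting the new edge restores `D`. Contracting the ribbon of `y` instead carries
  -- `b` along that ribbon to its other end. The hypothesis `hz` keeps the two arcs at which the
  -- vertex is split distinct.
  let G := D.split (D.h y) (D.h b) c2 hs1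
  have q1 : D.v (D.e y) ≠ y := fun h => b3 ((congrArg D.v h.symm).trans (vv _))
  have gy : G.v (.inl y) = .inl b :=
    split_v_of_ne y1.symm yp c1.symm z1.symm
  have gb : G.v (.inl b) = .inl y := (congrArg G.v gy.symm).trans (G.v_v _)
  have hS1 := split_ribbonFlags_inl (h1 := c2) (h2 := hs1) y
  have hS2 := split_ribbonFlags_inr (G := D) (h1 := c2) (h2 := hs1)
  have hSinr : ∀ i, Sum.inr i ∉ G.ribbonFlags (.inl y) := by
    intro i hi
    obtain ⟨w, -, hw⟩ := (hS1 _).1 hi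
    cases hw
  have hSinl : ∀ w, w ∉ D.ribbonFlags y → Sum.inl w ∉ G.ribbonFlags (.inl y) := by
    intro w hw hi
    obtain ⟨u, hu, hw'⟩ := (hS1 _).1 hi
    exact hw (Sum.inl_injective hw' ▸ hu)
  have hSmem : ∀ w, w ∈ D.ribbonFlags y → Sum.inl w ∈ G.ribbonFlags (.inl y) :=
    fun w hw => (hS1 _).2 ⟨w, hw, rfl⟩
  have my : y ∈ D.ribbonFlags y := Or.inl rfl
  have mhy : D.h y ∈ D.ribbonFlags y := Or.inr (Or.inl rfl)
  have mey : D.e y ∈ D.ribbonFlags y := Or.inr (Or.inr (Or.inl rfl))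
  have mhey : D.h (D.e y) ∈ D.ribbonFlags y := Or.inr (Or.inr (Or.inr rfl))
  have ehey : D.e (D.h (D.e y)) = D.h y := by rw [← D.h_e, ee]
  have ehy : D.e (D.h y) = D.h (D.e y) := (D.h_e y).symm
  -- The flags of the separated vertex. Both edges leave this set, so neither is a loop.
  let U : G.Flag → Prop := fun u => u = .inl y ∨ u = .inl (D.h y) ∨ u = .inl b ∨ u = .inl (D.h b) ∨
    u = .inr (false, false) ∨ u = .inr (false, true)
  have U1 : U (.inl y) := Or.inl rfl
  have U2 : U (.inl (D.h y)) := Or.inr (Or.inl rfl)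
  have U3 : U (.inl b) := Or.inr (Or.inr (Or.inl rfl))
  have U4 : U (.inl (D.h b)) := Or.inr (Or.inr (Or.inr (Or.inl rfl)))
  have U5 : U (.inr (false, false)) := Or.inr (Or.inr (Or.inr (Or.inr (Or.inl rfl))))
  have U6 : U (.inr (false, true)) := Or.inr (Or.inr (Or.inr (Or.inr (Or.inr rfl))))
  have hUv : ∀ u, U u → U (G.v u) := by
    rintro u (rfl | rfl | rfl | rfl | rfl | rfl)
    · exact gy ▸ U3
    · have : G.v (.inl (D.h y)) = .inr (false, false) := split_v_s
      exact this ▸ U5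
    · exact gb ▸ U1
    · have : G.v (.inl (D.h b)) = .inr (false, true) := split_v_t
      exact this ▸ U6
    · exact Or.inr (Or.inl rfl)
    · exact Or.inr (Or.inr (Or.inr (Or.inl rfl)))
  have hUh : ∀ u, U u → U (G.h u) := by
    rintro u (rfl | rfl | rfl | rfl | rfl | rfl)
    · exact Or.inr (Or.inl rfl)
    · exact Or.inl (congrArg Sum.inl (hh y))
    · exact Or.inr (Or.inr (Or.inr (Or.inl rfl)))
    · exact Or.inr (Or.inr (Or.inl (congrArg Sum.inl (hh b))))
    · exact Or.inr (Or.inr (Or.inr (Or.inr (Or.inr rfl))))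
    · exact Or.inr (Or.inr (Or.inr (Or.inr (Or.inl rfl))))
  have hU : ∀ a c, G.vertexOf a = G.vertexOf c → (U a ↔ U c) := by
    intro a c
    refine Quot.iff_of_mk_eq U ?_
    rintro a c (rfl | rfl)
    · exact ⟨hUv a, fun h => by simpa [G.v_v] using hUv _ h⟩
    · exact ⟨hUh a, fun h => by simpa [G.h_h] using hUh _ h⟩
  have hly : G.vertexOf (.inl y) ≠ G.vertexOf (G.e (.inl y)) := by
    intro h
    have h' : U (.inl (D.e y)) := (hU _ _ h).1 (Or.inl rfl)
    rcases h' with h | h | h | h | h | h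
    exacts [y2 (Sum.inl_injective h), y3 (Sum.inl_injective h), b3 (Sum.inl_injective h).symm,
      c3 (Sum.inl_injective h).symm, Sum.inl_ne_inr h, Sum.inl_ne_inr h]
  have hlx : G.vertexOf (.inr (false, false)) ≠ G.vertexOf (G.e (.inr (false, false))) := by
    intro h
    have h' : U (.inr (true, false)) := (hU _ _ h).1 U5
    rcases h' with h | h | h | h | h | h
    exacts [Sum.inr_ne_inl h, Sum.inr_ne_inl h, Sum.inr_ne_inl h, Sum.inr_ne_inl h,
      Bool.noConfusion (congrArg Prod.fst (Sum.inr_injective h)),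
      Bool.noConfusion (congrArg Prod.fst (Sum.inr_injective h))]
  -- After contraction of the ribbon of `y` the new edge plays its role; this is the identification
  -- `slideMap`.
  have hiso : (D.reorder v' hv' hne').Iso (G.contract (.inl y)) := by
    have py : slideMap D y y = .inr (true, true) := if_pos rfl
    have phy : slideMap D y (D.h y) = .inr (true, false) := by simp [slideMap, y1]
    have pey : slideMap D y (D.e y) = .inr (false, true) := by simp [slideMap, y2, y3]
    have phey : slideMap D y (D.h (D.e y)) = .inr (false, false) := by
      simp [slideMap, y4, y5, y6]
    have pout : ∀ w, w ∉ D.ribbonFlags y → slideMap D y w = .inl w := by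
      intro w hw
      have n1 : w ≠ y := fun h => hw (Or.inl h)
      have n2 : w ≠ D.h y := fun h => hw (Or.inr (Or.inl h))
      have n3 : w ≠ D.e y := fun h => hw (Or.inr (Or.inr (Or.inl h)))
      have n4 : w ≠ D.h (D.e y) := fun h => hw (Or.inr (Or.inr (Or.inr h)))
      simp [slideMap, n1, n2, n3, n4]
    have pmem : ∀ w, slideMap D y w ∉ G.ribbonFlags (.inl y) := by
      intro w
      by_cases hw : w ∈ D.ribbonFlags y
      · rcases hw with rfl | rfl | rfl | rfl
        · rw [py]; exact hSinr _
        · rw [phy]; exact hSinr _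
        · rw [pey]; exact hSinr _
        · rw [phey]; exact hSinr _
      · rw [pout w hw]; exact hSinl w hw
    refine iso_contract (H := D.reorder v' hv' hne') (slideMap D y) ?_ pmem ?_ ?_ ?_ ?_ rfl ?_
    · exact slideMap_injective D y
    · rintro (w | ⟨_ | _, _ | _⟩) hu
      · exact ⟨w, pout w fun h => hu (hSmem w h)⟩
      · exact ⟨_, phey⟩
      · exact ⟨_, pey⟩
      · exact ⟨_, phy⟩
      · exact ⟨_, py⟩
    · intro (w : D.Flag)
      change slideMap D y (D.h w) = G.h (slideMap D y w)
      by_cases hw : w ∈ D.ribbonFlags y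
      · rcases hw with rfl | rfl | rfl | rfl
        · rw [phy, py]; rfl
        · rw [hh, phy, py]; rfl
        · rw [phey, pey]; rfl
        · rw [hh, phey, pey]; rfl
      · rw [pout w hw, pout _ (mt (D.h_mem_ribbonFlags_iff y w).1 hw)]; rfl
    · intro (w : D.Flag)
      change slideMap D y (D.e w) = G.e (slideMap D y w)
      by_cases hw : w ∈ D.ribbonFlags y
      · rcases hw with rfl | rfl | rfl | rfl
        · rw [pey, py]; rfl
        · rw [ehy, phey, phy]; rfl
        · rw [ee, py, pey]; rfl
        · rw [ehey, phey, phy]; rfl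
      · rw [pout w hw, pout _ (mt (D.e_mem_ribbonFlags_iff y w).1 hw)]; rfl
    · let Q : D.Flag → Prop := fun w => G.contractArc (.inl y) (slideMap D y w) = slideMap D y (v' w)
      have hQ : ∀ w, Q w → Q (v' w) := by
        intro w hw
        change G.contractArc _ _ = _
        rw [← show G.contractArc (.inl y) (slideMap D y w) = slideMap D y (v' w) from hw,
          (G.contractArc_cases (.inl y) _ (pmem w)).2.1, hv']
      have hQ' : ∀ w, Q (v' w) → Q w := fun w hw => by simpa [hv'] using hQ _ hw
      have gtt : G.v (.inr (true, true)) = .inl z := rfl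
      have gtf : G.v (.inr (true, false)) = .inl (D.v (D.h y)) := rfl
      have gff : G.v (.inr (false, false)) = .inl (D.h y) := rfl
      have gft : G.v (.inr (false, true)) = .inl (D.h b) := rfl
      have ghy : G.v (.inl (D.h y)) = .inr (false, false) := split_v_s
      have gz : G.v (.inl z) = .inr (true, true) := split_v_vt
      have gp : G.v (.inl (D.v (D.h y))) = .inr (true, false) := split_v_vs
      have Qy : Q y := by
        change G.contractArc _ _ = _
        rw [s1, py]
        by_cases hze' : z = D.h (D.e y)
        · rw [hze', phey]
          exact contractArc_eq₁ (gtt.trans (by rw [hze'])) (hSmem _ mhey)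
            ((congrArg G.v (congrArg Sum.inl ehey)).trans ghy) (hSinr _)
        · have hzS : z ∉ D.ribbonFlags y := by
            rintro (h | h | h | h)
            exacts [z1 h, hz h, hze h, hze' h]
          rw [pout z hzS]
          exact contractArc_eq₀ gtt (hSinl _ hzS)
      have Qb' : Q (D.h b) := by
        change G.contractArc _ _ = _
        rw [s2, pout _ hb', pey]
        exact contractArc_eq₀ split_v_t (hSinr _)
      have Qb : Q b := by
        change G.contractArc _ _ = _
        rw [s3, pout _ hb]
        by_cases hp : D.e y = D.v (D.h y)
        · rw [hp, vv, phy]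
          exact contractArc_eq₁ gb (hSmem _ my) ((congrArg G.v (congrArg Sum.inl hp)).trans gp)
            (hSinr _)
        · have ge : G.v (.inl (D.e y)) = .inl (D.v (D.e y)) :=
            split_v_of_ne y3 hp c3.symm hze.symm
          by_cases hq : D.v (D.e y) = D.h (D.e y)
          · rw [hq, phey]
            exact contractArc_eq₂ gb (hSmem _ my) (ge.trans (by rw [hq])) (hSmem _ mhey)
              ((congrArg G.v (congrArg Sum.inl ehey)).trans ghy)
          · have hqS : D.v (D.e y) ∉ D.ribbonFlags y := by
              rintro (h | h | h | h)
              exacts [q1 h, hp (by rw [← h, vv]), D.v_ne _ h, hq h]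
            rw [pout _ hqS]
            exact contractArc_eq₁ gb (hSmem _ my) ge (hSinl _ hqS)
      intro (w : D.Flag)
      change Q w
      by_cases w1 : w = y
      · rw [w1]; exact Qy
      by_cases w2 : w = b
      · rw [w2]; exact Qb
      by_cases w3 : w = D.h b
      · rw [w3]; exact Qb'
      by_cases w4 : w = z
      · rw [w4, ← s1]; exact hQ _ Qy
      by_cases w5 : w = D.e y
      · rw [w5, ← s2]; exact hQ _ Qb'
      by_cases w6 : w = D.v (D.e y)
      · rw [w6, ← s3]; exact hQ _ Qb
      have hw := s4 w w1 w2 w3 w4 w5 w6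
      have u1 : D.v w ≠ y := fun h => w2 (by rw [hbdef, ← h, vv])
      have u2 : D.v w ≠ b := fun h => w1 (D.v_inj.1 h)
      have u3 : D.v w ≠ D.h b := fun h => w4 (by rw [hzdef, ← h, vv])
      have u4 : D.v w ≠ z := fun h => w3 (D.v_inj.1 h)
      have u5 : D.v w ≠ D.e y := fun h => w6 (by rw [← h, vv])
      have u6 : D.v w ≠ D.v (D.e y) := fun h => w5 (D.v_inj.1 h)
      have Qhy : w = D.h y → Q w := by
        intro hwy
        change G.contractArc _ _ = _
        rw [hw]
        subst hwy
        rw [phy]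
        by_cases hp : D.v (D.h y) = D.h (D.e y)
        · rw [hp, phey]
          exact contractArc_eq₁ (gtf.trans (by rw [hp])) (hSmem _ mhey)
            ((congrArg G.v (congrArg Sum.inl ehey)).trans ghy) (hSinr _)
        · have hpS : D.v (D.h y) ∉ D.ribbonFlags y := by
            rintro (h | h | h | h)
            exacts [u1 h, D.v_ne _ h, u5 h, hp h]
          rw [pout _ hpS]
          exact contractArc_eq₀ gtf (hSinl _ hpS)
      by_cases w7 : w = D.h y
      · exact Qhy w7
      by_cases w8 : D.v w = D.h y
      · refine hQ' w ?_
        rw [hw, w8]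
        have hw' := s4 (D.v w) u1 u2 u3 u4 u5 u6
        rw [w8] at hw' u1 u2 u3 u4 u5 u6
        change G.contractArc _ _ = _
        rw [hw', phy]
        have hwp : w = D.v (D.h y) := by rw [← w8, vv]
        by_cases hp : D.v (D.h y) = D.h (D.e y)
        · rw [hp, phey]
          exact contractArc_eq₁ (gtf.trans (by rw [hp])) (hSmem _ mhey)
            ((congrArg G.v (congrArg Sum.inl ehey)).trans ghy) (hSinr _)
        · have hpS : D.v (D.h y) ∉ D.ribbonFlags y := by
            rw [← hwp]
            rw [← hwp] at hp
            rintro (h | h | h | h)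
            exacts [w1 h, w7 h, w5 h, hp h]
          rw [pout _ hpS]
          exact contractArc_eq₀ gtf (hSinl _ hpS)
      have gw : G.v (.inl w) = .inl (D.v w) :=
        split_v_of_ne w7 (fun h => w8 (by rw [h, vv])) w3 w4
      have gvw : G.v (.inl (D.v w)) = .inl w := (congrArg G.v gw.symm).trans (G.v_v _)
      by_cases w9 : w = D.h (D.e y)
      · have hvS : D.v w ∉ D.ribbonFlags y := by
          rintro (h | h | h | h)
          exacts [u1 h, w8 h, u5 h, D.v_ne w (h.trans w9.symm)]
        change G.contractArc _ _ = _
        rw [hw, pout _ hvS]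
        subst w9
        rw [phey]
        exact contractArc_eq₁ gff (hSmem _ mhy) ((congrArg G.v (congrArg Sum.inl ehy)).trans gw)
          (hSinl _ hvS)
      have hwS : w ∉ D.ribbonFlags y := by
        rintro (h | h | h | h)
        exacts [w1 h, w7 h, w5 h, w9 h]
      change G.contractArc _ _ = _
      rw [hw, pout _ hwS]
      by_cases w10 : D.v w = D.h (D.e y)
      · rw [w10, phey]
        exact contractArc_eq₁ (gw.trans (by rw [w10])) (hSmem _ mhey)
          ((congrArg G.v (congrArg Sum.inl ehey)).trans ghy) (hSinr _)
      · have hvS : D.v w ∉ D.ribbonFlags y := by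
          rintro (h | h | h | h)
          exacts [u1 h, w8 h, u5 h, w10 h]
        rw [pout _ hvS]
        exact contractArc_eq₀ gw (hSinl _ hvS)
    · have fy : G.faceOf (.inl b) = G.faceOf (.inl y) := Quot.sound (Or.inl gb.symm)
      have fhy : G.faceOf (.inr (false, false)) = G.faceOf (.inl (D.h y)) :=
        Quot.sound (Or.inl rfl)
      have fe : ∀ w, G.faceOf (.inl (D.e w)) = G.faceOf (.inl w) :=
        fun w => Quot.sound_symm (Or.inr rfl)
      intro u hu
      obtain ⟨w, hw, rfl⟩ := (hS1 _).1 hu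
      rcases hw with rfl | rfl | rfl | rfl
      · exact ⟨_, hSinl _ hb, fy⟩
      · exact ⟨_, hSinr _, fhy⟩
      · exact ⟨_, hSinl _ hb, fy.trans (fe _).symm⟩
      · refine ⟨_, hSinr _, fhy.trans ?_⟩
        rw [← ehy, fe]
  have hD : D.Iso (G.contract (.inr (false, false))) := split_contract_iso
  have hxy : (Sum.inl y : G.Flag) ∉ G.ribbonFlags (.inr (false, false)) := by
    intro h
    obtain ⟨i, hi⟩ := (hS2 _).1 h
    cases hi
  have hyx : (Sum.inr (false, false) : G.Flag) ∉ G.ribbonFlags (.inl y) := hSinr _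
  have hGV : G.numVertices = 2 := by
    have e1 := numVertices_contract hlx
    have e2 := hD.sameNumbers.vertices
    omega
  have ex : G.IsEdge (.inr (false, false)) := fun h => hlx ((vertexOf_h G _).symm.trans (congrArg G.vertexOf h.symm))
  have ey : G.IsEdge (.inl y) := fun h => hly ((vertexOf_h G _).symm.trans (congrArg G.vertexOf h.symm))
  exact ⟨_, _, G, .inr (false, false), .inl y, hxy, hyx, hGV, ex, ey,
    (isLoop_iff ex).2 hlx, (isLoop_iff ey).2 hly, hD.of_eq, rfl, hiso.of_eq, rfl⟩

end Slide

end HERG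

namespace HERG

/-! ### Reading a one-vertex graph as a list of flags -/

section Paths

variable {F : Type} {v h : F → F}

/-- Walking along a vertex boundary from the flag `t` to the flag `t'` one meets the ribbon ends
whose first flags are listed. -/
def Path (v h : F → F) : F → List F → F → Prop
  | t, [], t' => v t = t'
  | t, f :: L, t' => v t = f ∧ Path v h (h f) L t'

/-- The whole vertex boundary, read off as a cyclic list. -/
def Cyc (v h : F → F) : List F → Prop
  | [] => True
  | f :: L => Path v h (h f) L f

theorem path_append_cons {A : List F} {t f t' : F} {B : List F} :
    Path v h t (A ++ f :: B) t' ↔ Path v h t A f ∧ Path v h (h f) B t' := by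
  induction A generalizing t with
  | nil => rfl
  | cons a A ih => simp only [List.cons_append, Path, ih, and_assoc]

theorem Cyc.rotate {A B : List F} (hc : Cyc v h (A ++ B)) : Cyc v h (B ++ A) := by
  cases A with
  | nil => simpa using hc
  | cons f A =>
    cases B with
    | nil => simpa using hc
    | cons g B =>
      have := path_append_cons.1 (show Path v h (h f) (A ++ g :: B) f from hc)
      exact path_append_cons.2 ⟨this.2, this.1⟩

/-- Walking backwards, the other flag of each ribbon end comes first. -/
theorem Path.flip (vv : ∀ x, v (v x) = x) (hh : ∀ x, h (h x) = x) {L : List F} {t t' : F}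
    (hp : Path v h t L t') : Path v h t' (L.reverse.map h) t := by
  induction L generalizing t with
  | nil => rw [← show v t = t' from hp]; exact vv t
  | cons f L ih =>
    obtain ⟨rfl, hp⟩ := hp
    rw [List.reverse_cons, List.map_append]
    refine path_append_cons.2 ⟨ih hp, ?_⟩
    rw [hh]; exact vv t

theorem Cyc.flip (vv : ∀ x, v (v x) = x) (hh : ∀ x, h (h x) = x) {L : List F}
    (hc : Cyc v h L) : Cyc v h (L.reverse.map h) := by
  cases L with
  | nil => trivial
  | cons f L =>
    rw [List.reverse_cons, List.map_append]
    refine Cyc.rotate (A := [h f]) ?_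
    have := Path.flip vv hh (show Path v h (h f) L f from hc)
    change Path v h (h (h f)) _ (h f)
    rwa [hh]

theorem Path.mem {A : List F} {t s : F} (hp : Path v h t A s) {w : F}
    (hw : w ∈ t :: A.map h) : v w ∈ A ++ [s] := by
  induction A generalizing t with
  | nil =>
    rw [List.map_nil, List.mem_singleton] at hw
    subst hw
    simp [show v w = s from hp]
  | cons a A ih =>
    rcases List.mem_cons.1 hw with rfl | hw
    · simp [hp.1]
    · exact List.mem_cons_of_mem _ (ih hp.2 hw)

/-- For a stretch of the circle between the places touched by a slide: inside, the arcs are the old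
ones; only its start and its arrival point are replaced. -/
theorem Path.change {v' : F → F} {A : List F} {t t' s s' : F} (hp : Path v h t A s)
    (hs : s ∉ A) (ht : (v t = s → v' t' = s') ∧ (v t ≠ s → v' t' = v t))
    (hA : ∀ w ∈ A.map h, (v w = s → v' w = s') ∧ (v w ≠ s → v' w = v w)) :
    Path v' h t' A s' := by
  induction A generalizing t t' with
  | nil => exact ht.1 hp
  | cons a A ih =>
    have hne : v t ≠ s := fun e => hs (by rw [← e, hp.1]; exact List.mem_cons_self)
    exact ⟨(ht.2 hne).trans hp.1, ih hp.2 (fun h' => hs (List.mem_cons_of_mem _ h'))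
      (hA _ List.mem_cons_self) fun w hw => hA w (List.mem_cons_of_mem _ hw)⟩

/-- The list contains exactly one flag of each ribbon end. -/
structure Transversal (h : F → F) (L : List F) : Prop where
  nodup : L.Nodup
  notMem : ∀ a ∈ L, h a ∉ L
  complete : ∀ a, a ∈ L ∨ h a ∈ L

theorem Transversal.perm {L L' : List F} (hL : Transversal h L) (hp : L.Perm L') :
    Transversal h L' :=
  ⟨hp.nodup_iff.1 hL.nodup, fun a ha => by rw [← hp.mem_iff] at ha ⊢; exact hL.notMem a ha,
    fun a => by rw [← hp.mem_iff, ← hp.mem_iff]; exact hL.complete a⟩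

theorem Transversal.flip_head (hh : ∀ x, h (h x) = x) (hne : ∀ x, h x ≠ x) {b : F} {L : List F}
    (hL : Transversal h (b :: L)) : Transversal h (h b :: L) := by
  have h1 := List.nodup_cons.1 hL.nodup
  have h2 : h b ∉ L := fun h' => hL.notMem b List.mem_cons_self (List.mem_cons_of_mem _ h')
  refine ⟨List.nodup_cons.2 ⟨h2, h1.2⟩, fun a ha => ?_, fun a => ?_⟩
  · rcases List.mem_cons.1 ha with rfl | ha
    · rw [hh, List.mem_cons, not_or]
      exact ⟨(hne b).symm, h1.1⟩
    · rw [List.mem_cons, not_or]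
      refine ⟨fun e => h1.1 ?_, fun h' => hL.notMem a (List.mem_cons_of_mem _ ha)
        (List.mem_cons_of_mem _ h')⟩
      rw [← hh b, ← e, hh]; exact ha
  · rcases hL.complete a with h' | h' <;> rcases List.mem_cons.1 h' with e | h'
    · right; rw [e]; exact List.mem_cons_self
    · left; exact List.mem_cons_of_mem _ h'
    · left; rw [← e, hh]; exact List.mem_cons_self
    · right; exact List.mem_cons_of_mem _ h'

theorem Transversal.map_flip (hh : ∀ x, h (h x) = x) {L : List F}
    (hL : Transversal h L) : Transversal h (L.map h) := by
  have hinj : Function.Injective h := Function.LeftInverse.injective hh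
  refine ⟨hL.nodup.map hinj, fun a ha => ?_, fun a => ?_⟩
  · obtain ⟨b, hb, rfl⟩ := List.mem_map.1 ha
    rw [List.mem_map_of_injective hinj]
    exact hL.notMem b hb
  · rw [List.mem_map_of_injective hinj]
    rcases hL.complete a with h' | h'
    · right; exact h'
    · left; exact List.mem_map.2 ⟨_, h', hh a⟩

end Paths

/-- The class of a one-vertex graph with the ribbons of `D`, attached in the order `L`. -/
def Realized (D : HERG) (L : List D.Flag) (c : HRClass) : Prop :=
  ∃ (v : D.Flag → D.Flag) (hv : ∀ x, v (v x) = x) (hne : ∀ x, v x ≠ x),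
    c = HRClass.of (D.reorder v hv hne) ∧ Cyc v D.h L ∧ Transversal D.h L

theorem numVertices_of_cyc {G : HERG} {L : List G.Flag} (hc : Cyc G.v G.h L)
    (hL : Transversal G.h L) (hne : L ≠ []) (hi : G.isolated = 0) : G.numVertices = 1 := by
  obtain ⟨f, L, rfl⟩ := List.exists_cons_of_ne_nil hne
  have key : ∀ (A : List G.Flag) (t s : G.Flag), Path G.v G.h t A s → ∀ a ∈ A,
      G.vertexOf a = G.vertexOf t := by
    intro A
    induction A with
    | nil => simp
    | cons b A ih =>
      rintro t s ⟨rfl, hp⟩ a ha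
      rcases List.mem_cons.1 ha with rfl | ha
      · exact vertexOf_v G t
      · rw [ih _ _ hp a ha, vertexOf_h, vertexOf_v]
  have hall : ∀ a ∈ f :: L, G.vertexOf a = G.vertexOf f := by
    intro a ha
    rcases List.mem_cons.1 ha with rfl | ha
    · rfl
    · rw [key L _ _ hc a ha, vertexOf_h]
  have hall' : ∀ a, G.vertexOf a = G.vertexOf f := by
    intro a
    rcases hL.complete a with h | h
    · exact hall a h
    · rw [← vertexOf_h, hall _ h]
  have : Nat.card G.Vertex = 1 := by
    rw [Nat.card_eq_one_iff_unique]
    exact ⟨⟨fun a b => by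
      obtain ⟨a, rfl⟩ := Quot.exists_rep a
      obtain ⟨b, rfl⟩ := Quot.exists_rep b
      exact (hall' a).trans (hall' b).symm⟩, ⟨G.vertexOf f⟩⟩
  unfold numVertices
  omega

section SlideArcs

variable (D : HERG) (y : D.Flag)

open Classical in
/-- The arcs after a handle slide along the side of a ribbon that starts at `y`. -/
noncomputable def slideV (w : D.Flag) : D.Flag :=
  if w = y then D.v (D.h (D.v y)) else if w = D.v (D.h (D.v y)) then y else
  if w = D.h (D.v y) then D.e y else if w = D.e y then D.h (D.v y) else
  if w = D.v y then D.v (D.e y) else if w = D.v (D.e y) then D.v y else D.v w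

variable {D y}

/-- With `b = v y`, `z = v (h b)` and `q = v (e y)`, the arcs `{y, b}`, `{h b, z}`, `{e y, q}` are
replaced by `{y, z}`, `{h b, e y}`, `{b, q}`: the end `b` is taken out next to `y` and put in next
to `e y`. The hypotheses make the six flags distinct; if `z = e y`, the end would already be there.
-/
theorem slideV_spec (hb : D.v y ∉ D.ribbonFlags y) (hze : D.v (D.h (D.v y)) ≠ D.e y) :
    (∀ x, D.slideV y (D.slideV y x) = x) ∧ (∀ x, D.slideV y x ≠ x) ∧
    D.slideV y y = D.v (D.h (D.v y)) ∧ D.slideV y (D.h (D.v y)) = D.e y ∧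
    D.slideV y (D.e y) = D.h (D.v y) ∧
    D.slideV y (D.v y) = D.v (D.e y) ∧ D.slideV y (D.v (D.e y)) = D.v y ∧
    (∀ w, w ≠ y → w ≠ D.v y → w ≠ D.h (D.v y) → w ≠ D.v (D.h (D.v y)) → w ≠ D.e y →
      w ≠ D.v (D.e y) → D.slideV y w = D.v w) := by
  have vv := D.v_v
  generalize hbd : D.v y = b at *
  generalize hzd : D.v (D.h b) = z at *
  generalize hqd : D.v (D.e y) = q at *
  have b1 : b ≠ y := hbd ▸ D.v_ne y
  have b3 : b ≠ D.e y := fun h => hb (Or.inr (Or.inr (Or.inl h)))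
  have hb' : D.h b ∉ D.ribbonFlags y := mt (D.h_mem_ribbonFlags_iff y b).1 hb
  have c1 : D.h b ≠ y := fun h => hb' (Or.inl h)
  have c3 : D.h b ≠ D.e y := fun h => hb' (Or.inr (Or.inr (Or.inl h)))
  have c5 : D.h b ≠ b := D.h_ne b
  have y2 : D.e y ≠ y := D.e_ne y
  have z1 : z ≠ y := fun h => c5 (by rw [← vv (D.h b), hzd, h, hbd])
  have zb : z ≠ b := fun h => c1 (D.v_inj.1 (by rw [hzd, h, hbd]))
  have zb' : z ≠ D.h b := hzd ▸ D.v_ne _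
  have q1 : q ≠ y := fun h => b3 (by
    have := vv (D.e y)
    rw [hqd, h, hbd] at this
    exact this)
  have q2 : q ≠ b := fun h => y2 (D.v_inj.1 (by rw [hqd, h, hbd]))
  have q3 : q ≠ D.h b := fun h => hze (by
    have := vv (D.e y)
    rw [hqd, h, hzd] at this
    exact this)
  have q4 : q ≠ z := fun h => c3 (D.v_inj.1 (by rw [hqd, h, hzd]))
  have q5 : q ≠ D.e y := fun h => D.v_ne _ (hqd.trans h)
  have e1 : D.slideV y y = z := by simp [slideV, hbd, hzd]
  have e2 : D.slideV y z = y := by simp [slideV, hbd, hzd, z1]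
  have e3 : D.slideV y (D.h b) = D.e y := by simp [slideV, hbd, hzd, c1, zb'.symm]
  have e4 : D.slideV y (D.e y) = D.h b := by
    simp [slideV, hbd, hzd, y2, hze.symm, c3.symm]
  have e5 : D.slideV y b = q := by
    simp [slideV, hbd, hzd, hqd, b1, b3, zb.symm, c5.symm]
  have e6 : D.slideV y q = b := by
    simp [slideV, hbd, hzd, hqd, q1, q2, q3, q4, q5]
  have e7 : ∀ w, w ≠ y → w ≠ b → w ≠ D.h b → w ≠ z → w ≠ D.e y → w ≠ q →
      D.slideV y w = D.v w := by
    intro w w1 w2 w3 w4 w5 w6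
    simp [slideV, hbd, hzd, hqd, w1, w2, w3, w4, w5, w6]
  have vb : D.v b = y := by rw [← hbd, vv]
  have vz : D.v z = D.h b := by rw [← hzd, vv]
  have vq : D.v q = D.e y := by rw [← hqd, vv]
  refine ⟨fun x => ?_, fun x => ?_, e1, e3, e4, e5, e6, e7⟩
  · by_cases w1 : x = y
    · rw [w1, e1, e2]
    by_cases w2 : x = b
    · rw [w2, e5, e6]
    by_cases w3 : x = D.h b
    · rw [w3, e3, e4]
    by_cases w4 : x = z
    · rw [w4, e2, e1]
    by_cases w5 : x = D.e y
    · rw [w5, e4, e3]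
    by_cases w6 : x = q
    · rw [w6, e6, e5]
    rw [e7 x w1 w2 w3 w4 w5 w6, e7, vv]
    · exact fun h => w2 (by rw [← hbd, ← h, vv])
    · exact fun h => w1 (by rw [← vb, ← h, vv])
    · exact fun h => w4 (by rw [← hzd, ← h, vv])
    · exact fun h => w3 (by rw [← vz, ← h, vv])
    · exact fun h => w6 (by rw [← hqd, ← h, vv])
    · exact fun h => w5 (by rw [← vq, ← h, vv])
  · by_cases w1 : x = y
    · rw [w1, e1]; exact z1
    by_cases w2 : x = b
    · rw [w2, e5]; exact q2
    by_cases w3 : x = D.h b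
    · rw [w3, e3]; exact c3.symm
    by_cases w4 : x = z
    · rw [w4, e2]; exact z1.symm
    by_cases w5 : x = D.e y
    · rw [w5, e4]; exact c3
    by_cases w6 : x = q
    · rw [w6, e6]; exact q2.symm
    rw [e7 x w1 w2 w3 w4 w5 w6]
    exact D.v_ne x

end SlideArcs

/-! ### Handle slides of lists -/

/-- Every graph attached in the order `L` can be transformed into a graph attached in the order
`L'` by rotations and twists. -/
def Red (D : HERG) (L L' : List D.Flag) : Prop :=
  ∀ c, D.Realized L c → ∃ c', D.Realized L' c' ∧ HRClass.REquiv c c'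

section Red

variable {D : HERG}

theorem Red.refl (L : List D.Flag) : D.Red L L := fun c hc => ⟨c, hc, Relation.ReflTransGen.refl⟩

theorem Red.trans {L L' L'' : List D.Flag} (h : D.Red L L') (h' : D.Red L' L'') : D.Red L L'' := by
  intro c hc
  obtain ⟨c', hc', hr⟩ := h c hc
  obtain ⟨c'', hc'', hr'⟩ := h' c' hc'
  exact ⟨c'', hc'', Relation.ReflTransGen.trans hr hr'⟩

theorem Red.rot (A B : List D.Flag) : D.Red (A ++ B) (B ++ A) := by
  rintro c ⟨v, hv, hne, rfl, hc, hL⟩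
  exact ⟨_, ⟨v, hv, hne, rfl, hc.rotate, hL.perm List.perm_append_comm⟩,
    Relation.ReflTransGen.refl⟩

theorem Red.flip (L : List D.Flag) : D.Red L (L.reverse.map D.h) := by
  rintro c ⟨v, hv, hne, rfl, hc, hL⟩
  exact ⟨_, ⟨v, hv, hne, rfl, hc.flip hv D.h_h,
    (hL.perm L.reverse_perm.symm).map_flip D.h_h⟩, Relation.ReflTransGen.refl⟩

theorem reorder_slide {v : D.Flag → D.Flag} (hv : ∀ x, v (v x) = x) (hne : ∀ x, v x ≠ x)
    (hV : (D.reorder v hv hne).numVertices = 1) {y b q : D.Flag} (hyb : v y = b)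
    (hyq : D.e y = q) (hy : q ≠ D.h y) (b1 : b ≠ y) (b2 : b ≠ D.h y) (b3 : b ≠ q)
    (b4 : b ≠ D.h q) (hz1 : v (D.h b) ≠ D.h y) (hz2 : v (D.h b) ≠ q) :
    ∃ (v' : D.Flag → D.Flag) (hv' : ∀ x, v' (v' x) = x) (hne' : ∀ x, v' x ≠ x),
      HRClass.Step (HRClass.of (D.reorder v hv hne)) (HRClass.of (D.reorder v' hv' hne')) ∧
      v' y = v (D.h b) ∧ v' (D.h b) = q ∧ v' q = D.h b ∧ v' b = v q ∧ v' (v q) = b ∧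
      ∀ w, w ≠ y → w ≠ b → w ≠ D.h b → w ≠ v (D.h b) → w ≠ q → w ≠ v q → v' w = v w := by
  subst hyb hyq
  have hb : v y ∉ D.ribbonFlags y := by
    rintro (h | h | h | h)
    exacts [b1 h, b2 h, b3 h, b4 h]
  obtain ⟨s1, s2, s3, s4, s5, s6, s7, s8⟩ := slideV_spec (D := D.reorder v hv hne) (y := y) hb hz2
  exact ⟨(D.reorder v hv hne).slideV y, s1, s2,
    slide_step (D := D.reorder v hv hne) (y := y) hy hV hb hz1 hz2
      ((D.reorder v hv hne).slideV y) s1 s2 s3 s4 s6 s8, s3, s4, s5, s6, s7, s8⟩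

/-- A handle slide over an untwisted ribbon. -/
theorem Red.slide_pos (hi : D.isolated = 0) {g b g' : D.Flag} {X Y : List D.Flag}
    (hg : D.e g = D.h g') : D.Red (g :: b :: (X ++ g' :: Y)) (g :: (X ++ b :: g' :: Y)) := by
  rintro c ⟨v, hv, hne, rfl, hc, hL⟩
  -- For empty `X` the end is already next to `g'` and nothing has to be moved; this is the case
  -- that `slide_step` excludes.
  rcases List.eq_nil_or_concat X with rfl | ⟨X₀, ℓ, hX⟩
  · exact ⟨_, ⟨v, hv, hne, rfl, hc, hL⟩, Relation.ReflTransGen.refl⟩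
  have hXne : X ≠ [] := by rw [hX]; simp
  have hV := numVertices_of_cyc (G := D.reorder v hv hne) hc hL (List.cons_ne_nil _ _) hi
  have hnd := hL.nodup
  have hnm := hL.notMem
  simp only [List.nodup_cons, List.mem_cons, List.mem_append, not_or, List.nodup_append] at hnd
  obtain ⟨⟨gb, gX, gg', gY⟩, ⟨bX, bg', bY⟩, hXnd, ⟨g'Y, hYnd⟩, hXY⟩ := hnd
  have hX1 : ∀ x ∈ X, x ≠ g' := fun x hx => hXY x hx g' (Or.inl rfl)
  have hX2 : ∀ x ∈ X, x ∉ Y := fun x hx hy => hXY x hx x (Or.inr hy) rfl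
  have mem : ∀ w, w = g ∨ w = b ∨ w ∈ X ∨ w = g' ∨ w ∈ Y → w ∈ g :: b :: (X ++ g' :: Y) := by
    intro w hw; simpa using hw
  have hnm' : ∀ a c, a ∈ g :: b :: (X ++ g' :: Y) → c ∈ g :: b :: (X ++ g' :: Y) →
      D.h a ≠ c := fun a c ha hc h => hnm a ha (h ▸ hc)
  obtain ⟨hvg, hp⟩ : v (D.h g) = b ∧ Path v D.h (D.h b) (X ++ g' :: Y) g := hc
  obtain ⟨hp1, hp2⟩ := path_append_cons.1 hp
  have ehg : D.e (D.h g) = g' := by rw [← D.h_e, hg, D.h_h]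
  have hz : v (D.h b) ∈ X := by
    obtain ⟨f, X', rfl⟩ := List.exists_cons_of_ne_nil hXne
    rw [hp1.1]; exact List.mem_cons_self
  -- The slide runs along the side of the chord that starts at `D.h g`, next to `b`, and ends at
  -- `g'`.
  obtain ⟨v', hv', hne', hstep, s3, s4, s5, s6, s7, s8⟩ := reorder_slide hv hne
    hV hvg ehg
    (by rw [D.h_h]; exact fun h => gg' h.symm)
    (fun h => hnm' g b (mem _ (by tauto)) (mem _ (by tauto)) h.symm)
    (by rw [D.h_h]; exact fun h => gb h.symm) bg'
    (fun h => hnm' g' b (mem _ (by tauto)) (mem _ (by tauto)) h.symm)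
    (by rw [D.h_h]; exact fun h => gX (h ▸ hz)) (hX1 _ hz)
  refine ⟨_, ⟨v', hv', hne', rfl, ?_, ?_⟩, Relation.ReflTransGen.single hstep⟩
  · have old : ∀ w x, w = D.h x → x ∈ X ∨ x ∈ Y ∨ x = g' → v w ≠ g' →
        v' w = v w := by
      rintro w x rfl hx hne'
      have hx' : x ∈ g :: b :: (X ++ g' :: Y) := mem _ (by tauto)
      refine s8 _ ?_ ?_ ?_ ?_ ?_ ?_
      · intro h
        have := D.h_inj.1 h
        subst this
        rcases hx with h | h | h
        exacts [gX h, gY h, gg' h]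
      · exact hnm' x b hx' (mem _ (by tauto))
      · intro h
        have := D.h_inj.1 h
        subst this
        rcases hx with h | h | h
        exacts [bX h, bY h, bg' h]
      · exact hnm' x _ hx' (mem _ (Or.inr (Or.inr (Or.inl hz))))
      · exact hnm' x g' hx' (mem _ (by tauto))
      · intro h
        apply hne'
        rw [h, hv]
    refine path_append_cons.2 ⟨?_, ?_, ?_⟩
    · refine hp1.change (fun h => hX1 _ h rfl) ⟨fun h => ?_, fun h => s3⟩ ?_
      · exact (hX1 _ hz h).elim
      · intro w hw
        obtain ⟨x, hx, rfl⟩ := List.mem_map.1 hw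
        refine ⟨fun h => ?_, fun h => old _ x rfl (Or.inl hx) h⟩
        rw [← s7, ← h, hv]
    · exact s4
    · have hYv : ∀ w ∈ D.h g' :: Y.map D.h, v w ≠ g' := by
        intro w hw h
        have := hp2.mem hw
        rw [h, List.mem_append, List.mem_singleton] at this
        rcases this with h | h
        exacts [g'Y h, gg' h.symm]
      refine hp2.change gY ⟨fun h => ?_, fun h => ?_⟩ ?_
      · rw [old _ g' rfl (by tauto) (hYv _ List.mem_cons_self), h]
      · rw [old _ g' rfl (by tauto) (hYv _ List.mem_cons_self)]
      · intro w hw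
        have hw' := hYv w (List.mem_cons_of_mem _ hw)
        obtain ⟨x, hx, rfl⟩ := List.mem_map.1 hw
        have := old _ x rfl (by tauto) hw'
        exact ⟨fun h => by rw [this, h], fun _ => this⟩
  · refine hL.perm (List.Perm.cons _ ?_)
    exact List.perm_middle.symm

/-- A handle slide over a twisted ribbon. -/
theorem Red.slide_neg (hi : D.isolated = 0) {g b g' : D.Flag} {X Y : List D.Flag}
    (hg : D.e g = g') : D.Red (g :: b :: (X ++ g' :: Y)) (g :: (X ++ g' :: D.h b :: Y)) := by
  rintro c ⟨v, hv, hne, rfl, hc, hL⟩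
  have hV := numVertices_of_cyc (G := D.reorder v hv hne) hc hL (List.cons_ne_nil _ _) hi
  have hnd := hL.nodup
  have hnm := hL.notMem
  simp only [List.nodup_cons, List.mem_cons, List.mem_append, not_or, List.nodup_append] at hnd
  obtain ⟨⟨gb, gX, gg', gY⟩, ⟨bX, bg', bY⟩, hXnd, ⟨g'Y, hYnd⟩, hXY⟩ := hnd
  have hX1 : ∀ x ∈ X, x ≠ g' := fun x hx => hXY x hx g' (Or.inl rfl)
  have mem : ∀ w, w = g ∨ w = b ∨ w ∈ X ∨ w = g' ∨ w ∈ Y → w ∈ g :: b :: (X ++ g' :: Y) := by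
    intro w hw; simpa using hw
  have hnm' : ∀ a c, a ∈ g :: b :: (X ++ g' :: Y) → c ∈ g :: b :: (X ++ g' :: Y) →
      D.h a ≠ c := fun a c ha hc h => hnm a ha (h ▸ hc)
  obtain ⟨hvg, hp⟩ : v (D.h g) = b ∧ Path v D.h (D.h b) (X ++ g' :: Y) g := hc
  obtain ⟨hp1, hp2⟩ := path_append_cons.1 hp
  have ehg : D.e (D.h g) = D.h g' := by rw [← D.h_e, hg]
  have hz : v (D.h b) ∈ X ∨ v (D.h b) = g' := by
    have := hp1.mem List.mem_cons_self
    simpa using this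
  have hz3 : v (D.h b) ≠ D.h g' := fun h' => by
    rcases hz with h | h
    · exact hnm' g' _ (mem _ (by tauto)) (mem _ (by tauto)) h'.symm
    · exact D.h_ne g' (h'.symm.trans h)
  obtain ⟨v', hv', hne', hstep, s3, s4, s5, s6, s7, s8⟩ := reorder_slide hv hne
    hV hvg ehg
    (by rw [D.h_h]; exact fun h => hnm' g' g (mem _ (by tauto)) (mem _ (by tauto)) h)
    (fun h => hnm' g b (mem _ (by tauto)) (mem _ (by tauto)) h.symm)
    (by rw [D.h_h]; exact fun h => gb h.symm)
    (fun h => hnm' g' b (mem _ (by tauto)) (mem _ (by tauto)) h.symm)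
    (by rw [D.h_h]; exact bg')
    (by
      rw [D.h_h]
      rcases hz with h | h
      · exact fun h' => gX (h' ▸ h)
      · rw [h]; exact fun h' => gg' h'.symm) hz3
  refine ⟨_, ⟨v', hv', hne', rfl, ?_, ?_⟩, Relation.ReflTransGen.single hstep⟩
  · have old : ∀ x, x ∈ X ∨ x ∈ Y → v' (D.h x) = v (D.h x) := by
      intro x hx
      have hx' : x ∈ g :: b :: (X ++ g' :: Y) := mem _ (by tauto)
      refine s8 _ ?_ ?_ ?_ ?_ ?_ ?_
      · intro h
        have := D.h_inj.1 h
        subst this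
        rcases hx with h | h
        exacts [gX h, gY h]
      · exact hnm' x b hx' (mem _ (by tauto))
      · intro h
        have := D.h_inj.1 h
        subst this
        rcases hx with h | h
        exacts [bX h, bY h]
      · exact hnm' x _ hx' (mem _ (by tauto))
      · intro h
        have := D.h_inj.1 h
        subst this
        rcases hx with h | h
        exacts [hX1 _ h rfl, g'Y h]
      · have h' := hp2.mem List.mem_cons_self
        rw [List.mem_append, List.mem_singleton] at h'
        exact hnm' x _ hx' (mem _ (by tauto))
    refine path_append_cons.2 ⟨?_, ?_, ?_⟩
    · refine hp1.change (fun h => hX1 _ h rfl) ⟨fun h => s3.trans h, fun h => s3⟩ ?_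
      intro w hw
      obtain ⟨x, hx, rfl⟩ := List.mem_map.1 hw
      have := old x (Or.inl hx)
      exact ⟨fun h => by rw [this, h], fun _ => this⟩
    · exact s5
    · rw [D.h_h]
      refine hp2.change gY ⟨fun h => s6.trans h, fun h => s6⟩ ?_
      intro w hw
      obtain ⟨x, hx, rfl⟩ := List.mem_map.1 hw
      have := old x (Or.inr hx)
      exact ⟨fun h => by rw [this, h], fun _ => this⟩
  · have p1 : (g :: b :: (X ++ g' :: Y)).Perm (b :: (g :: (X ++ g' :: Y))) := List.Perm.swap _ _ _
    refine ((hL.perm p1).flip_head D.h_h D.h_ne).perm ?_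
    refine (List.Perm.swap _ _ _).trans (List.Perm.cons _ ?_)
    have : X ++ g' :: D.h b :: Y = (X ++ [g']) ++ D.h b :: Y := by simp
    rw [this]
    refine List.Perm.trans ?_ List.perm_middle.symm
    simp

end Red

end HERG

namespace HERG

/-! ### Moving blocks and separating chords by handle slides -/

section Reduction

variable {D : HERG}

theorem e_eq_h_comm {x y : D.Flag} (h : D.e x = D.h y) : D.e y = D.h x := by
  have := congrArg D.h (congrArg D.e h)
  rw [D.e_e, D.h_e, D.h_h] at this
  exact this.symm

theorem e_eq_comm {x y : D.Flag} (h : D.e x = y) : D.e y = x := by rw [← h, D.e_e]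

theorem e_h_eq {x y : D.Flag} (h : D.e x = y) : D.e (D.h x) = D.h y := by rw [← D.h_e, h]

theorem map_h_map_h (L : List D.Flag) : (L.map D.h).map D.h = L := by
  rw [List.map_map]
  exact List.map_id'' D.h_h L

/-- A slide to the left over a twisted ribbon. -/
theorem Red.slide_neg_left (hi : D.isolated = 0) {g b g' : D.Flag} {X Y : List D.Flag}
    (hg : D.e g = g') : D.Red (b :: g :: (X ++ g' :: Y)) (g :: (X ++ D.h b :: g' :: Y)) := by
  -- The slide to the right, conjugated with reading the circle backwards.
  have h1 := Red.flip (D := D) (b :: g :: (X ++ g' :: Y))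
  have h2 := Red.rot (Y.reverse.map D.h ++ D.h g' :: (X.reverse.map D.h)) [D.h g, D.h b]
  have h3 := Red.slide_neg hi (b := D.h b) (X := Y.reverse.map D.h) (Y := X.reverse.map D.h)
    (e_h_eq hg)
  have h4 := Red.flip (D := D)
    (D.h g :: ((Y.reverse.map D.h) ++ D.h g' :: b :: (X.reverse.map D.h)))
  have h5 := Red.rot (X ++ D.h b :: g' :: Y) [g]
  simp only [List.reverse_cons, List.reverse_append, List.map_append, List.map_cons, List.map_nil,
    List.append_assoc, List.cons_append, List.nil_append, ← List.map_reverse, map_h_map_h,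
    List.reverse_reverse, D.h_h] at h1 h2 h3 h4 h5 ⊢
  exact h1.trans (h2.trans (h3.trans (h4.trans h5)))

/-- A block that can be moved along the circle. -/
def Mobile (B : List D.Flag) : Prop := ∀ b W, D.Red (B ++ b :: W) (b :: (B ++ W))

theorem Mobile.nil : Mobile ([] : List D.Flag) := fun _ _ => Red.refl _

theorem Mobile.append {B C : List D.Flag} (hB : Mobile B) (hC : Mobile C) : Mobile (B ++ C) := by
  intro b W
  have h1 := Red.rot B (C ++ b :: W)
  have h2 := hC b (W ++ B)
  have h3 := Red.rot (b :: (C ++ W)) B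
  have h4 := hB b (C ++ W)
  simp only [List.append_assoc, List.cons_append] at h1 h2 h3 h4 ⊢
  exact h1.trans (h2.trans (h3.trans h4))

theorem Mobile.flatMap {ι : Type} {f : ι → List D.Flag} {L : List ι} (h : ∀ i ∈ L, Mobile (f i)) :
    Mobile (L.flatMap f) := by
  induction L with
  | nil => exact Mobile.nil
  | cons i L ih =>
    rw [List.flatMap_cons]
    exact (h i List.mem_cons_self).append (ih fun j hj => h j (List.mem_cons_of_mem _ hj))

/-- Mobility is stated for one ribbon end crossing the block, with the block at the start of the
reading. Since readings are cyclic, iterating it moves the block over any stretch of the circle. -/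
theorem Mobile.move {B : List D.Flag} (hB : Mobile B) (A U C : List D.Flag) :
    D.Red (A ++ (B ++ (U ++ C))) (A ++ (U ++ (B ++ C))) := by
  induction U generalizing A with
  | nil => exact Red.refl _
  | cons u U ih =>
    have h1 := Red.rot A (B ++ (u :: U ++ C))
    have h2 := hB u (U ++ C ++ A)
    have h3 := Red.rot (u :: (B ++ (U ++ C))) A
    have h4 := ih (A ++ [u])
    simp only [List.append_assoc, List.cons_append, List.nil_append] at h1 h2 h3 h4 ⊢
    exact h1.trans (h2.trans (h3.trans h4))

/-- The end `b` is slid over the chord twice; each slide over a twisted ribbon reverses it, so that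
it regains its direction. -/
theorem mobile_neg (hi : D.isolated = 0) {g g' : D.Flag} (hg : D.e g = g') : Mobile [g, g'] := by
  intro b W
  have h1 := Red.rot [g] (g' :: b :: W)
  have h2 := Red.slide_neg hi (b := b) (X := W) (Y := []) (e_eq_comm hg)
  have h3 := Red.rot (g' :: (W ++ [g])) [D.h b]
  have h4 := Red.slide_neg_left hi (b := D.h b) (X := W) (Y := []) (e_eq_comm hg)
  have h5 := Red.rot (g' :: W) [b, g]
  simp only [List.append_assoc, List.cons_append, List.nil_append, D.h_h] at h1 h2 h3 h4 h5 ⊢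
  exact h1.trans (h2.trans (h3.trans (h4.trans h5)))

/-- One slide over the chord takes `b` from behind `g'` to the front of `g`, whatever the chord
encloses. -/
theorem mobile_pos (hi : D.isolated = 0) {g g' : D.Flag} (hg : D.e g = D.h g')
    (N : List D.Flag) : Mobile (g :: (N ++ [g'])) := by
  intro b W
  have h1 := Red.rot (g :: N) (g' :: b :: W)
  have h2 := Red.slide_pos hi (b := b) (X := W) (Y := N) (e_eq_h_comm hg)
  have h3 := Red.rot (g' :: W) (b :: g :: N)
  simp only [List.append_assoc, List.cons_append, List.nil_append] at h1 h2 h3 ⊢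
  exact h1.trans (h2.trans h3)

/-- A crossing pair has a single boundary circle, and following it by four slides, over `y'`, `x`,
`y` and `x'`, leads `b` past the block. -/
theorem mobile_quad (hi : D.isolated = 0) {x x' y y' : D.Flag} (hx : D.e x = D.h x')
    (hy : D.e y = D.h y') : Mobile [x, y, x', y'] := by
  intro b W
  have h1 := Red.rot [x, y, x'] (y' :: b :: W)
  have h2 := Red.slide_pos hi (b := b) (X := W ++ [x]) (Y := [x']) (e_eq_h_comm hy)
  have h3 := Red.rot (y' :: W) [x, b, y, x']
  have h4 := Red.slide_pos hi (b := b) (X := [y]) (Y := y' :: W) hx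
  have h5 := Red.rot [x] (y :: b :: x' :: y' :: W)
  have h6 := Red.slide_pos hi (b := b) (X := [x']) (Y := W ++ [x]) hy
  have h7 := Red.rot [y] (x' :: b :: y' :: (W ++ [x]))
  have h8 := Red.slide_pos hi (b := b) (X := y' :: W) (Y := [y]) (e_eq_h_comm hx)
  have h9 := Red.rot (x' :: y' :: W) [b, x, y]
  simp only [List.append_assoc, List.cons_append, List.nil_append] at h1 h2 h3 h4 h5 h6 h7 h8 h9 ⊢
  exact h1.trans (h2.trans (h3.trans (h4.trans (h5.trans (h6.trans (h7.trans (h8.trans h9)))))))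

/-- Everything inside a negative chord can be moved out of it. -/
theorem Red.empty_neg (hi : D.isolated = 0) {g g' : D.Flag} (hg : D.e g = g')
    (X Y : List D.Flag) :
    D.Red (g :: (X ++ g' :: Y)) (g :: g' :: (X.reverse.map D.h ++ Y)) := by
  induction X generalizing Y with
  | nil => exact Red.refl _
  | cons x X ih =>
    have h1 := Red.slide_neg hi (b := x) (X := X) (Y := Y) hg
    have h2 := ih (D.h x :: Y)
    simp only [List.append_assoc, List.cons_append, List.nil_append, List.reverse_cons,
      List.map_append, List.map_cons, List.map_nil] at h1 h2 ⊢
    exact h1.trans h2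

/-- The rotation of the inside of a positive chord. -/
theorem Red.rotate_inside (hi : D.isolated = 0) {g g' : D.Flag} (hg : D.e g = D.h g')
    (X A Y : List D.Flag) :
    D.Red (g :: (X ++ (A ++ g' :: Y))) (g :: (A ++ (X ++ g' :: Y))) := by
  induction X generalizing A with
  | nil => exact Red.refl _
  | cons x X ih =>
    have h1 := Red.slide_pos hi (b := x) (X := X ++ A) (Y := Y) hg
    have h2 := ih (A ++ [x])
    simp only [List.append_assoc, List.cons_append, List.nil_append] at h1 h2 ⊢
    exact h1.trans h2

/-- Two crossing positive chords can be separated from the rest. -/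
theorem Red.separate_quad (hi : D.isolated = 0) {g g' b b' : D.Flag} (hg : D.e g = D.h g')
    (hb : D.e b = D.h b') (X Y Z U : List D.Flag) :
    D.Red (g :: (X ++ b :: (Y ++ g' :: (Z ++ b' :: U))))
      ([g, b, g', b'] ++ (U ++ (Z ++ (Y ++ X)))) := by
  -- Three rotations of insides: of the chord of `g`, of the chord of `b`, and then of the first
  -- chord again, read from `g'`, whose inside is the former outside. They remove `X`, `Y` and `Z`
  -- from between the four ends.
  have h1 := Red.rotate_inside hi hg X (b :: Y) (Z ++ b' :: U)
  have h2 := Red.rot [g] (b :: (Y ++ (X ++ g' :: (Z ++ b' :: U))))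
  have h3 := Red.rotate_inside hi hb (Y ++ X) (g' :: Z) (U ++ [g])
  have h4 := Red.rot [b] (g' :: (Z ++ (Y ++ (X ++ b' :: (U ++ [g])))))
  have h5 := Red.rotate_inside hi (e_eq_h_comm hg) (Z ++ (Y ++ X)) (b' :: U) [b]
  have h6 := Red.rot (g' :: b' :: (U ++ (Z ++ (Y ++ X)))) [g, b]
  simp only [List.append_assoc, List.cons_append, List.nil_append] at h1 h2 h3 h4 h5 h6 ⊢
  exact h1.trans (h2.trans (h3.trans (h4.trans (h5.trans h6))))

/-- Three negative chords are equivalent to a pair of crossing positive chords and a negative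
chord. -/
theorem Red.three_neg (hi : D.isolated = 0) {a a' b b' c c' : D.Flag} (ha : D.e a = a')
    (hb : D.e b = b') (hc : D.e c = c') (U : List D.Flag) :
    D.Red (U ++ [a, a', b, b', c, c']) (U ++ [a, D.h b', D.h a', b, c, c']) := by
  -- Dyck's relation: three cross-caps are a handle and a cross-cap. Five slides realise it; they
  -- occur in `h2`, `h4`, `h6`, `h8` and `h9`, and the other steps turn the circle.
  have ha' := e_eq_comm ha
  have hbh : D.e b' = D.h (D.h b) := by rw [D.h_h]; exact e_eq_comm hb
  have h1 := Red.rot (U ++ [a]) [a', b, b', c, c']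
  have h2 := Red.slide_neg hi (b := b) (X := b' :: c :: c' :: U) (Y := []) ha'
  have h3 := Red.rot [a'] (b' :: c :: c' :: (U ++ [a, D.h b]))
  have h4 := Red.slide_pos hi (b := c) (X := c' :: (U ++ [a])) (Y := [a']) hbh
  have h5 := Red.rot (b' :: c' :: (U ++ [a, c, D.h b])) [a']
  have h6 := Red.slide_neg hi (b := b') (X := c' :: U) (Y := [c, D.h b]) ha'
  have h7 := Red.rot (a' :: c' :: (U ++ [a, D.h b', c])) [D.h b]
  have h8 := Red.slide_neg hi (b := a') (X := c' :: (U ++ [a])) (Y := [c]) (e_h_eq hb)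
  have h9 := Red.slide_neg_left hi (b := D.h b) (X := U ++ [a, D.h b', D.h a']) (Y := [])
    (e_eq_comm hc)
  have h8' := Red.rot (D.h b :: c' :: (U ++ [a])) [D.h b', D.h a', c]
  have h10 := Red.rot [c'] (U ++ [a, D.h b', D.h a', b, c])
  simp only [List.append_assoc, List.cons_append, List.nil_append, D.h_h] at *
  exact h1.trans (h2.trans (h3.trans (h4.trans (h5.trans (h6.trans (h7.trans (h8.trans
    (h9.trans h10))))))))

/-! ### Reduction to blocks -/

/-- The block of a crossing pair of positive chords. -/
def quadBlock (p : D.Flag × D.Flag) : List D.Flag := [p.1, p.2, D.h (D.e p.1), D.h (D.e p.2)]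

/-- The block of a positive chord. -/
def posBlock (p : D.Flag × List D.Flag) : List D.Flag := p.1 :: (p.2 ++ [D.h (D.e p.1)])

/-- The block of a negative chord. -/
def negBlock (g : D.Flag) : List D.Flag := [g, D.e g]

def blocks (Q : List (D.Flag × D.Flag)) (P : List (D.Flag × List D.Flag)) (T : List D.Flag) :
    List D.Flag :=
  Q.flatMap quadBlock ++ (P.flatMap posBlock ++ T.flatMap negBlock)

/-- The signs need no separate condition: the second end of a positive chord is listed by its flag
`D.h (D.e g)`, that of a negative chord by `D.e g`. -/
structure ValidBlocks (Q : List (D.Flag × D.Flag)) (P : List (D.Flag × List D.Flag))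
    (T : List D.Flag) : Prop where
  quad : ∀ p ∈ Q, D.IsEdge p.1 ∧ D.IsEdge p.2
  pos : ∀ p ∈ P, D.IsEdge p.1 ∧ ∀ n ∈ p.2, D.e n = D.h n
  neg : ∀ g ∈ T, D.IsEdge g
  two : T.length ≤ 2

theorem mobile_quadBlock (hi : D.isolated = 0) (p : D.Flag × D.Flag) : Mobile (quadBlock p) :=
  mobile_quad hi (D.h_h _).symm (D.h_h _).symm

theorem mobile_posBlock (hi : D.isolated = 0) (p : D.Flag × List D.Flag) : Mobile (posBlock p) :=
  mobile_pos hi (D.h_h _).symm _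

theorem mobile_negBlock (hi : D.isolated = 0) (g : D.Flag) : Mobile (negBlock g) :=
  mobile_neg hi rfl

theorem partner_mem_blocks {Q : List (D.Flag × D.Flag)} {P : List (D.Flag × List D.Flag)}
    {T : List D.Flag} (hP : ∀ p ∈ P, D.IsEdge p.1 ∧ ∀ n ∈ p.2, D.e n = D.h n) {b : D.Flag}
    (hb : b ∈ blocks Q P T) : D.e b ∈ blocks Q P T ∨ D.h (D.e b) ∈ blocks Q P T := by
  have ee := D.e_e
  have hh := D.h_h
  have he : ∀ x, D.e (D.h x) = D.h (D.e x) := fun x => (D.h_e x).symm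
  simp only [blocks, List.mem_append, List.mem_flatMap] at hb ⊢
  rcases hb with ⟨p, hp, hb⟩ | ⟨p, hp, hb⟩ | ⟨p, hp, hb⟩
  · right; left
    refine ⟨p, hp, ?_⟩
    simp only [quadBlock, List.mem_cons, List.not_mem_nil, or_false] at hb ⊢
    rcases hb with rfl | rfl | rfl | rfl <;> simp [he, hh, ee]
  · right; right; left
    refine ⟨p, hp, ?_⟩
    have := (hP p hp).2 b
    simp only [posBlock, List.mem_cons, List.mem_append, List.not_mem_nil, or_false] at hb ⊢
    rcases hb with rfl | h | rfl
    · simp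
    · rw [this h, hh]; tauto
    · simp [he, hh, ee]
  · left; right; right
    refine ⟨p, hp, ?_⟩
    simp only [negBlock, List.mem_cons, List.not_mem_nil, or_false] at hb ⊢
    rcases hb with rfl | rfl <;> simp [ee]

/-- The blocks `K` contain every ribbon with both of its ends, so the same holds for the unprocessed
part `W`. The first alternative is a negative chord, the second a positive chord or a half-ribbon.
-/
theorem Transversal.partner_mem {W K : List D.Flag} (hL : Transversal D.h (W ++ K))
    (hK : ∀ b ∈ K, D.e b ∈ K ∨ D.h (D.e b) ∈ K) {a : D.Flag} (ha : a ∈ W) :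
    D.e a ∈ W ∨ D.h (D.e a) ∈ W := by
  have h1 : a ∉ K := fun h => (List.disjoint_of_nodup_append hL.nodup) ha h
  have h2 : D.h a ∉ K := fun h => hL.notMem a (List.mem_append_left _ ha)
    (List.mem_append_right _ h)
  have h3 : D.e a ∉ K := fun h => by
    have := hK _ h
    rw [D.e_e] at this
    tauto
  have h4 : D.h (D.e a) ∉ K := fun h => by
    have := hK _ h
    rw [← D.h_e, D.h_h, D.e_e] at this
    tauto
  have h5 := hL.complete (D.e a)
  simp only [List.mem_append] at h5
  tauto

/-- Take the positive chord that is completed first when reading `W` from the left. No other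
positive chord is complete at that moment, so a chord with an end inside it has its other end later.
-/
theorem exists_first_pair {W : List D.Flag} (hW : ∃ a ∈ W, D.IsEdge a ∧ D.h (D.e a) ∈ W) :
    ∃ A g X Y, W = A ++ g :: (X ++ D.h (D.e g) :: Y) ∧ D.IsEdge g ∧
      ∀ x ∈ X, D.IsEdge x → D.h (D.e x) ∉ A ++ g :: X := by
  induction W using List.reverseRecOn with
  | nil => obtain ⟨a, ha, -⟩ := hW; cases ha
  | append_singleton W z ih =>
    by_cases hp : ∃ a ∈ W, D.IsEdge a ∧ D.h (D.e a) ∈ W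
    · obtain ⟨A, g, X, Y, rfl, h1, h2⟩ := ih hp
      exact ⟨A, g, X, Y ++ [z], by simp, h1, h2⟩
    · have key : ∀ g ∈ W, D.IsEdge g → D.h (D.e g) = z → ∃ A g X Y,
          W ++ [z] = A ++ g :: (X ++ D.h (D.e g) :: Y) ∧ D.IsEdge g ∧
          ∀ x ∈ X, D.IsEdge x → D.h (D.e x) ∉ A ++ g :: X := by
        intro g hg he hz
        obtain ⟨A, X, rfl⟩ := List.append_of_mem hg
        refine ⟨A, g, X, [], by simp [hz], he, fun x hx hxe hm => hp ⟨x, ?_, hxe, hm⟩⟩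
        simp [hx]
      obtain ⟨a, ha, hae, hm⟩ := hW
      simp only [List.mem_append, List.mem_singleton] at ha hm
      rcases ha with ha | rfl <;> rcases hm with hm | hm
      · exact (hp ⟨a, ha, hae, hm⟩).elim
      · exact key a ha hae hm
      · refine key _ hm ?_ (by rw [← D.h_e, D.h_h, D.e_e])
        intro h
        rw [← D.h_e, D.h_h, D.e_e] at h
        exact hae h.symm
      · exact (hae (by rw [← D.h_h (D.e a), hm])).elim

theorem exists_neg_pair {W : List D.Flag} {a : D.Flag} (ha : a ∈ W) (ha' : D.e a ∈ W) :
    ∃ A g X Y, W = A ++ g :: (X ++ D.e g :: Y) := by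
  obtain ⟨s, t, rfl⟩ := List.append_of_mem ha
  simp only [List.mem_append, List.mem_cons] at ha'
  rcases ha' with h | h | h
  · obtain ⟨A, X, rfl⟩ := List.append_of_mem h
    exact ⟨A, D.e a, X, t, by simp [D.e_e]⟩
  · exact (D.e_ne a h).elim
  · obtain ⟨X, Y, rfl⟩ := List.append_of_mem h
    exact ⟨s, a, X, Y, rfl⟩

/-- The word is `W` followed by finished blocks, and `W` shrinks. As long as `W` has a negative
chord, it is emptied and moved to the blocks. Emptying reverses ends and so may create new negative
chords, which are met at a later stage. Otherwise take the positive chord completed first: either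
another chord crosses it, and the crossing pair can be separated, or it encloses half-ribbons only
and already is a block. When no chord is left, `W` consists of half-ribbons. -/
theorem exists_blocks_aux (hi : D.isolated = 0) (n : ℕ) : ∀ (W : List D.Flag)
    (Q : List (D.Flag × D.Flag)) (P : List (D.Flag × List D.Flag)) (T : List D.Flag) (c : HRClass),
    W.length ≤ n → ValidBlocks Q P T → D.Realized (W ++ blocks Q P T) c →
    ∃ Q' P' T' N c', ValidBlocks Q' P' T' ∧ (∀ x ∈ N, D.e x = D.h x) ∧
      D.Realized (blocks Q' P' T' ++ N) c' ∧ HRClass.REquiv c c' := by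
  induction n with
  | zero =>
    intro W Q P T c hW hV hc
    obtain rfl := List.length_eq_zero_iff.1 (Nat.le_zero.1 hW)
    exact ⟨Q, P, T, [], c, hV, by simp, by simpa using hc, Relation.ReflTransGen.refl⟩
  | succ n ih =>
    intro W Q P T c hW hV hc
    have hL : Transversal D.h (W ++ blocks Q P T) := by
      obtain ⟨_, _, _, _, _, h⟩ := hc
      exact h
    have step : ∀ (W' : List D.Flag) Q' P' T', W'.length ≤ n → ValidBlocks Q' P' T' →
        D.Red (W ++ blocks Q P T) (W' ++ blocks Q' P' T') →
        ∃ Q' P' T' N c', ValidBlocks Q' P' T' ∧ (∀ x ∈ N, D.e x = D.h x) ∧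
          D.Realized (blocks Q' P' T' ++ N) c' ∧ HRClass.REquiv c c' := by
      intro W' Q' P' T' h1 h2 h3
      obtain ⟨c', hc', hr⟩ := h3 c hc
      obtain ⟨Q'', P'', T'', N, c'', h4, h5, h6, h7⟩ := ih W' Q' P' T' c' h1 h2 hc'
      exact ⟨Q'', P'', T'', N, c'', h4, h5, h6, Relation.ReflTransGen.trans hr h7⟩
    have hWnd : W.Nodup := (List.nodup_append.1 hL.nodup).1
    have hpart : ∀ a ∈ W, D.e a ∈ W ∨ D.h (D.e a) ∈ W :=
      fun a ha => hL.partner_mem (fun b hb => partner_mem_blocks hV.pos hb) ha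
    have mQ : Mobile (Q.flatMap quadBlock) := Mobile.flatMap fun p _ => mobile_quadBlock hi p
    have mP : Mobile (P.flatMap posBlock) := Mobile.flatMap fun p _ => mobile_posBlock hi p
    by_cases hneg : ∃ a ∈ W, D.e a ∈ W
    · obtain ⟨a, ha, ha'⟩ := hneg
      obtain ⟨A, g, X, Y, rfl⟩ := exists_neg_pair ha ha'
      have hge : D.IsEdge g := fun h => hL.notMem g (by simp) (by simp [← h])
      have hlen : (A ++ (X.reverse.map D.h ++ Y)).length ≤ n := by
        simp at hW ⊢; omega
      have red : D.Red (A ++ g :: (X ++ D.e g :: Y) ++ blocks Q P T)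
          ((A ++ (X.reverse.map D.h ++ Y)) ++
            (Q.flatMap quadBlock ++ (P.flatMap posBlock ++ (g :: T).flatMap negBlock))) := by
        have h1 := Red.rot A (g :: (X ++ D.e g :: (Y ++ blocks Q P T)))
        have h2 := Red.empty_neg hi (g := g) rfl X (Y ++ (blocks Q P T ++ A))
        have h3 := Red.rot ([g, D.e g] ++ (X.reverse.map D.h ++ (Y ++ blocks Q P T))) A
        have h4 := (mobile_negBlock hi g).move A (X.reverse.map D.h ++ (Y ++
          (Q.flatMap quadBlock ++ P.flatMap posBlock))) (T.flatMap negBlock)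
        simp only [List.append_assoc, List.cons_append, List.nil_append, blocks, negBlock,
          List.flatMap_cons] at h1 h2 h3 h4 ⊢
        exact h1.trans (h2.trans (h3.trans h4))
      by_cases hT : T.length < 2
      · refine step _ Q P (g :: T) hlen ⟨hV.quad, hV.pos, ?_, by simpa using hT⟩ red
        rintro x hx
        rcases List.mem_cons.1 hx with rfl | hx
        exacts [hge, hV.neg x hx]
      · have hT2 : T.length = 2 := by have := hV.two; omega
        -- A third negative chord has appeared: `g` and the chord of `b` are traded for a crossing
        -- pair, and `c'` remains.
        obtain ⟨b, c', rfl⟩ := List.length_eq_two.1 hT2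
        have hbe := hV.neg b (by simp)
        have hbe' : D.IsEdge (D.h (D.e b)) := by
          intro h
          rw [← D.h_e, D.e_e, D.h_h] at h
          exact hbe h.symm
        refine step _ ((g, D.h (D.e b)) :: Q) P [c'] hlen ⟨?_, hV.pos, ?_, by simp⟩
          (red.trans ?_)
        · rintro p hp
          rcases List.mem_cons.1 hp with rfl | hp
          exacts [⟨hge, hbe'⟩, hV.quad p hp]
        · intro x hx
          exact hV.neg x (List.mem_cons_of_mem _ hx)
        · have h1 := Red.three_neg hi (a := g) rfl (b := b) rfl (c := c') rfl
            ((A ++ (X.reverse.map D.h ++ Y)) ++ (Q.flatMap quadBlock ++ P.flatMap posBlock))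
          have h2 := (mQ.append mP).move (A ++ (X.reverse.map D.h ++ Y))
            [g, D.h (D.e b), D.h (D.e g), b] [c', D.e c']
          have e1 : D.h (D.e (D.h (D.e b))) = b := by rw [← D.h_e, D.h_h, D.e_e]
          simp only [List.append_assoc, List.cons_append, List.nil_append, blocks, negBlock,
            List.flatMap_cons, List.flatMap_nil, List.append_nil, quadBlock, e1] at h1 h2 ⊢
          exact h1.trans h2
    · by_cases hedge : ∃ a ∈ W, D.IsEdge a
      · obtain ⟨a, ha, hae⟩ := hedge
        obtain ⟨A, g, X, Y, rfl, hge, hfirst⟩ := exists_first_pair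
          ⟨a, ha, hae, (hpart a ha).resolve_left fun h => hneg ⟨a, ha, h⟩⟩
        by_cases hX : ∃ b ∈ X, D.IsEdge b
        · obtain ⟨b, hb, hbe⟩ := hX
          -- By the choice of `g` as completed first, the other end of `b` comes after the chord of
          -- `g`, so the two chords cross.
          have hbY : D.h (D.e b) ∈ Y := by
            have hbW : b ∈ A ++ g :: (X ++ D.h (D.e g) :: Y) := by simp [hb]
            have h1 := (hpart b hbW).resolve_left fun h => hneg ⟨b, hbW, h⟩
            have h2 := hfirst b hb hbe
            have h3 : D.h (D.e b) ≠ D.h (D.e g) := by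
              intro h
              have := D.e_inj.1 (D.h_inj.1 h)
              subst this
              rw [List.nodup_append] at hWnd
              have := List.nodup_cons.1 hWnd.2.1
              exact this.1 (by simp [hb])
            simp only [List.mem_append, List.mem_cons] at h1 h2
            tauto
          obtain ⟨X₁, X₂, rfl⟩ := List.append_of_mem hb
          obtain ⟨Z, U, rfl⟩ := List.append_of_mem hbY
          refine step (A ++ (Z ++ (X₂ ++ (X₁ ++ U)))) ((g, b) :: Q) P T ?_
            ⟨?_, hV.pos, hV.neg, hV.two⟩ ?_
          · simp at hW ⊢; omega
          · rintro p hp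
            rcases List.mem_cons.1 hp with rfl | hp
            exacts [⟨hge, hbe⟩, hV.quad p hp]
          · have h1 := Red.rot A (g :: (X₁ ++ b :: (X₂ ++ D.h (D.e g) :: (Z ++ D.h (D.e b) ::
              (U ++ blocks Q P T)))))
            have h2 := Red.separate_quad hi (g := g) (D.h_h _).symm (b := b) (D.h_h _).symm X₁ X₂ Z
              (U ++ (blocks Q P T ++ A))
            have h3 := Red.rot ([g, b, D.h (D.e g), D.h (D.e b)] ++ (U ++ blocks Q P T))
              (A ++ (Z ++ (X₂ ++ X₁)))
            have h4 := (mobile_quadBlock hi (g, b)).move (A ++ (Z ++ (X₂ ++ X₁))) U (blocks Q P T)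
            simp only [List.append_assoc, List.cons_append, List.nil_append, blocks, quadBlock,
              List.flatMap_cons] at h1 h2 h3 h4 ⊢
            exact h1.trans (h2.trans (h3.trans h4))
        · refine step (A ++ Y) Q ((g, X) :: P) T ?_ ⟨hV.quad, ?_, hV.neg, hV.two⟩ ?_
          · simp at hW ⊢; omega
          · rintro p hp
            rcases List.mem_cons.1 hp with rfl | hp
            · exact ⟨hge, fun x hx => by_contra fun h => hX ⟨x, hx, h⟩⟩
            · exact hV.pos p hp
          · have h1 := (mobile_posBlock hi (g, X)).move A (Y ++ Q.flatMap quadBlock)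
              (P.flatMap posBlock ++ T.flatMap negBlock)
            simp only [List.append_assoc, List.cons_append, List.nil_append, blocks, posBlock,
              List.flatMap_cons] at h1 ⊢
            exact h1
      · obtain ⟨c', hc', hr⟩ := Red.rot W (blocks Q P T) c hc
        exact ⟨Q, P, T, W, c', hV, fun x hx => by_contra fun h => hedge ⟨x, hx, h⟩, hc', hr⟩

/-- The reduction of a one-vertex graph to a canonical order. -/
theorem exists_blocks (hi : D.isolated = 0) {L : List D.Flag} {c : HRClass}
    (hc : D.Realized L c) : ∃ Q P T N c', ValidBlocks Q P T ∧ (∀ x ∈ N, D.e x = D.h x) ∧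
      D.Realized (blocks Q P T ++ N) c' ∧ HRClass.REquiv c c' := by
  refine exists_blocks_aux hi L.length L [] [] [] c le_rfl ⟨?_, ?_, ?_, ?_⟩ ?_
  · simp
  · simp
  · simp
  · simp
  · simpa [blocks] using hc

end Reduction

end HERG

/-! ### Words of blocks -/

section Words

variable {C : Type} (tw : C → Bool)

/-- The word is a sequence of half-chords, `a` positive chords that enclose half-chords only,
`j` crossing pairs of positive chords and `m` negative chords. -/
inductive BlockWord : List (Option C) → ℕ → ℕ → ℕ → Prop
  | nil : BlockWord [] 0 0 0
  | half {u a j m} : BlockWord u a j m → BlockWord (none :: u) a j m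
  | pos {u a j m} (c : C) (n : ℕ) (hc : tw c = false) (hu : some c ∉ u) :
      BlockWord u a j m →
      BlockWord (some c :: (List.replicate n none ++ some c :: u)) (a + 1) j m
  | neg {u a j m} (c : C) (hc : tw c = true) (hu : some c ∉ u) :
      BlockWord u a j m → BlockWord (some c :: some c :: u) a j (m + 1)
  | quad {u a j m} (c d : C) (hcd : c ≠ d) (hc : tw c = false) (hd : tw d = false)
      (hu : some c ∉ u) (hu' : some d ∉ u) :
      BlockWord u a j m → BlockWord (some c :: some d :: some c :: some d :: u) a (j + 1) m

/-- The same for a list of objects labelled with the letters of the word. -/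
inductive BlockList {F : Type} : List (F × Option C) → ℕ → ℕ → ℕ → Prop
  | nil : BlockList [] 0 0 0
  | half {Z a j m} (f : F) : BlockList Z a j m → BlockList ((f, none) :: Z) a j m
  | pos {Z a j m} (c : C) (g g' : F) (N : List (F × Option C)) (hN : ∀ x ∈ N, x.2 = none)
      (hc : tw c = false) (hZ : ∀ f, (f, some c) ∉ Z) :
      BlockList Z a j m →
      BlockList ((g, some c) :: (N ++ (g', some c) :: Z)) (a + 1) j m
  | neg {Z a j m} (c : C) (g g' : F) (hc : tw c = true) (hZ : ∀ f, (f, some c) ∉ Z) :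
      BlockList Z a j m → BlockList ((g, some c) :: (g', some c) :: Z) a j (m + 1)
  | quad {Z a j m} (c d : C) (x y x' y' : F) (hcd : c ≠ d) (hc : tw c = false) (hd : tw d = false)
      (hZ : ∀ f, (f, some c) ∉ Z) (hZ' : ∀ f, (f, some d) ∉ Z) :
      BlockList Z a j m →
      BlockList ((x, some c) :: (y, some d) :: (x', some c) :: (y', some d) :: Z) a (j + 1) m

variable {tw}

theorem BlockWord.blockList {F : Type} {u : List (Option C)} {a j m : ℕ}
    (h : BlockWord tw u a j m) {Z : List (F × Option C)} (hZ : Z.map Prod.snd = u) :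
    BlockList tw Z a j m := by
  have key : ∀ {Z : List (F × Option C)} {c : Option C}, c ∉ Z.map Prod.snd → ∀ f, (f, c) ∉ Z :=
    fun h f hf => h (List.mem_map.2 ⟨_, hf, rfl⟩)
  induction h generalizing Z with
  | nil => rw [List.map_eq_nil_iff.1 hZ]; exact .nil
  | half _ ih =>
    obtain ⟨⟨f, _⟩, Z, rfl, rfl, h1⟩ := List.map_eq_cons_iff.1 hZ
    exact .half f (ih h1)
  | pos c n hc hu _ ih =>
    obtain ⟨⟨g, _⟩, Z, rfl, rfl, h1⟩ := List.map_eq_cons_iff.1 hZ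
    obtain ⟨N, Z, rfl, hN, h2⟩ := List.map_eq_append_iff.1 h1
    obtain ⟨⟨g', _⟩, Z, rfl, rfl, rfl⟩ := List.map_eq_cons_iff.1 h2
    refine .pos c g g' N (fun x hx => ?_) hc (key hu) (ih rfl)
    exact List.eq_of_mem_replicate (hN ▸ List.mem_map.2 ⟨x, hx, rfl⟩)
  | neg c hc hu _ ih =>
    obtain ⟨⟨g, _⟩, Z, rfl, rfl, h1⟩ := List.map_eq_cons_iff.1 hZ
    obtain ⟨⟨g', _⟩, Z, rfl, rfl, rfl⟩ := List.map_eq_cons_iff.1 h1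
    exact .neg c g g' hc (key hu) (ih rfl)
  | quad c d hcd hc hd hu hu' _ ih =>
    obtain ⟨⟨x, _⟩, Z, rfl, rfl, h1⟩ := List.map_eq_cons_iff.1 hZ
    obtain ⟨⟨y, _⟩, Z, rfl, rfl, h2⟩ := List.map_eq_cons_iff.1 h1
    obtain ⟨⟨x', _⟩, Z, rfl, rfl, h3⟩ := List.map_eq_cons_iff.1 h2
    obtain ⟨⟨y', _⟩, Z, rfl, rfl, rfl⟩ := List.map_eq_cons_iff.1 h3
    exact .quad c d x y x' y' hcd hc hd (key hu) (key hu') (ih rfl)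

theorem eq_of_mem_two {F : Type} {g g' f f' f'' : F} (hf : f = g ∨ f = g')
    (hf' : f' = g ∨ f' = g') (hf'' : f'' = g ∨ f'' = g') : f = f' ∨ f = f'' ∨ f' = f'' := by
  rcases hf with rfl | rfl <;> rcases hf' with rfl | rfl <;> rcases hf'' with rfl | rfl <;> simp

/-- Each letter occurs at most twice. -/
theorem BlockList.twice {F : Type} {Z : List (F × Option C)} {a j m : ℕ}
    (h : BlockList tw Z a j m) {f f' f'' : F} {c : C} (hf : (f, some c) ∈ Z)
    (hf' : (f', some c) ∈ Z) (hf'' : (f'', some c) ∈ Z) : f = f' ∨ f = f'' ∨ f' = f'' := by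
  induction h with
  | nil => cases hf
  | half g _ ih =>
    simp only [List.mem_cons, Prod.mk.injEq, reduceCtorEq, and_false, false_or] at hf hf' hf''
    exact ih hf hf' hf''
  | pos c₁ g g' N hN hc hZ _ ih =>
    have hN' : ∀ f, (f, some c) ∉ N := fun f hf => by simpa using hN _ hf
    by_cases hcc : c = c₁
    · subst hcc
      simp only [List.mem_cons, List.mem_append, Prod.mk.injEq, hN', hZ, false_or, or_false,
        and_true] at hf hf' hf''
      exact eq_of_mem_two hf hf' hf''
    · simp only [List.mem_cons, List.mem_append, Prod.mk.injEq, hN', Option.some.injEq, hcc,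
        and_false, false_or] at hf hf' hf''
      exact ih hf hf' hf''
  | neg c₁ g g' hc hZ _ ih =>
    by_cases hcc : c = c₁
    · subst hcc
      simp only [List.mem_cons, Prod.mk.injEq, hZ, or_false, and_true] at hf hf' hf''
      exact eq_of_mem_two hf hf' hf''
    · simp only [List.mem_cons, Prod.mk.injEq, Option.some.injEq, hcc,
        and_false, false_or] at hf hf' hf''
      exact ih hf hf' hf''
  | quad c₁ d x y x' y' hcd hc hd hZ hZ' _ ih =>
    by_cases hcc : c = c₁
    · subst hcc
      simp only [List.mem_cons, Prod.mk.injEq, hZ, or_false, and_true, Option.some.injEq, hcd,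
        and_false, false_or] at hf hf' hf''
      exact eq_of_mem_two hf hf' hf''
    · by_cases hcd' : c = d
      · subst hcd'
        simp only [List.mem_cons, Prod.mk.injEq, hZ', or_false, and_true, Option.some.injEq, hcc,
          and_false, false_or] at hf hf' hf''
        exact eq_of_mem_two hf hf' hf''
      · simp only [List.mem_cons, Prod.mk.injEq, Option.some.injEq, hcc, hcd',
          and_false, false_or] at hf hf' hf''
        exact ih hf hf' hf''

/-- Each letter that occurs occurs twice. -/
theorem BlockList.exists_ne {F : Type} {Z : List (F × Option C)} {a j m : ℕ}
    (h : BlockList tw Z a j m) (hnd : (Z.map Prod.fst).Nodup) {f : F} {c : C}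
    (hf : (f, some c) ∈ Z) : ∃ f', (f', some c) ∈ Z ∧ f' ≠ f := by
  induction h with
  | nil => cases hf
  | half g _ ih =>
    simp only [List.mem_cons, Prod.mk.injEq, reduceCtorEq, and_false, false_or] at hf
    obtain ⟨f', h1, h2⟩ := ih (List.nodup_cons.1 hnd).2 hf
    exact ⟨f', List.mem_cons_of_mem _ h1, h2⟩
  | pos c₁ g g' N hN hc hZ _ ih =>
    have hN' : ∀ f, (f, some c) ∉ N := fun f hf => by simpa using hN _ hf
    simp only [List.map_cons, List.map_append, List.nodup_cons, List.nodup_append] at hnd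
    simp only [List.mem_cons, List.mem_append, Prod.mk.injEq, hN', false_or, Option.some.injEq]
      at hf
    have hgg' : g' ≠ g := fun h => hnd.1 (by simp [h])
    rcases hf with ⟨rfl, rfl⟩ | ⟨rfl, rfl⟩ | hf
    · exact ⟨g', by simp, hgg'⟩
    · exact ⟨g, by simp, hgg'.symm⟩
    · obtain ⟨f', h1, h2⟩ := ih hnd.2.2.1.2 hf
      exact ⟨f', by simp [h1], h2⟩
  | neg c₁ g g' hc hZ _ ih =>
    simp only [List.map_cons, List.nodup_cons] at hnd
    simp only [List.mem_cons, Prod.mk.injEq, Option.some.injEq] at hf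
    have hgg' : g' ≠ g := fun h => hnd.1 (by simp [h])
    rcases hf with ⟨rfl, rfl⟩ | ⟨rfl, rfl⟩ | hf
    · exact ⟨g', by simp, hgg'⟩
    · exact ⟨g, by simp, hgg'.symm⟩
    · obtain ⟨f', h1, h2⟩ := ih hnd.2.2 hf
      exact ⟨f', by simp [h1], h2⟩
  | quad c₁ d x y x' y' hcd hc hd hZ hZ' _ ih =>
    simp only [List.map_cons, List.nodup_cons] at hnd
    simp only [List.mem_cons, Prod.mk.injEq, Option.some.injEq] at hf
    have hx : x' ≠ x := fun h => hnd.1 (by simp [h])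
    have hy : y' ≠ y := fun h => hnd.2.1 (by simp [h])
    rcases hf with ⟨rfl, rfl⟩ | ⟨rfl, rfl⟩ | ⟨rfl, rfl⟩ | ⟨rfl, rfl⟩ | hf
    · exact ⟨x', by simp, hx⟩
    · exact ⟨y', by simp, hy⟩
    · exact ⟨x, by simp, hx.symm⟩
    · exact ⟨y, by simp, hy.symm⟩
    · obtain ⟨f', h1, h2⟩ := ih hnd.2.2.2.2 hf
      exact ⟨f', by simp [h1], h2⟩

theorem BlockWord.append {u u' : List (Option C)} {a j m a' j' m' : ℕ}
    (h : BlockWord tw u a j m) (h' : BlockWord tw u' a' j' m')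
    (hd : ∀ c, some c ∈ u → some c ∉ u') :
    BlockWord tw (u ++ u') (a + a') (j + j') (m + m') := by
  induction h with
  | nil => simpa using h'
  | half _ ih => exact .half (ih fun c hc => hd c (by simp [hc]))
  | @pos u a j m c n hc hu _ ih =>
    have := BlockWord.pos (tw := tw) c n hc
      (by simpa [hu] using hd c (by simp)) (ih fun c hc => hd c (by simp [hc]))
    rw [show a + 1 + a' = a + a' + 1 by omega]
    simpa using this
  | @neg u a j m c hc hu _ ih =>
    have := BlockWord.neg (tw := tw) c hc
      (by simpa [hu] using hd c (by simp)) (ih fun c hc => hd c (by simp [hc]))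
    rw [show m + 1 + m' = m + m' + 1 by omega]
    simpa using this
  | @quad u a j m c d hcd hc hd' hu hu' _ ih =>
    have := BlockWord.quad (tw := tw) c d hcd hc hd'
      (by simpa [hu] using hd c (by simp)) (by simpa [hu'] using hd d (by simp))
      (ih fun c hc => hd c (by simp [hc]))
    rw [show j + 1 + j' = j + j' + 1 by omega]
    simpa using this

theorem BlockWord.flatMap {ι : Type} {l : List ι} {f : ι → List (Option C)} {a j m : ι → ℕ}
    (h : ∀ i ∈ l, BlockWord tw (f i) (a i) (j i) (m i))
    (hd : l.Pairwise fun i i' => ∀ c, some c ∈ f i → some c ∉ f i') :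
    BlockWord tw (l.flatMap f) (l.map a).sum (l.map j).sum (l.map m).sum := by
  induction l with
  | nil => exact .nil
  | cons i l ih =>
    simp only [List.flatMap_cons, List.map_cons, List.sum_cons]
    rw [List.pairwise_cons] at hd
    refine (h i List.mem_cons_self).append (ih (fun i hi => h i (List.mem_cons_of_mem _ hi)) hd.2)
      fun c hc hm => ?_
    obtain ⟨i', hi', hm⟩ := List.mem_flatMap.1 hm
    exact hd.1 i' hi' c hc hm

theorem BlockWord.replicate (n : ℕ) : BlockWord tw (List.replicate n none) 0 0 0 := by
  induction n with
  | zero => exact .nil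
  | succ n ih => exact .half ih

end Words

/-! ### The canonical words -/

/-- Keep the chords with `P` and cut the others. -/
def filterWord (P : Chord → Bool) (w : List (Option Chord)) : List (Option Chord) :=
  w.map fun c => c.filter P

theorem filterWord_true (w : List (Option Chord)) : filterWord (fun _ => true) w = w := by
  unfold filterWord
  conv_rhs => rw [← List.map_id w]
  congr 1
  funext c
  cases c <;> rfl

/-- If exactly one chord of a crossing pair is cut, the other becomes an isolated positive chord
that encloses one half-chord. -/
theorem blockWord_quad (P : Chord → Bool) (p : ℕ) :
    BlockWord Chord.tw (filterWord P
        [some (.crossL p), some (.crossR p), some (.crossL p), some (.crossR p)])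
      (if P (.crossL p) = P (.crossR p) then 0 else 1)
      (if P (.crossL p) ∧ P (.crossR p) then 1 else 0) 0 := by
  have hn := BlockWord.nil (tw := Chord.tw)
  have hne : Chord.crossL p ≠ .crossR p := by simp
  cases hL : P (.crossL p) <;> cases hR : P (.crossR p) <;>
    simp only [filterWord, List.map_cons, List.map_nil, Option.filter, hL, hR, if_true]
  · exact .half (.half (.half (.half hn)))
  · exact .half (.pos (.crossR p) 1 rfl (by simp) hn)
  · exact .pos (.crossL p) 1 rfl (by simp) (.half hn)
  · exact .quad _ _ hne rfl rfl (by simp) (by simp) hn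

theorem blockWord_pos (P : Chord → Bool) (p l : ℕ) :
    BlockWord Chord.tw (filterWord P
        (some (.positive p) :: (List.replicate l none ++ [some (.positive p)])))
      (if P (.positive p) then 1 else 0) 0 0 := by
  have hn := BlockWord.nil (tw := Chord.tw)
  have e : filterWord P (some (.positive p) :: (List.replicate l none ++ [some (.positive p)])) =
      (some (.positive p) : Option Chord).filter P :: (List.replicate l none ++
        [(some (.positive p) : Option Chord).filter P]) := by simp [filterWord]
  rw [e]
  cases h : P (.positive p) <;> simp only [Option.filter, h, if_true]
  · exact .half ((BlockWord.replicate l).append (.half hn) (by simp))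
  · exact .pos (.positive p) l rfl (by simp) hn

theorem blockWord_neg (P : Chord → Bool) (p : ℕ) :
    BlockWord Chord.tw (filterWord P [some (.negative p), some (.negative p)])
      0 0 (if P (.negative p) then 1 else 0) := by
  have hn := BlockWord.nil (tw := Chord.tw)
  cases h : P (.negative p)
  · simp only [filterWord, List.map_cons, List.map_nil, Option.filter, h]
    exact .half (.half hn)
  · simp only [filterWord, List.map_cons, List.map_nil, Option.filter, h, if_true]
    exact .neg (.negative p) rfl (by simp) hn

theorem mem_filterWord {P : Chord → Bool} {w : List (Option Chord)} {c : Chord}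
    (h : some c ∈ filterWord P w) : some c ∈ w ∧ P c := by
  obtain ⟨d, hd, hc⟩ := List.mem_map.1 h
  rw [Option.filter_eq_some_iff] at hc
  rw [← hc.1]; exact ⟨hd, hc.2⟩

theorem filterWord_flatMap {ι : Type} (P : Chord → Bool) (l : List ι)
    (f : ι → List (Option Chord)) :
    filterWord P (l.flatMap f) = l.flatMap fun i => filterWord P (f i) := List.map_flatMap

theorem filterWord_append (P : Chord → Bool) (w w' : List (Option Chord)) :
    filterWord P (w ++ w') = filterWord P w ++ filterWord P w' := List.map_append

theorem filterWord_replicate (P : Chord → Bool) (n : ℕ) :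
    filterWord P (List.replicate n none) = List.replicate n none := List.map_replicate

/-- Cut canonical words need not be canonical words themselves, since half-chords can remain
anywhere, but they are block words. The isolated positive chords come from two sources: crossing
pairs with one chord cut, and kept positive chords. -/
theorem blockWord_canonical (P : Chord → Bool) (j : ℕ) (ls : List ℕ) (m s : ℕ) :
    BlockWord Chord.tw (filterWord P (canonicalWord j ls m s))
      (∑ p ∈ Finset.range j, (if P (.crossL p) = P (.crossR p) then 0 else 1) +
        ∑ p ∈ Finset.range ls.length, (if P (.positive p) then 1 else 0))
      (∑ p ∈ Finset.range j, if P (.crossL p) ∧ P (.crossR p) then 1 else 0)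
      (∑ p ∈ Finset.range m, if P (.negative p) then 1 else 0) := by
  have h1 := BlockWord.flatMap (l := List.range j) (fun p _ => blockWord_quad P p) (by
    refine List.nodup_range.imp fun {p q} hpq c h h' => ?_
    have h := (mem_filterWord h).1
    have h' := (mem_filterWord h').1
    simp only [List.mem_cons, Option.some.injEq, List.not_mem_nil, or_false] at h h'
    rcases h with rfl | rfl | rfl | rfl <;> simp [hpq] at h')
  have h2 := BlockWord.flatMap (l := ls.zipIdx) (fun p _ => blockWord_pos P p.2 p.1) (by
    have h0 : (ls.zipIdx.map Prod.snd).Nodup := by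
      rw [List.zipIdx_map_snd]; exact List.nodup_range'
    refine (List.pairwise_map.1 h0).imp fun {p q} hpq c h h' => ?_
    have h := (mem_filterWord h).1
    have h' := (mem_filterWord h').1
    simp only [List.mem_cons, List.mem_append, List.mem_replicate, reduceCtorEq, and_false,
      false_or, Option.some.injEq, List.not_mem_nil, or_false] at h h'
    rcases h with rfl | rfl <;> simp [hpq] at h')
  have h3 := BlockWord.flatMap (l := List.range m) (fun p _ => blockWord_neg P p) (by
    refine List.nodup_range.imp fun {p q} hpq c h h' => ?_
    have h := (mem_filterWord h).1
    have h' := (mem_filterWord h').1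
    simp only [List.mem_cons, Option.some.injEq, List.not_mem_nil, or_false] at h h'
    rcases h with rfl | rfl <;> simp [hpq] at h')
  have h12 := h1.append h2 (by
    intro c h h'
    obtain ⟨p, -, h⟩ := List.mem_flatMap.1 h
    obtain ⟨q, -, h'⟩ := List.mem_flatMap.1 h'
    have h := (mem_filterWord h).1
    have h' := (mem_filterWord h').1
    simp only [List.mem_cons, Option.some.injEq, List.not_mem_nil, or_false] at h
    rcases h with rfl | rfl | rfl | rfl <;> simp at h')
  have h123 := h12.append h3 (by
    intro c h h'
    obtain ⟨q, -, h'⟩ := List.mem_flatMap.1 h'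
    have h' := (mem_filterWord h').1
    rcases List.mem_append.1 h with h | h
    · obtain ⟨p, -, h⟩ := List.mem_flatMap.1 h
      have h := (mem_filterWord h).1
      simp only [List.mem_cons, Option.some.injEq, List.not_mem_nil, or_false] at h
      rcases h with rfl | rfl | rfl | rfl <;> simp at h'
    · obtain ⟨p, -, h⟩ := List.mem_flatMap.1 h
      have h := (mem_filterWord h).1
      simp only [List.mem_cons, Option.some.injEq, List.not_mem_nil, or_false] at h'
      rcases h' with rfl | rfl <;> simp at h)
  have h4 := h123.append (BlockWord.replicate (tw := Chord.tw) s) (by simp)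
  have hsum : ∀ (n : ℕ) (f : ℕ → ℕ), ((List.range n).map f).sum = ∑ p ∈ Finset.range n, f p := by
    intro n f
    induction n with
    | zero => rfl
    | succ n ih => rw [List.sum_range_succ, Finset.sum_range_succ, ih]
  have hz : ∀ f : ℕ → ℕ, (ls.zipIdx.map fun p => f p.2) = (List.range ls.length).map f := by
    intro f
    rw [List.range_eq_range', ← List.zipIdx_map_snd, List.map_map]
    rfl
  rw [hz fun p => if P (.positive p) = true then 1 else 0] at h4
  rw [canonicalWord, filterWord_append, filterWord_append, filterWord_append,
    filterWord_flatMap, filterWord_flatMap, filterWord_flatMap]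
  rw [filterWord_replicate]
  have h0 : ∀ {ι : Type} (l : List ι), (l.map fun _ => (0 : ℕ)).sum = 0 := by simp
  simp only [hsum, h0, Finset.sum_const_zero, Nat.add_zero, Nat.zero_add] at h4
  exact h4

namespace HERG

/-! ### Cyclic readings by position, and their existence -/

section

variable {F : Type} {v h : F → F}

theorem path_iff {L : List F} {t s : F} : Path v h t L s ↔
    ∀ i (hi : i < L.length + 1), v ((t :: L.map h)[i]'(by simpa using hi)) =
      (L ++ [s])[i]'(by simpa using hi) := by
  induction L generalizing t with
  | nil =>
    constructor
    · intro h i hi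
      obtain rfl : i = 0 := by simpa using hi
      exact h
    · intro h
      exact h 0 (by simp)
  | cons f L ih =>
    constructor
    · rintro ⟨h1, h2⟩ i hi
      cases i with
      | zero => exact h1
      | succ i => exact ih.1 h2 i (by simpa using hi)
    · intro h'
      refine ⟨h' 0 (by simp), ih.2 fun i hi => ?_⟩
      exact h' (i + 1) (by simpa using hi)

theorem cyc_iff {L : List F} : Cyc v h L ↔
    ∀ i (hi : i < L.length), v (h L[i]) =
      L[(i + 1) % L.length]'(Nat.mod_lt _ (Nat.zero_lt_of_lt hi)) := by
  cases L with
  | nil => simp [Cyc]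
  | cons f L =>
    refine path_iff.trans ⟨fun h' i hi => ?_, fun h' i hi => ?_⟩
    · have := h' i hi
      simp only [← List.map_cons, List.getElem_map] at this
      rw [this, ← List.getElem_rotate (f :: L) 1 i (by simpa using hi)]
      simp
    · have := h' i hi
      simp only [← List.map_cons, List.getElem_map]
      rw [this, ← List.getElem_rotate (f :: L) 1 i (by simpa using hi)]
      simp

/-- The orbit of a flag under `v ∘ h` is a cyclic reading of the vertex. -/
theorem exists_cyc [Finite F] (vv : ∀ x, v (v x) = x) (hh : ∀ x, h (h x) = x)
    (vne : ∀ x, v x ≠ x) (hne : ∀ x, h x ≠ x) (f : F)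
    (hconn : ∀ S : Set F, f ∈ S → (∀ x ∈ S, v x ∈ S ∧ h x ∈ S) → ∀ x, x ∈ S) :
    ∃ L : List F, f ∈ L ∧ Cyc v h L ∧ Transversal h L := by
  set ρ : F → F := fun x => v (h x) with hρ
  have hinj : Function.Injective ρ := fun a b hab => by
    have : v (v (h a)) = v (v (h b)) := congrArg v hab
    rw [vv, vv] at this
    rw [← hh a, this, hh]
  have hmem : f ∈ Function.periodicPts ρ := hinj.mem_periodicPts f
  set p := Function.minimalPeriod ρ f with hp
  have hp0 : 0 < p := Function.minimalPeriod_pos_of_mem_periodicPts hmem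
  have hpf : ρ^[p] f = f := Function.isPeriodicPt_minimalPeriod ρ f
  have hmod : ∀ k, ρ^[k % p] f = ρ^[k] f := fun k => Function.iterate_mod_minimalPeriod_eq
  set L := (List.range p).map fun i => ρ^[i] f with hLdef
  have hL : ∀ x, x ∈ L ↔ ∃ i, ρ^[i] f = x := by
    intro x
    simp only [hLdef, List.mem_map, List.mem_range]
    exact ⟨fun ⟨i, _, h⟩ => ⟨i, h⟩, fun ⟨i, h⟩ => ⟨i % p, Nat.mod_lt _ hp0, (hmod i).trans h⟩⟩
  -- The involution `h` inverts `ρ`, so `h a = ρ^[k + 2] a` yields the same relation at `ρ a` with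
  -- exponent `k`. The descent ends in a fixed point of `h` or of `v`.
  have key : ∀ k a, h a ≠ ρ^[k] a := by
    intro k
    induction k using Nat.strong_induction_on with
    | _ k ih =>
      intro a ha
      match k, ih, ha with
      | 0, _, ha => exact hne a ha
      | 1, _, ha => exact vne (h a) ha.symm
      | k + 2, ih, ha =>
        refine ih k (by omega) (ρ a) (hinj ?_)
        have h1 : ρ (h (ρ a)) = h a := by simp only [hρ, hh, vv]
        rw [h1, ha, ← Function.iterate_succ_apply' ρ k (ρ a), ← Function.iterate_succ_apply]
  have hρL : ∀ x, x ∈ L → ρ x ∈ L := by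
    intro x hx
    obtain ⟨i, rfl⟩ := (hL x).1 hx
    exact (hL _).2 ⟨i + 1, Function.iterate_succ_apply' ρ i f⟩
  have hρL' : ∀ x ∈ L, ∃ y ∈ L, ρ y = x := by
    intro x hx
    obtain ⟨i, rfl⟩ := (hL x).1 hx
    refine ⟨ρ^[i + (p - 1)] f, (hL _).2 ⟨_, rfl⟩, ?_⟩
    rw [← Function.iterate_succ_apply' ρ, show (i + (p - 1)).succ = i + p by omega,
      Function.iterate_add_apply, hpf]
  refine ⟨L, (hL f).2 ⟨0, rfl⟩, ?_, ?_, ?_, ?_⟩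
  · rw [cyc_iff]
    intro i hi
    have hlen : L.length = p := by simp [hLdef]
    simp only [hLdef, List.getElem_map, List.getElem_range, List.length_map, List.length_range]
    rw [hmod]
    exact (Function.iterate_succ_apply' ρ i f).symm
  · refine (List.nodup_map_iff_inj_on List.nodup_range).2 fun i hi j hj hij => ?_
    rw [List.mem_range] at hi hj
    exact Function.iterate_injOn_Iio_minimalPeriod hi hj hij
  · intro a ha ha'
    obtain ⟨i, rfl⟩ := (hL a).1 ha
    obtain ⟨j, hj⟩ := (hL _).1 ha'
    -- The exponent leads from `ρ^[i] f` to `ρ^[j] f`; the multiple `p * i` of the period makes the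
    -- subtraction legitimate.
    refine key (j + p * i - i) (ρ^[i] f) ?_
    rw [← hj, ← Function.iterate_add_apply, Nat.sub_add_cancel
      ((Nat.le_mul_of_pos_left i hp0).trans (Nat.le_add_left _ _)), ← hmod (j + p * i),
      Nat.add_mul_mod_self_left, hmod]
  -- The flags listed directly or through `h` form a set that is stable under `v` and `h` and
  -- contains `f`, so connectedness applies.
  · refine hconn {a | a ∈ L ∨ h a ∈ L} (Or.inl ((hL f).2 ⟨0, rfl⟩)) fun x hx => ⟨?_, ?_⟩
    · rcases hx with hx | hx
      · obtain ⟨y, hy, rfl⟩ := hρL' x hx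
        right
        change h (v (v (h y))) ∈ L
        rwa [vv, hh]
      · left
        have := hρL _ hx
        change v (h (h x)) ∈ L at this
        rwa [hh] at this
    · rcases hx with hx | hx
      · right; rwa [hh]
      · left; exact hx

end

/-! ### Graphs spelled by words -/

/-- The vertex boundary of the graph reads as the word formed by the labels of `Z`. -/
structure Spells {C : Type} (G : HERG) (tw : C → Bool) (Z : List (G.Flag × Option C)) : Prop where
  cyc : Cyc G.v G.h (Z.map Prod.fst)
  trans : Transversal G.h (Z.map Prod.fst)
  half : ∀ f, (f, none) ∈ Z → G.e f = G.h f
  chord : ∀ f f' c, (f, some c) ∈ Z → (f', some c) ∈ Z → f' ≠ f →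
    G.e f = if tw c then f' else G.h f'

theorem finRotate_val {n : ℕ} (p : Fin n) : (finRotate n p).val = (p.val + 1) % n := by
  have := p.neZero
  rw [finRotate_apply, Fin.val_add, Fin.val_one', Nat.add_mod_mod]

theorem partner_eq {C : Type} {w : List (Option C)} {p q : Fin w.length} {c : C}
    (hp : w.get p = some c) (hq : w.get q = some c) (hqp : q ≠ p)
    (h : ∀ r, w.get r = some c → r = p ∨ r = q) : partner w p = q := by
  have hu : w.get p ≠ none ∧ ∃! q, q ≠ p ∧ w.get q = w.get p :=
    ⟨by rw [hp]; simp, q, ⟨hqp, hq.trans hp.symm⟩, fun r hr =>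
      (h r (hr.2.trans hp)).resolve_left hr.1⟩
  rw [partner, dif_pos hu]
  have := hu.2.choose_spec.1
  exact (h _ (this.2.trans hp)).resolve_left this.1

theorem partner_none {C : Type} {w : List (Option C)} {p : Fin w.length}
    (hp : w.get p = none) : partner w p = p := by
  rw [partner, dif_neg fun h => h.1 hp]

section

variable {C : Type} {tw : C → Bool}

/-- The reading of a chord diagram. -/
def chordList (tw : C → Bool) (w : List (Option C)) :
    List ((chordDiagram tw w).Flag × Option C) :=
  List.ofFn fun p : Fin w.length => ((p, false), w.get p)

theorem chordList_map_snd (w : List (Option C)) : (chordList tw w).map Prod.snd = w := by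
  rw [chordList, List.map_ofFn]
  exact List.ofFn_get w

theorem chordList_map_fst (w : List (Option C)) : (chordList tw w).map Prod.fst =
    List.ofFn fun p : Fin w.length => ((p, false) : Fin w.length × Bool) := by
  rw [chordList, List.map_ofFn]; rfl

theorem mem_chordList {w : List (Option C)} {x : Fin w.length × Bool} {c : Option C} :
    ((x, c) : (chordDiagram tw w).Flag × Option C) ∈ chordList tw w ↔
      x.2 = false ∧ w.get x.1 = c := by
  rw [chordList, List.mem_ofFn]
  constructor
  · rintro ⟨i, hi⟩
    cases hi
    exact ⟨rfl, rfl⟩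
  · obtain ⟨p, b⟩ := x
    rintro ⟨h1, rfl⟩
    exact ⟨p, by rw [show b = false from h1]⟩

theorem partner_chord {w : List (Option C)} {a j m : ℕ} (hw : BlockWord tw w a j m)
    {p q : Fin w.length} {c : C} (hp : w.get p = some c) (hq : w.get q = some c) (hqp : q ≠ p) :
    partner w p = q := by
  refine partner_eq hp hq hqp fun r hr => ?_
  have := (hw.blockList (chordList_map_snd (tw := tw) w)).twice
    (mem_chordList.2 ⟨rfl, hp⟩ : ((p, false), some c) ∈ chordList tw w)
    (mem_chordList.2 ⟨rfl, hq⟩ : ((q, false), some c) ∈ chordList tw w)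
    (mem_chordList.2 ⟨rfl, hr⟩ : ((r, false), some c) ∈ chordList tw w)
  rcases this with h | h | h
  · exact (hqp (Prod.mk.inj h).1.symm).elim
  · exact Or.inl (Prod.mk.inj h).1.symm
  · exact Or.inr (Prod.mk.inj h).1.symm

theorem transversal_chordList (w : List (Option C)) :
    Transversal (chordDiagram tw w).h ((chordList tw w).map Prod.fst) := by
  rw [chordList_map_fst]
  have hmem : ∀ x : Fin w.length × Bool, x ∈ (List.ofFn fun p : Fin w.length =>
      ((p, false) : Fin w.length × Bool)) ↔ x.2 = false := by
    rintro ⟨p, b⟩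
    rw [List.mem_ofFn]
    exact ⟨fun ⟨i, hi⟩ => by rw [← hi], fun h => ⟨p, by rw [show b = false from h]⟩⟩
  refine ⟨List.nodup_ofFn.2 fun a b hab => (Prod.mk.inj hab).1, fun x hx hx' => ?_, fun x => ?_⟩
  · have h1 := (hmem x).1 hx
    have h2 : (!x.2) = false := (hmem _).1 hx'
    rw [h1] at h2
    cases h2
  · obtain ⟨p, _ | _⟩ := x
    · exact Or.inl ((hmem _).2 rfl)
    · exact Or.inr ((hmem _).2 rfl)

theorem chordDiagram_spells {w : List (Option C)} {a j m : ℕ} (hw : BlockWord tw w a j m) :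
    (chordDiagram tw w).Spells tw (chordList tw w) := by
  refine ⟨?_, transversal_chordList w, ?_, ?_⟩
  · have key : Cyc (F := Fin w.length × Bool) (chordDiagram tw w).v (chordDiagram tw w).h
        (List.ofFn fun p => (p, false)) := by
      refine (cyc_iff (F := Fin w.length × Bool)).2 fun i hi => ?_
      simp only [List.getElem_ofFn, List.length_ofFn]
      exact Prod.ext (Fin.ext (finRotate_val _)) rfl
    rw [chordList_map_fst]
    exact key
  · rintro ⟨p, b⟩ hf
    obtain ⟨h1, h2⟩ := mem_chordList.1 hf
    exact if_pos (partner_none h2)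
  · rintro ⟨p, b⟩ ⟨q, b'⟩ c hf hf' hne
    obtain ⟨h1, h2⟩ := mem_chordList.1 hf
    obtain ⟨h3, h4⟩ := mem_chordList.1 hf'
    dsimp only at h1 h2 h3 h4
    subst h1 h3
    have hqp : q ≠ p := fun h => hne (by rw [h])
    have hpq := partner_chord hw h2 h4 hqp
    have hne' : ¬ partner w p = p := by rw [hpq]; exact hqp
    refine (if_neg hne').trans ?_
    change (partner w p, if (w.get p).elim false tw then false else !false) = _
    rw [hpq, h2]
    cases h : tw c <;> simp [h] <;> rfl

/-- A graph whose vertex boundary spells a word is the chord diagram of this word. -/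
theorem Spells.iso {G : HERG} {Z : List (G.Flag × Option C)} {a j m : ℕ} (hZ : G.Spells tw Z)
    (hB : BlockList tw Z a j m) (hi : G.isolated = if Z.length = 0 then 1 else 0) :
    (chordDiagram tw (Z.map Prod.snd)).Iso G := by
  have hlen : (Z.map Prod.snd).length = Z.length := List.length_map _
  let z : Fin (Z.map Prod.snd).length → G.Flag := fun p => (Z[p.1]'(hlen ▸ p.2)).1
  have hz : ∀ p, (z p, (Z.map Prod.snd).get p) ∈ Z := by
    intro p
    have : (z p, (Z.map Prod.snd).get p) = Z[p.1]'(hlen ▸ p.2) := by simp [z]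
    rw [this]
    exact List.getElem_mem _
  have hzL : ∀ p, z p ∈ Z.map Prod.fst := fun p => List.mem_map.2 ⟨_, hz p, rfl⟩
  have hzinj : Function.Injective z := by
    intro p q hpq
    have := (List.nodup_iff_injective_getElem.1 hZ.trans.nodup)
      (a₁ := ⟨p.1, by simpa using p.2⟩) (a₂ := ⟨q.1, by simpa using q.2⟩) (by simpa [z] using hpq)
    exact Fin.ext (by simpa using this)
  have hzsurj : ∀ f c, (f, c) ∈ Z → ∃ p, z p = f ∧ (Z.map Prod.snd).get p = c := by
    intro f c hf
    obtain ⟨i, hi, h⟩ := List.getElem_of_mem hf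
    exact ⟨⟨i, hlen ▸ hi⟩, by simp [z, h], by simp [h]⟩
  have hzv : ∀ p, G.v (G.h (z p)) = z (finRotate _ p) := by
    intro p
    have := cyc_iff.1 hZ.cyc p.1 (by simpa using p.2)
    simp only [List.getElem_map, List.length_map] at this
    refine this.trans ?_
    change _ = (Z[(finRotate _ p).1]'_).1
    simp only [finRotate_val, List.length_map]
  -- A place without partner must be a half-chord, since a chord letter occurs at exactly two
  -- places.
  have hze : ∀ p, partner (Z.map Prod.snd) p = p → G.e (z p) = G.h (z p) := by
    intro p hp
    cases hc : (Z.map Prod.snd).get p with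
    | none => exact hZ.half _ (hc ▸ hz p)
    | some c =>
      exfalso
      obtain ⟨f', h1, h2⟩ := hB.exists_ne hZ.trans.nodup (hc ▸ hz p)
      obtain ⟨q, rfl, hq⟩ := hzsurj _ _ h1
      have : partner (Z.map Prod.snd) p = q := by
        refine partner_eq hc hq (fun h => h2 (by rw [h])) fun r hr => ?_
        rcases hB.twice (hc ▸ hz p) (hq ▸ hz q) (hr ▸ hz r) with h | h | h
        · exact (h2 h.symm).elim
        · exact Or.inl (hzinj h.symm)
        · exact Or.inr (hzinj h.symm)
      exact h2 (by rw [← this, hp])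
  have hze' : ∀ p, partner (Z.map Prod.snd) p ≠ p → G.e (z p) =
      if ((Z.map Prod.snd).get p).elim false tw then z (partner (Z.map Prod.snd) p)
      else G.h (z (partner (Z.map Prod.snd) p)) := by
    intro p hp
    cases hc : (Z.map Prod.snd).get p with
    | none => exact (hp (partner_none hc)).elim
    | some c =>
      refine hZ.chord _ _ c (hc ▸ hz p) ?_ fun h => hp (hzinj h)
      have := hz (partner (Z.map Prod.snd) p)
      rwa [get_partner, hc] at this
  refine ⟨?_, Equiv.ofBijective (fun x : Fin (Z.map Prod.snd).length × Bool =>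
    if x.2 then G.h (z x.1) else z x.1) ⟨?_, ?_⟩, ?_⟩
  · rw [hi, ← hlen]
    rfl
  · have hcross : ∀ p q, G.h (z p) ≠ z q := fun p q h => hZ.trans.notMem _ (hzL p) (h ▸ hzL q)
    rintro ⟨p, _ | _⟩ ⟨q, _ | _⟩ hpq
    · exact Prod.ext (hzinj hpq) rfl
    · exact (hcross q p hpq.symm).elim
    · exact (hcross p q hpq).elim
    · exact Prod.ext (hzinj (G.h_inj.1 hpq)) rfl
  · intro f
    rcases hZ.trans.complete f with hf | hf <;> obtain ⟨⟨f', c⟩, hf', h⟩ := List.mem_map.1 hf <;>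
      obtain ⟨p, hp, -⟩ := hzsurj _ _ hf' <;> dsimp only at h
    · exact ⟨(p, false), hp.trans h⟩
    · refine ⟨(p, true), ?_⟩
      change G.h (z p) = f
      rw [hp, h, G.h_h]
  · rintro ⟨p, b⟩
    refine ⟨?_, ?_, ?_⟩
    · cases b
      · change G.h (z ((finRotate _).symm p)) = G.v (z p)
        have := hzv ((finRotate _).symm p)
        rw [Equiv.apply_symm_apply] at this
        rw [← this, G.v_v]
      · exact (hzv p).symm
    · cases b
      · rfl
      · exact (G.h_h _).symm
    · by_cases hp : partner (Z.map Prod.snd) p = p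
      · have he : (chordDiagram tw (Z.map Prod.snd)).e (p, b) = (p, !b) := if_pos hp
        rw [he]
        have := hze p hp
        cases b
        · exact this.symm
        · change z p = G.e (G.h (z p))
          rw [← G.h_e, this, G.h_h]
      · have he : (chordDiagram tw (Z.map Prod.snd)).e (p, b) = (partner (Z.map Prod.snd) p,
            if ((Z.map Prod.snd).get p).elim false tw then b else !b) := if_neg hp
        rw [he]
        have := hze' p hp
        cases ht : ((Z.map Prod.snd).get p).elim false tw <;> rw [ht] at this <;> cases b
        · exact this.symm
        · change z _ = G.e (G.h (z p))
          rw [← G.h_e, this]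
          exact (G.h_h _).symm
        · exact this.symm
        · change G.h (z _) = G.e (G.h (z p))
          rw [← G.h_e, this]
          rfl

end

end HERG

namespace HERG

/-! ### Every one-vertex graph is equivalent to a canonical diagram -/

section

variable {D : HERG}

/-- The labelled reading of a list of blocks. -/
def blockLabels (Q : List (D.Flag × D.Flag)) (P : List (D.Flag × List D.Flag)) (T N : List D.Flag) :
    List (D.Flag × Option Chord) :=
  Q.zipIdx.flatMap (fun a => [(a.1.1, some (.crossL a.2)), (a.1.2, some (.crossR a.2)),
      (D.h (D.e a.1.1), some (.crossL a.2)), (D.h (D.e a.1.2), some (.crossR a.2))]) ++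
    P.zipIdx.flatMap (fun a => (a.1.1, some (.positive a.2)) ::
      (a.1.2.map (fun n => (n, none)) ++ [(D.h (D.e a.1.1), some (.positive a.2))])) ++
    T.zipIdx.flatMap (fun a => [(a.1, some (.negative a.2)), (D.e a.1, some (.negative a.2))]) ++
    N.map fun n => (n, none)

variable {Q : List (D.Flag × D.Flag)} {P : List (D.Flag × List D.Flag)} {T N : List D.Flag}

theorem flatMap_zipIdx_fst {α β : Type} (l : List α) (f : α → List β) :
    l.zipIdx.flatMap (fun a => f a.1) = l.flatMap f := by
  conv_rhs => rw [← List.zipIdx_map_fst 0 l, List.flatMap_map]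

theorem flatMap_zipIdx_snd {α β : Type} (l : List α) (f : ℕ → List β) :
    l.zipIdx.flatMap (fun a => f a.2) = (List.range l.length).flatMap f := by
  rw [List.range_eq_range', ← List.zipIdx_map_snd, List.flatMap_map]

theorem blockLabels_fst : (blockLabels Q P T N).map Prod.fst = blocks Q P T ++ N := by
  have h1 := flatMap_zipIdx_fst Q quadBlock
  have h2 := flatMap_zipIdx_fst P posBlock
  have h3 := flatMap_zipIdx_fst T negBlock
  rw [blocks, ← h1, ← h2, ← h3, blockLabels]
  simp [List.map_flatMap, quadBlock, posBlock, negBlock, Function.comp_def]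

theorem blockLabels_snd : (blockLabels Q P T N).map Prod.snd =
    canonicalWord Q.length (P.map fun p => p.2.length) T.length N.length := by
  have h1 := flatMap_zipIdx_snd Q fun p =>
    [some (Chord.crossL p), some (.crossR p), some (.crossL p), some (.crossR p)]
  have h3 := flatMap_zipIdx_snd T fun p => [some (Chord.negative p), some (.negative p)]
  rw [canonicalWord, ← h1, ← h3, blockLabels]
  simp [List.map_flatMap, Function.comp_def, List.zipIdx_map, List.flatMap_map, List.map_const']

theorem half_of_mem_blockLabels (hV : ValidBlocks Q P T) (hN : ∀ x ∈ N, D.e x = D.h x)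
    {f : D.Flag} (hf : (f, none) ∈ blockLabels Q P T N) : D.e f = D.h f := by
  simp only [blockLabels, List.mem_append, List.mem_flatMap, List.mem_map, List.mem_cons,
    Prod.mk.injEq, reduceCtorEq, and_false, List.not_mem_nil, or_false, false_or, and_true,
    exists_false, exists_eq_right] at hf
  rcases hf with ⟨⟨p, i⟩, hp, hf⟩ | hf
  · exact (hV.pos p (List.fst_mem_of_mem_zipIdx hp)).2 f hf
  · exact hN f hf

theorem partner_of_mem_blockLabels (hV : ValidBlocks Q P T) {f : D.Flag} {c : Chord}
    (hf : (f, some c) ∈ blockLabels Q P T N) :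
    ∃ f', (f', some c) ∈ blockLabels Q P T N ∧ f' ≠ f ∧
      D.e f = if c.tw then f' else D.h f' := by
  have ne1 : ∀ x, D.IsEdge x → D.h (D.e x) ≠ x := fun x hx h => hx (by rw [← D.h_h (D.e x), h])
  have e1 : ∀ x, D.e x = D.h (D.h (D.e x)) := fun x => (D.h_h _).symm
  have e2 : ∀ x, D.e (D.h (D.e x)) = D.h x := fun x => by rw [← D.h_e, D.e_e]
  simp only [blockLabels, List.mem_append, List.mem_flatMap, List.mem_map, List.mem_cons,
    Prod.mk.injEq, reduceCtorEq, and_false, List.not_mem_nil, or_false, false_or, exists_false,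
    Option.some.injEq] at hf ⊢
  rcases hf with (⟨⟨p, i⟩, hp, hf⟩ | ⟨⟨p, i⟩, hp, hf⟩) | ⟨⟨p, i⟩, hp, hf⟩
  · have hp' := hV.quad p (List.fst_mem_of_mem_zipIdx hp)
    rcases hf with ⟨rfl, rfl⟩ | ⟨rfl, rfl⟩ | ⟨rfl, rfl⟩ | ⟨rfl, rfl⟩
    · exact ⟨_, Or.inl (Or.inl ⟨_, hp, by simp⟩), ne1 _ hp'.1, e1 _⟩
    · exact ⟨D.h (D.e p.2), Or.inl (Or.inl ⟨_, hp, by simp⟩), ne1 _ hp'.2, e1 _⟩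
    · exact ⟨p.1, Or.inl (Or.inl ⟨_, hp, by simp⟩), (ne1 _ hp'.1).symm, e2 _⟩
    · exact ⟨p.2, Or.inl (Or.inl ⟨_, hp, by simp⟩), (ne1 _ hp'.2).symm, e2 _⟩
  · have hp' := (hV.pos p (List.fst_mem_of_mem_zipIdx hp)).1
    rcases hf with ⟨rfl, rfl⟩ | ⟨rfl, rfl⟩
    · exact ⟨D.h (D.e p.1), Or.inl (Or.inr ⟨_, hp, by simp⟩), ne1 _ hp', e1 _⟩
    · exact ⟨p.1, Or.inl (Or.inr ⟨_, hp, by simp⟩), (ne1 _ hp').symm, e2 _⟩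
  · dsimp only at hf
    rcases hf with ⟨hf, rfl⟩ | ⟨hf, rfl⟩
    · exact ⟨D.e p, Or.inr ⟨_, hp, by simp⟩, hf ▸ D.e_ne p, hf ▸ rfl⟩
    · exact ⟨p, Or.inr ⟨_, hp, by simp⟩, hf ▸ (D.e_ne p).symm, hf ▸ D.e_e p⟩

theorem blockWord_canonicalWord (j : ℕ) (ls : List ℕ) (m s : ℕ) :
    ∃ a' j' m', BlockWord Chord.tw (canonicalWord j ls m s) a' j' m' :=
  ⟨_, _, _, filterWord_true (canonicalWord j ls m s) ▸ blockWord_canonical (fun _ => true) j ls m s⟩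

/-- The vertex is read as a cyclic list of flags, slides bring the list into blocks, and numbering
the blocks of each kind turns it into a canonical word. The word determines the graph by
`Spells.iso`. -/
theorem exists_canonical {G : HERG} (hV : G.numVertices = 1) : ∃ j ls m s, m ≤ 2 ∧
    HRClass.REquiv (HRClass.of G) (HRClass.canonical j ls m s) := by
  by_cases hi : G.isolated = 0
  · have hcard : Nat.card G.Vertex = 1 := by unfold numVertices at hV; omega
    obtain ⟨hsub, ⟨f⟩⟩ := Nat.card_eq_one_iff_unique.1 hcard
    obtain ⟨f, rfl⟩ := Quot.exists_rep f
    obtain ⟨L, -, hc, hL⟩ := exists_cyc G.v_v G.h_h G.v_ne G.h_ne f (by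
      intro S hf hS x
      refine (Quot.iff_of_mk_eq (r := fun x y : G.Flag => y = G.v x ∨ y = G.h x) (· ∈ S) ?_
        (hsub.elim (Quot.mk _ f) (Quot.mk _ x))).1 hf
      rintro a b (rfl | rfl)
      · exact ⟨fun h => (hS a h).1, fun h => by simpa [G.v_v] using (hS _ h).1⟩
      · exact ⟨fun h => (hS a h).2, fun h => by simpa [G.h_h] using (hS _ h).2⟩)
    obtain ⟨Q, P, T, N, c', hval, hN, ⟨v, hv, hne, rfl, hc', hL'⟩, hr⟩ :=
      exists_blocks hi ⟨G.v, G.v_v, G.v_ne, rfl, hc, hL⟩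
    refine ⟨Q.length, P.map fun p => p.2.length, T.length, N.length, hval.two, ?_⟩
    obtain ⟨a', j', m', hw⟩ := blockWord_canonicalWord Q.length (P.map fun p => p.2.length)
      T.length N.length
    have hB := hw.blockList (blockLabels_snd (Q := Q) (P := P) (T := T) (N := N))
    rw [← blockLabels_fst] at hc' hL'
    have hne' : blockLabels Q P T N ≠ [] := by
      intro h
      rw [h] at hL'
      have := hL'.complete f
      simp at this
    have hsp : (G.reorder v hv hne).Spells Chord.tw (blockLabels Q P T N) := by
      refine ⟨hc', hL', fun f hf => half_of_mem_blockLabels hval hN hf,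
        fun f f' c hf hf' hff' => ?_⟩
      obtain ⟨f₀, h1, h2, h3⟩ := partner_of_mem_blockLabels hval hf
      rcases hB.twice hf h1 hf' with h | h | h
      · exact (h2 h.symm).elim
      · exact (hff' h.symm).elim
      · exact h ▸ h3
    have hiso := (congrArg (fun w => HRClass.of (chordDiagram Chord.tw w)) (blockLabels_snd
      (Q := Q) (P := P) (T := T) (N := N)).symm).trans (hsp.iso hB (hi.trans (if_neg (mt List.length_eq_zero_iff.1 hne')).symm)).of_eq
    rw [HRClass.canonical, hiso]
    exact hr
  -- The only vertex carries no ribbon; it is the diagram of the empty word.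
  · refine ⟨0, [], 0, 0, by omega, ?_⟩
    have h1 : Nat.card G.Vertex = 0 ∧ G.isolated = 1 := by unfold numVertices at hV; omega
    have h2 : IsEmpty G.Flag := by
      refine ⟨fun x => ?_⟩
      have : Nonempty G.Vertex := ⟨G.vertexOf x⟩
      have := Nat.card_pos (α := G.Vertex)
      omega
    have h3 : G.Iso (chordDiagram Chord.tw (canonicalWord 0 [] 0 0)) := by
      refine ⟨h1.2, ?_⟩
      have : IsEmpty (chordDiagram Chord.tw (canonicalWord 0 [] 0 0)).Flag :=
        ⟨fun x : Fin 0 × Bool => x.1.elim0⟩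
      exact ⟨Equiv.equivOfIsEmpty _ _, fun x => isEmptyElim x⟩
    rw [HRClass.canonical, h3.of_eq]
    exact Relation.ReflTransGen.refl

end

end HERG

namespace HERG

/-! ### The faces of a graph spelled by blocks -/

section Faces

variable {G : HERG}

theorem faceOf_v (x : G.Flag) : G.faceOf (G.v x) = G.faceOf x := Quot.sound_symm (Or.inl rfl)

theorem faceOf_e (x : G.Flag) : G.faceOf (G.e x) = G.faceOf x := Quot.sound_symm (Or.inr rfl)

/-- The flags `R` represent the faces that meet the ribbon ends in `L` apart from the face
of `t`. -/
structure FaceReps (t : G.Flag) (L R : List G.Flag) : Prop where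
  nodup : ((t :: R).map G.faceOf).Nodup
  inside : ∀ r ∈ R, ∀ x, G.faceOf x = G.faceOf r → x ∈ L ∨ G.h x ∈ L
  cover : ∀ x, x ∈ L ∨ G.h x ∈ L → G.faceOf x = G.faceOf t ∨ ∃ r ∈ R, G.faceOf x = G.faceOf r

theorem FaceReps.nil (t : G.Flag) : FaceReps t [] [] := ⟨by simp, by simp, by simp⟩

/-- A block all of whose flags lie on the circle of `t` adds no circle; the reading goes on from a
flag `t'` of the same circle. -/
theorem FaceReps.extend {t t' : G.Flag} {B L R : List G.Flag} (h : FaceReps t' L R)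
    (ht : G.faceOf t' = G.faceOf t)
    (hB : ∀ x ∈ B, G.faceOf x = G.faceOf t ∧ G.faceOf (G.h x) = G.faceOf t) :
    FaceReps t (B ++ L) R := by
  refine ⟨?_, fun r hr x hx => ?_, fun x hx => ?_⟩
  · have := h.nodup
    rwa [List.map_cons, ht] at this
  · rcases h.inside r hr x hx with h | h
    · exact Or.inl (List.mem_append_right _ h)
    · exact Or.inr (List.mem_append_right _ h)
  · rw [List.mem_append, List.mem_append] at hx
    by_cases h1 : x ∈ B
    · exact Or.inl (hB x h1).1
    by_cases h2 : G.h x ∈ B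
    · left
      have := (hB _ h2).2
      rwa [G.h_h] at this
    rw [← ht]
    exact h.cover x (by tauto)

theorem faceOf_of_path {M : List G.Flag} {t s : G.Flag} (hp : Path G.v G.h t M s)
    (hM : ∀ n ∈ M, G.e n = G.h n) :
    G.faceOf s = G.faceOf t ∧ ∀ n ∈ M, G.faceOf n = G.faceOf t ∧ G.faceOf (G.h n) = G.faceOf t := by
  induction M generalizing t with
  | nil => exact ⟨by rw [← show G.v t = s from hp, faceOf_v], by simp⟩
  | cons n M ih =>
    obtain ⟨rfl, hp⟩ := hp
    have h1 : G.faceOf (G.h (G.v t)) = G.faceOf t := by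
      rw [← hM _ List.mem_cons_self, faceOf_e, faceOf_v]
    obtain ⟨h2, h3⟩ := ih hp fun n hn => hM n (List.mem_cons_of_mem _ hn)
    rw [h1] at h2 h3
    refine ⟨h2, fun n hn => ?_⟩
    rcases List.mem_cons.1 hn with rfl | hn
    · exact ⟨faceOf_v t, h1⟩
    · exact h3 n hn

/-- An untwisted chord around half-ribbons cuts off one circle, represented by `G.h g`. Its flags
are those of the inner arcs, the set `I`, which is stable under `v` and `e` and does not contain
`g`. The circle of `t` passes on the outer side of the chord. -/
theorem FaceReps.pos {t g g' : G.Flag} {M L R : List G.Flag} (h : FaceReps (G.h g') L R)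
    (hg : G.v t = g) (hp : Path G.v G.h (G.h g) M g') (he : G.e g = G.h g')
    (hM : ∀ n ∈ M, G.e n = G.h n) (hnd : (g :: (M ++ g' :: L)).Nodup)
    (hnm : ∀ a ∈ g :: (M ++ g' :: L), G.h a ∉ g :: (M ++ g' :: L)) :
    FaceReps t (g :: (M ++ g' :: L)) (G.h g :: R) := by
  have he' : G.e g' = G.h g := e_eq_h_comm he
  have h1 : G.faceOf g = G.faceOf t := by rw [← hg, faceOf_v]
  have h2 : G.faceOf (G.h g') = G.faceOf t := by rw [← he, faceOf_e, h1]
  obtain ⟨h3, h4⟩ := faceOf_of_path hp hM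
  let I : G.Flag → Prop := fun x => x ∈ G.h g :: M.map G.h ∨ x ∈ M ++ [g']
  have hIv : ∀ x, I x → I (G.v x) := by
    rintro x (hx | hx)
    · exact Or.inr (hp.mem hx)
    · left
      have := (hp.flip G.v_v G.h_h).mem (w := x) (by
        rw [map_h_map_h, List.mem_cons, List.mem_reverse]
        simpa [or_comm] using hx)
      simpa [or_comm] using this
  have hIe : ∀ x, I x → I (G.e x) := by
    rintro x (hx | hx)
    · rcases List.mem_cons.1 hx with rfl | hx
      · rw [← he', G.e_e]; exact Or.inr (by simp)
      · obtain ⟨n, hn, rfl⟩ := List.mem_map.1 hx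
        rw [← G.h_e, hM n hn, G.h_h]; exact Or.inr (by simp [hn])
    · rcases List.mem_append.1 hx with hx | hx
      · rw [hM x hx]; exact Or.inl (List.mem_cons_of_mem _ (List.mem_map.2 ⟨x, hx, rfl⟩))
      · rw [List.mem_singleton.1 hx, he']; exact Or.inl (by simp)
  have hI : ∀ a b, G.faceOf a = G.faceOf b → (I a ↔ I b) := by
    intro a b
    refine Quot.iff_of_mk_eq I ?_
    rintro a b (rfl | rfl)
    · exact ⟨hIv a, fun h => by simpa [G.v_v] using hIv _ h⟩
    · exact ⟨hIe a, fun h => by simpa [G.e_e] using hIe _ h⟩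
  have hIg : I (G.h g) := Or.inl List.mem_cons_self
  have hIL : ∀ x, I x → x ∈ g :: (M ++ g' :: L) ∨ G.h x ∈ g :: (M ++ g' :: L) := by
    rintro x (hx | hx)
    · right
      rcases List.mem_cons.1 hx with rfl | hx
      · rw [G.h_h]; exact List.mem_cons_self
      · obtain ⟨n, hn, rfl⟩ := List.mem_map.1 hx
        rw [G.h_h]; simp [hn]
    · left
      simp only [List.mem_append, List.mem_singleton] at hx
      simp only [List.mem_cons, List.mem_append]
      tauto
  have hgI : ¬ I g := by
    rintro (hx | hx)
    · rcases List.mem_cons.1 hx with h | hx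
      · exact G.h_ne g h.symm
      · obtain ⟨n, hn, h⟩ := List.mem_map.1 hx
        exact hnm n (by simp [hn]) (by simp [h])
    · refine (List.nodup_cons.1 hnd).1 ?_
      simp only [List.mem_append, List.mem_singleton] at hx
      simp only [List.mem_cons, List.mem_append]
      tauto
  have htI : G.faceOf t ≠ G.faceOf (G.h g) := fun h => hgI ((hI _ _ (h1.trans h)).2 hIg)
  have hnd' := h.nodup
  rw [List.map_cons, List.nodup_cons, h2] at hnd'
  refine ⟨?_, ?_, ?_⟩
  · rw [List.map_cons, List.map_cons, List.nodup_cons, List.nodup_cons, List.mem_cons, not_or]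
    refine ⟨⟨htI, hnd'.1⟩, ?_, hnd'.2⟩
    intro hm
    obtain ⟨r, hr, hrg⟩ := List.mem_map.1 hm
    rcases h.inside r hr _ hrg.symm with h | h
    · exact hnm g (by simp) (by simp [h])
    · rw [G.h_h] at h
      exact (List.nodup_cons.1 hnd).1 (by simp [h])
  · intro r hr x hx
    rcases List.mem_cons.1 hr with rfl | hr
    · exact hIL x ((hI _ _ hx).2 hIg)
    · have := h.inside r hr x hx
      simp only [List.mem_cons, List.mem_append]
      tauto
  · have key : ∀ x ∈ g :: (M ++ g' :: L), (x ∈ L) ∨ ((G.faceOf x = G.faceOf t ∨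
        G.faceOf x = G.faceOf (G.h g)) ∧ (G.faceOf (G.h x) = G.faceOf t ∨
        G.faceOf (G.h x) = G.faceOf (G.h g))) := by
      intro x hx
      rcases List.mem_cons.1 hx with rfl | hx
      · exact Or.inr ⟨Or.inl h1, Or.inr rfl⟩
      · rcases List.mem_append.1 hx with hx | hx
        · exact Or.inr ⟨Or.inr (h4 x hx).1, Or.inr (h4 x hx).2⟩
        · rcases List.mem_cons.1 hx with rfl | hx
          · exact Or.inr ⟨Or.inr h3, Or.inl h2⟩
          · exact Or.inl hx
    have hc := h.cover
    rw [h2] at hc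
    intro x hx
    have fin1 : G.faceOf x = G.faceOf t ∨ G.faceOf x = G.faceOf (G.h g) ∨ (x ∈ L ∨ G.h x ∈ L) := by
      rcases hx with hx | hx
      · have := key x hx; tauto
      · have := key _ hx
        rw [G.h_h] at this
        tauto
    rcases fin1 with h | h | h
    · exact Or.inl h
    · exact Or.inr ⟨_, List.mem_cons_self, h⟩
    · rcases hc x h with h | ⟨r, hr, h⟩
      · exact Or.inl h
      · exact Or.inr ⟨r, List.mem_cons_of_mem _ hr, h⟩

variable {C : Type} {tw : C → Bool}

/-- The circle of `t` is followed through the blocks. Half-chords, negative chords and crossing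
pairs lie on it entirely; only an isolated positive chord contributes a circle of its own. -/
theorem exists_faceReps {Z : List (G.Flag × Option C)} {a j m : ℕ} (hB : BlockList tw Z a j m)
    (half : ∀ f, (f, none) ∈ Z → G.e f = G.h f)
    (chord : ∀ f f' c, (f, some c) ∈ Z → (f', some c) ∈ Z → f' ≠ f →
      G.e f = if tw c then f' else G.h f')
    (hnd : (Z.map Prod.fst).Nodup) (hnm : ∀ a ∈ Z.map Prod.fst, G.h a ∉ Z.map Prod.fst)
    {t s : G.Flag} (hp : Path G.v G.h t (Z.map Prod.fst) s) :
    ∃ R, R.length = a ∧ FaceReps t (Z.map Prod.fst) R := by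
  induction hB generalizing t with
  | nil => exact ⟨[], rfl, FaceReps.nil t⟩
  | @half Z a j m f _ ih =>
    obtain ⟨rfl, hp⟩ := hp
    obtain ⟨R, hR, hF⟩ := ih (fun f hf => half f (List.mem_cons_of_mem _ hf))
      (fun f f' c hf hf' => chord f f' c (List.mem_cons_of_mem _ hf) (List.mem_cons_of_mem _ hf'))
      (List.nodup_cons.1 hnd).2
      (fun a ha h => hnm a (List.mem_cons_of_mem _ ha) (List.mem_cons_of_mem _ h)) hp
    have h1 : G.faceOf (G.h (G.v t)) = G.faceOf t := by
      rw [← half _ List.mem_cons_self, faceOf_e, faceOf_v]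
    refine ⟨R, hR, hF.extend (B := [G.v t]) h1 ?_⟩
    simp [h1, faceOf_v]
  | @pos Z a j m c g g' N hN hc hZ _ ih =>
    have hL : ((g, some c) :: (N ++ (g', some c) :: Z)).map Prod.fst =
        g :: (N.map Prod.fst ++ g' :: Z.map Prod.fst) := by simp
    rw [hL] at hnd hnm hp ⊢
    obtain ⟨hg, hp⟩ := hp
    obtain ⟨hp1, hp2⟩ := path_append_cons.1 hp
    have hsub : ∀ x ∈ Z, x ∈ (g, some c) :: (N ++ (g', some c) :: Z) := fun x hx => by simp [hx]
    have hsub' : ∀ x ∈ Z.map Prod.fst, x ∈ g :: (N.map Prod.fst ++ g' :: Z.map Prod.fst) :=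
      fun x hx => List.mem_cons_of_mem _ (List.mem_append_right _ (List.mem_cons_of_mem _ hx))
    have hnd2 := (List.nodup_append.1 (List.nodup_cons.1 hnd).2).2.1
    obtain ⟨R, hR, hF⟩ := ih (fun f hf => half f (hsub _ hf))
      (fun f f' c hf hf' => chord f f' c (hsub _ hf) (hsub _ hf'))
      (List.nodup_cons.1 hnd2).2 (fun a ha h => hnm a (hsub' _ ha) (hsub' _ h)) hp2
    refine ⟨G.h g :: R, by simp [hR], hF.pos hg hp1 ?_ ?_ hnd hnm⟩
    · have := chord g g' c (by simp) (by simp) fun h => (List.nodup_cons.1 hnd).1 (by simp [h])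
      rwa [hc, if_neg (by simp)] at this
    · intro n hn
      obtain ⟨⟨n, o⟩, hno, rfl⟩ := List.mem_map.1 hn
      obtain rfl : o = none := hN (n, o) hno
      exact half n (by simp [hno])
  | @neg Z a j m c g g' hc hZ _ ih =>
    have hL : ((g, some c) :: (g', some c) :: Z).map Prod.fst =
        g :: g' :: Z.map Prod.fst := by simp
    rw [hL] at hnd hnm hp ⊢
    obtain ⟨hg, hg', hp⟩ := hp
    have hsub : ∀ x ∈ Z, x ∈ (g, some c) :: (g', some c) :: Z := fun x hx => by simp [hx]
    have hsub' : ∀ x ∈ Z.map Prod.fst, x ∈ g :: g' :: Z.map Prod.fst := fun x hx => by simp [hx]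
    obtain ⟨R, hR, hF⟩ := ih (fun f hf => half f (hsub _ hf))
      (fun f f' c hf hf' => chord f f' c (hsub _ hf) (hsub _ hf'))
      (List.nodup_cons.1 (List.nodup_cons.1 hnd).2).2
      (fun a ha h => hnm a (hsub' _ ha) (hsub' _ h)) hp
    have he := chord g g' c (by simp) (by simp) fun h => (List.nodup_cons.1 hnd).1 (by simp [h])
    rw [hc, if_pos rfl] at he
    have h1 : G.faceOf g = G.faceOf t := by rw [← hg, faceOf_v]
    have h2 : G.faceOf g' = G.faceOf t := by rw [← he, faceOf_e, h1]
    have h3 : G.faceOf (G.h g) = G.faceOf t := by rw [← faceOf_v, hg', h2]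
    have h4 : G.faceOf (G.h g') = G.faceOf t := by rw [← e_h_eq he, faceOf_e, h3]
    refine ⟨R, hR, hF.extend (B := [g, g']) h4 ?_⟩
    simp [h1, h2, h3, h4]
  | @quad Z a j m c d x y x' y' hcd hc hd hZ hZ' _ ih =>
    have hL : ((x, some c) :: (y, some d) :: (x', some c) :: (y', some d) :: Z).map Prod.fst =
        x :: y :: x' :: y' :: Z.map Prod.fst := by simp
    rw [hL] at hnd hnm hp ⊢
    obtain ⟨hx, hy, hx', hy', hp⟩ := hp
    have hsub : ∀ z ∈ Z, z ∈ (x, some c) :: (y, some d) :: (x', some c) :: (y', some d) :: Z :=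
      fun x hx => by simp [hx]
    have hsub' : ∀ z ∈ Z.map Prod.fst, z ∈ x :: y :: x' :: y' :: Z.map Prod.fst :=
      fun x hx => by simp [hx]
    have hnd1 := List.nodup_cons.1 hnd
    have hnd2 := List.nodup_cons.1 hnd1.2
    obtain ⟨R, hR, hF⟩ := ih (fun f hf => half f (hsub _ hf))
      (fun f f' c hf hf' => chord f f' c (hsub _ hf) (hsub _ hf'))
      (List.nodup_cons.1 (List.nodup_cons.1 hnd2.2).2).2
      (fun a ha h => hnm a (hsub' _ ha) (hsub' _ h)) hp
    have hex := chord x x' c (by simp) (by simp) fun h => hnd1.1 (by simp [h])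
    have hey := chord y y' d (by simp) (by simp) fun h => hnd2.1 (by simp [h])
    rw [hc, if_neg (by simp)] at hex
    rw [hd, if_neg (by simp)] at hey
    have h1 : G.faceOf x = G.faceOf t := by rw [← hx, faceOf_v]
    have h2 : G.faceOf (G.h x') = G.faceOf t := by rw [← hex, faceOf_e, h1]
    have h3 : G.faceOf y' = G.faceOf t := by rw [← hy', faceOf_v, h2]
    have h4 : G.faceOf (G.h y) = G.faceOf t := by rw [← e_eq_h_comm hey, faceOf_e, h3]
    have h5 : G.faceOf x' = G.faceOf t := by rw [← hx', faceOf_v, h4]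
    have h6 : G.faceOf (G.h x) = G.faceOf t := by rw [← e_eq_h_comm hex, faceOf_e, h5]
    have h7 : G.faceOf y = G.faceOf t := by rw [← hy, faceOf_v, h6]
    have h8 : G.faceOf (G.h y') = G.faceOf t := by rw [← hey, faceOf_e, h7]
    refine ⟨R, hR, hF.extend (B := [x, y, x', y']) h8 ?_⟩
    simp [h1, h2, h3, h4, h5, h6, h7, h8]

theorem card_eq_length {α : Type} [Finite α] {p : α → Prop} {l : List α} (hl : l.Nodup)
    (hp : ∀ x, x ∈ l ↔ p x) : Nat.card {x // p x} = l.length := by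
  classical
  rw [← List.toFinset_card_of_nodup hl]
  exact Nat.subtype_card _ fun x => by rw [List.mem_toFinset, hp]

end Faces

/-! ### The numerical invariants of a graph spelled by blocks -/

section Numbers

variable {G : HERG} {C : Type} {tw : C → Bool} {Z : List (G.Flag × Option C)} {a j m : ℕ}

theorem Spells.isEmpty (hZ : G.Spells tw ([] : List (G.Flag × Option C))) : IsEmpty G.Flag :=
  ⟨fun x => by simpa using hZ.trans.complete x⟩

theorem Spells.numVertices (hZ : G.Spells tw Z) (hi : G.isolated = if Z.length = 0 then 1 else 0) :
    G.numVertices = 1 := by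
  by_cases h : Z = []
  · subst h
    have := hZ.isEmpty
    have : IsEmpty G.Vertex := ⟨by rintro ⟨x⟩; exact isEmptyElim x⟩
    rw [HERG.numVertices, hi]
    simp
  · rw [if_neg (by simpa using h)] at hi
    exact numVertices_of_cyc hZ.cyc hZ.trans (by simpa using h) hi

theorem Spells.numFaces (hZ : G.Spells tw Z) (hB : BlockList tw Z a j m)
    (hi : G.isolated = if Z.length = 0 then 1 else 0) : G.numFaces = a + 1 := by
  by_cases h : Z = []
  · subst h
    have := hZ.isEmpty
    have : IsEmpty G.Face := ⟨by rintro ⟨x⟩; exact isEmptyElim x⟩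
    cases hB
    rw [HERG.numFaces, hi]
    simp
  · rw [if_neg (by simpa using h)] at hi
    obtain ⟨⟨f, c⟩, Z', rfl⟩ := List.exists_cons_of_ne_nil h
    -- Starting one arc before `f` makes the path run through the complete list; the `+ 1` is the
    -- circle of this starting flag.
    have hp : Path G.v G.h (G.v f) (((f, c) :: Z').map Prod.fst) f := ⟨G.v_v f, hZ.cyc⟩
    obtain ⟨R, hR, hF⟩ := exists_faceReps hB hZ.half hZ.chord hZ.trans.nodup hZ.trans.notMem hp
    have := card_eq_length (p := fun _ => True) hF.nodup (by
      intro x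
      obtain ⟨x, rfl⟩ := Quot.exists_rep x
      refine iff_of_true ?_ trivial
      rcases hF.cover x (hZ.trans.complete x) with h | ⟨r, hr, h⟩
      · exact List.mem_map.2 ⟨_, List.mem_cons_self, h.symm⟩
      · exact List.mem_map.2 ⟨r, List.mem_cons_of_mem _ hr, h.symm⟩)
    rw [Nat.card_congr (Equiv.subtypeUnivEquiv fun _ => trivial)] at this
    rw [HERG.numFaces, hi, this]
    simp [hR]

theorem _root_.BlockList.length_filter {F : Type} {Z : List (F × Option C)} (hB : BlockList tw Z a j m) :
    (Z.filter fun z => z.2.isSome).length = 2 * (a + 2 * j + m) := by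
  induction hB with
  | nil => rfl
  | half f _ ih => simpa using ih
  | pos c g g' N hN hc hZ _ ih =>
    have : N.filter (fun z => z.2.isSome) = [] := by
      rw [List.filter_eq_nil_iff]
      intro x hx
      simp [hN x hx]
    simp [ih, this]
    ring
  | neg c g g' hc hZ _ ih => simp [ih]; ring
  | quad c d x y x' y' hcd hc hd hZ hZ' _ ih => simp [ih]; ring

theorem Spells.isEdge_iff (hZ : G.Spells tw Z) (hB : BlockList tw Z a j m) {f : G.Flag}
    {c : Option C} (hf : (f, c) ∈ Z) : G.IsEdge f ↔ c.isSome := by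
  cases c with
  | none => simpa [IsEdge] using hZ.half f hf
  | some c =>
    refine iff_of_true ?_ rfl
    obtain ⟨f', hf', hne⟩ := hB.exists_ne hZ.trans.nodup hf
    have := hZ.chord f f' c hf hf' hne
    intro h
    rw [this] at h
    split_ifs at h
    · exact hZ.trans.notMem f (List.mem_map.2 ⟨_, hf, rfl⟩) (List.mem_map.2 ⟨_, hf', h⟩)
    · exact hne (G.h_inj.1 h)

theorem Spells.numEdges (hZ : G.Spells tw Z) (hB : BlockList tw Z a j m) :
    G.numEdges = a + 2 * j + m := by
  set L := (Z.filter fun z => z.2.isSome).map Prod.fst with hL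
  have hmem : ∀ x, x ∈ L ↔ x ∈ Z.map Prod.fst ∧ G.IsEdge x := by
    intro x
    simp only [hL, List.mem_map, List.mem_filter]
    constructor
    · rintro ⟨⟨f, c⟩, ⟨h1, h2⟩, rfl⟩
      exact ⟨⟨_, h1, rfl⟩, (hZ.isEdge_iff hB h1).2 h2⟩
    · rintro ⟨⟨⟨f, c⟩, h1, rfl⟩, h2⟩
      exact ⟨_, ⟨h1, (hZ.isEdge_iff hB h1).1 h2⟩, rfl⟩
  have hinj : Function.Injective G.h := Function.LeftInverse.injective G.h_h
  have hnd : L.Nodup := hZ.trans.nodup.sublist (List.filter_sublist.map _)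
  have hnd' : (L ++ L.map G.h).Nodup := by
    refine hnd.append (hnd.map hinj) fun x hx hx' => ?_
    obtain ⟨y, hy, rfl⟩ := List.mem_map.1 hx'
    exact hZ.trans.notMem y ((hmem y).1 hy).1 ((hmem _).1 hx).1
  have hcard := card_eq_length (p := fun x => G.IsEdge x) hnd' (by
    intro x
    rw [List.mem_append, hmem, List.mem_map (l := L)]
    constructor
    · rintro (h | ⟨y, hy, rfl⟩)
      · exact h.2
      · exact (G.isEdge_h y).2 ((hmem y).1 hy).2
    · intro h
      rcases hZ.trans.complete x with h' | h'
      · exact Or.inl ⟨h', h⟩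
      · exact Or.inr ⟨G.h x, (hmem _).2 ⟨h', (G.isEdge_h x).2 h⟩, G.h_h x⟩)
  have h4 := G.four_mul_numEdges
  have h5 := hB.length_filter
  have h6 : L.length = 2 * (a + 2 * j + m) := by rw [hL, List.length_map, h5]
  rw [hcard, List.length_append, List.length_map (as := L), h6] at h4
  omega

theorem _root_.BlockList.negative_iff {F : Type} {Z : List (F × Option C)} (hB : BlockList tw Z a j m) :
    m ≠ 0 ↔ ∃ f c, (f, some c) ∈ Z ∧ tw c = true := by
  induction hB with
  | nil => simp
  | half f _ ih => simpa using ih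
  | pos c g g' N hN hc hZ _ ih =>
    have hN' : ∀ f c, (f, some c) ∉ N := fun f c hf => by simpa using hN _ hf
    rw [ih]
    simp only [List.mem_cons, List.mem_append, Prod.mk.injEq, Option.some.injEq, hN', false_or]
    constructor
    · rintro ⟨f, d, h1, h2⟩
      exact ⟨f, d, by tauto, h2⟩
    · rintro ⟨f, d, ⟨_, rfl⟩ | ⟨_, rfl⟩ | h1, h2⟩
      · simp [hc] at h2
      · simp [hc] at h2
      · exact ⟨f, d, h1, h2⟩
  | neg c g g' hc hZ _ ih => exact iff_of_true (by omega) ⟨g, c, by simp, hc⟩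
  | quad c d x y x' y' hcd hc hd hZ hZ' _ ih =>
    rw [ih]
    simp only [List.mem_cons, Prod.mk.injEq, Option.some.injEq]
    constructor
    · rintro ⟨f, d, h1, h2⟩
      exact ⟨f, d, by tauto, h2⟩
    · rintro ⟨f, d, ⟨_, rfl⟩ | ⟨_, rfl⟩ | ⟨_, rfl⟩ | ⟨_, rfl⟩ | h1, h2⟩
      · simp [hc] at h2
      · simp [hd] at h2
      · simp [hc] at h2
      · simp [hd] at h2
      · exact ⟨f, d, h1, h2⟩

/-- The listed flags are the first ones of their ribbon ends in the chosen direction of reading, so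
an arc joins a listed flag to an unlisted one. -/
theorem Spells.v_mem_iff (hZ : G.Spells tw Z) (x : G.Flag) :
    G.v x ∈ Z.map Prod.fst ↔ x ∉ Z.map Prod.fst := by
  have h1 : ∀ x, G.h x ∈ Z.map Prod.fst → G.v x ∈ Z.map Prod.fst := by
    intro x hx
    obtain ⟨i, hi, h⟩ := List.getElem_of_mem hx
    have := cyc_iff.1 hZ.cyc i hi
    rw [h, G.h_h] at this
    rw [this]
    exact List.getElem_mem _
  have hfl := hZ.cyc.flip G.v_v G.h_h
  have h2 : ∀ x, x ∈ Z.map Prod.fst → G.h (G.v x) ∈ Z.map Prod.fst := by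
    intro x hx
    have hx' : G.h x ∈ (Z.map Prod.fst).reverse.map G.h :=
      List.mem_map.2 ⟨x, List.mem_reverse.2 hx, rfl⟩
    obtain ⟨i, hi, h⟩ := List.getElem_of_mem hx'
    have := cyc_iff.1 hfl i hi
    rw [h, G.h_h] at this
    have hm : G.v x ∈ (Z.map Prod.fst).reverse.map G.h := this ▸ List.getElem_mem _
    obtain ⟨y, hy, hyx⟩ := List.mem_map.1 hm
    rw [← hyx, G.h_h]
    exact List.mem_reverse.1 hy
  constructor
  · intro h h'
    exact hZ.trans.notMem _ h (h2 x h')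
  · intro h
    exact h1 x ((hZ.trans.complete x).resolve_left h)

/-- Every colouring is constant on the list, as `v ∘ h` preserves colours; a negative chord joins
two listed flags by `e` and excludes it. Without negative chords, membership in the list is a
colouring. -/
theorem Spells.orientable_iff (hZ : G.Spells tw Z) (hB : BlockList tw Z a j m) :
    G.Orientable ↔ m = 0 := by
  classical
  have hmemfst : ∀ {f c}, (f, c) ∈ Z → f ∈ Z.map Prod.fst := fun h => List.mem_map.2 ⟨_, h, rfl⟩
  have hh : ∀ x, G.h x ∈ Z.map Prod.fst ↔ x ∉ Z.map Prod.fst := fun x =>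
    ⟨fun h h' => hZ.trans.notMem x h' h, fun h => (hZ.trans.complete x).resolve_left h⟩
  constructor
  · rintro ⟨c, hc⟩
    by_contra hm
    obtain ⟨f, d, hf, hd⟩ := hB.negative_iff.1 hm
    obtain ⟨f', hf', hne⟩ := hB.exists_ne hZ.trans.nodup hf
    have he := hZ.chord f f' d hf hf' hne
    rw [if_pos hd] at he
    have key : ∀ i (hi : i < (Z.map Prod.fst).length),
        c (Z.map Prod.fst)[i] = c ((Z.map Prod.fst)[0]'(by omega)) := by
      intro i
      induction i with
      | zero => intro _; rfl
      | succ i ih =>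
        intro hi
        rw [← ih (by omega)]
        have := cyc_iff.1 hZ.cyc i (by omega)
        simp only [Nat.mod_eq_of_lt hi] at this
        rw [← this, (hc _).1, (hc _).2.1, Bool.not_not]
    obtain ⟨i, hi, h1⟩ := List.getElem_of_mem (hmemfst hf)
    obtain ⟨i', hi', h2⟩ := List.getElem_of_mem (hmemfst hf')
    have h3 := key i hi
    rw [← key i' hi', h1, h2, ← he, (hc f).2.2] at h3
    simp at h3
  · intro hm
    have hneg : ∀ f c, (f, some c) ∈ Z → tw c = false := by
      intro f c hf
      by_contra h
      exact hB.negative_iff.2 ⟨f, c, hf, by simpa using h⟩ hm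
    have he : ∀ x ∈ Z.map Prod.fst, G.e x ∉ Z.map Prod.fst := by
      intro x hx
      obtain ⟨⟨f, c⟩, hf, rfl⟩ := List.mem_map.1 hx
      cases c with
      | none =>
        rw [hZ.half f hf, hh]
        exact not_not.2 hx
      | some c =>
        obtain ⟨f', hf', hne⟩ := hB.exists_ne hZ.trans.nodup hf
        rw [hZ.chord f f' c hf hf' hne, hneg f c hf, if_neg (by simp), hh]
        exact not_not.2 (hmemfst hf')
    have he' : ∀ x, G.e x ∈ Z.map Prod.fst ↔ x ∉ Z.map Prod.fst := by
      refine fun x => ⟨fun h h' => he x h' h, fun h => ?_⟩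
      have := he _ ((hh x).2 h)
      rw [← G.h_e, hh] at this
      exact not_not.1 this
    refine ⟨fun x => decide (x ∈ Z.map Prod.fst), fun x => ⟨?_, ?_, ?_⟩⟩
    · exact (decide_eq_decide.2 (hZ.v_mem_iff x)).trans decide_not
    · exact (decide_eq_decide.2 (hh x)).trans decide_not
    · exact (decide_eq_decide.2 (he' x)).trans decide_not

/-- With one vertex, `r = 0`, `k = 1` and `n = a + 2j + m`. There are `a + 1` circles, so `F_int = a
+ 1 - C_∂`, and the exponent `k + n - F_int` of `z` is `2j + m + C_∂`. -/
theorem Spells.weight_eq {R : Type*} [CommRing R] (hZ : G.Spells tw Z) (hB : BlockList tw Z a j m)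
    (hi : G.isolated = if Z.length = 0 then 1 else 0) (x y z s w t : R) :
    weight 0 G x y z s w t = (y - 1) ^ (a + 2 * j + m) * z ^ (2 * j + m + G.numBoundary) *
      s ^ G.numBoundary * w ^ (if m = 0 then 0 else 1) * t ^ G.numHalfRibbons := by
  have h1 := hZ.numVertices hi
  have h2 := numComponents_eq_one h1
  have h3 := hZ.numFaces hB hi
  have h4 := hZ.numEdges hB
  have h5 := G.numClosedFaces_add_numBoundary
  have h6 : G.rank = 0 := by rw [rank, h1, h2]
  have h7 : G.nullity = a + 2 * j + m := by rw [nullity, h6, h4]; rfl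
  have h8 : G.nonorientability = if m = 0 then 0 else 1 := by
    unfold nonorientability
    by_cases hm : m = 0
    · rw [if_pos hm, if_pos ((hZ.orientable_iff hB).2 hm)]
    · rw [if_neg hm, if_neg (mt (hZ.orientable_iff hB).1 hm)]
  have h9 : G.numComponents + G.nullity - G.numClosedFaces = 2 * j + m + G.numBoundary := by
    rw [h2, h7]; omega
  rw [weight, h9, h6, h7, h8]
  simp

end Numbers

end HERG

namespace HERG

/-! ### The polynomial of a canonical diagram -/

section

variable {G : HERG} {C : Type} {tw : C → Bool} {Z : List (G.Flag × Option C)} {a j m : ℕ}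

/-- The flags of the edges with a letter in `A`. -/
def flagsOf (G : HERG) {C : Type} (Z : List (G.Flag × Option C)) (A : Finset C) : Set G.Flag :=
  {x | ∃ c ∈ A, (x, some c) ∈ Z ∨ (G.h x, some c) ∈ Z}

theorem Spells.label_unique (hZ : G.Spells tw Z) {f : G.Flag} {c d : Option C} (h : (f, c) ∈ Z)
    (h' : (f, d) ∈ Z) : c = d :=
  (Prod.mk.inj (List.inj_on_of_nodup_map hZ.trans.nodup h h' rfl)).2

theorem Spells.h_notMem (hZ : G.Spells tw Z) {f : G.Flag} {c d : Option C} (h : (f, c) ∈ Z) :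
    (G.h f, d) ∉ Z := fun h' =>
  hZ.trans.notMem f (List.mem_map.2 ⟨_, h, rfl⟩) (List.mem_map.2 ⟨_, h', rfl⟩)

theorem Spells.isEdgeSet_flagsOf (hZ : G.Spells tw Z) (hB : BlockList tw Z a j m) (A : Finset C) :
    G.IsEdgeSet (G.flagsOf Z A) := by
  have key : ∀ x, ∀ c ∈ A, (x, some c) ∈ Z → G.e x ∈ G.flagsOf Z A ∧ G.IsEdge x := by
    intro x c hc hx
    refine ⟨?_, (hZ.isEdge_iff hB hx).2 rfl⟩
    obtain ⟨f', hf', hne⟩ := hB.exists_ne hZ.trans.nodup hx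
    rw [hZ.chord x f' c hx hf' hne]
    split_ifs
    · exact ⟨c, hc, Or.inl hf'⟩
    · exact ⟨c, hc, Or.inr ((G.h_h f').symm ▸ hf')⟩
  have hh : ∀ x, x ∈ G.flagsOf Z A → G.h x ∈ G.flagsOf Z A := by
    rintro x ⟨c, hc, hx⟩
    refine ⟨c, hc, ?_⟩
    rw [G.h_h]
    exact hx.symm
  intro x hx
  refine ⟨hh x hx, ?_⟩
  obtain ⟨c, hc, hx | hx⟩ := hx
  · exact key x c hc hx
  · obtain ⟨h1, h2⟩ := key _ c hc hx
    refine ⟨?_, (G.isEdge_h x).1 h2⟩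
    have := hh _ h1
    rwa [G.h_e, G.h_h] at this

/-- Each letter labels exactly the two ends of one edge, so sets of edges are sets of letters. -/
theorem Spells.sum_edgeSets {R : Type*} [AddCommMonoid R] (hZ : G.Spells tw Z)
    (hB : BlockList tw Z a j m) {K : Finset C} (hK : ∀ c, c ∈ K ↔ ∃ f, (f, some c) ∈ Z)
    (F : Set G.Flag → R) : ∑ S ∈ G.edgeSets, F S = ∑ A ∈ K.powerset, F (G.flagsOf Z A) := by
  classical
  have hsame : ∀ S, G.IsEdgeSet S → ∀ f g c, f ∈ S → (f, some c) ∈ Z → (g, some c) ∈ Z →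
      g ∈ S := by
    intro S hS f g c hf h1 h2
    by_cases hgf : g = f
    · exact hgf ▸ hf
    have h3 := (hS f hf).2.1
    rw [hZ.chord f g c h1 h2 hgf] at h3
    split_ifs at h3
    · exact h3
    · exact (hS.h_mem_iff g).1 h3
  refine (Finset.sum_nbij' (fun A => G.flagsOf Z A)
    (fun S => K.filter fun c => ∃ f ∈ S, (f, some c) ∈ Z) ?_ ?_ ?_ ?_ ?_).symm
  · intro A _
    exact (mem_edgeSets _ _).2 (hZ.isEdgeSet_flagsOf hB A)
  · intro S _
    exact Finset.mem_powerset.2 (Finset.filter_subset _ _)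
  · intro A hA
    ext c
    rw [Finset.mem_filter]
    constructor
    · rintro ⟨-, f, ⟨d, hd, hf | hf⟩, hf'⟩
      · obtain rfl := Option.some.inj (hZ.label_unique hf hf')
        exact hd
      · exact (hZ.h_notMem hf' hf).elim
    · intro hc
      have hcK := Finset.mem_powerset.1 hA hc
      obtain ⟨f, hf⟩ := (hK c).1 hcK
      exact ⟨hcK, f, ⟨c, hc, Or.inl hf⟩, hf⟩
  · intro S hS
    have hS' := (mem_edgeSets _ _).1 hS
    ext x
    constructor
    · rintro ⟨c, hc, hx | hx⟩ <;> obtain ⟨-, f, hf, hfc⟩ := Finset.mem_filter.1 hc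
      · exact hsame S hS' f x c hf hfc hx
      · exact (hS'.h_mem_iff x).1 (hsame S hS' f _ c hf hfc hx)
    · intro hx
      have key : ∀ y c, y ∈ S → (y, c) ∈ Z → ∃ d, c = some d ∧
          d ∈ K.filter fun c => ∃ f ∈ S, (f, some c) ∈ Z := by
        intro y c hy hyc
        obtain ⟨d, rfl⟩ := Option.isSome_iff_exists.1 ((hZ.isEdge_iff hB hyc).1 (hS' y hy).2.2)
        exact ⟨d, rfl, Finset.mem_filter.2 ⟨(hK d).2 ⟨y, hyc⟩, y, hy, hyc⟩⟩
      rcases hZ.trans.complete x with h | h <;> obtain ⟨⟨y, c⟩, hy, h⟩ := List.mem_map.1 h <;>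
        dsimp only at h <;> subst h
      · obtain ⟨d, rfl, hd⟩ := key _ c hx hy
        exact ⟨d, hd, Or.inl hy⟩
      · obtain ⟨d, rfl, hd⟩ := key _ c ((hS'.h_mem_iff x).2 hx) hy
        exact ⟨d, hd, Or.inr hy⟩
  · intro _ _
    rfl

/-- The labels after cutting the chords that are not in `A`. -/
noncomputable def keepLabels [DecidableEq C] (A : Finset C) {F : Type} (Z : List (F × Option C)) :
    List (F × Option C) :=
  Z.map fun z => (z.1, z.2.filter fun d => decide (d ∈ A))

theorem mem_keepLabels [DecidableEq C] {A : Finset C} {F : Type} {Z : List (F × Option C)} {f : F}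
    {c : Option C} : (f, c) ∈ keepLabels A Z ↔
      ∃ d, (f, d) ∈ Z ∧ d.filter (fun d => decide (d ∈ A)) = c := by
  rw [keepLabels, List.mem_map]
  constructor
  · rintro ⟨⟨g, d⟩, h, he⟩
    obtain ⟨rfl, rfl⟩ := Prod.mk.inj he
    exact ⟨d, h, rfl⟩
  · rintro ⟨d, h, rfl⟩
    exact ⟨_, h, rfl⟩

theorem map_snd_keepLabels [DecidableEq C] (A : Finset C) {F : Type} (Z : List (F × Option C)) :
    (keepLabels A Z).map Prod.snd =
      (Z.map Prod.snd).map fun d => d.filter fun d => decide (d ∈ A) := by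
  rw [keepLabels, List.map_map, List.map_map]; rfl

theorem Spells.iso_of_eq {w : List (Option C)} (hZ : G.Spells tw Z) (hw : Z.map Prod.snd = w)
    (hB : BlockList tw Z a j m) (hi : G.isolated = if Z.length = 0 then 1 else 0) :
    (chordDiagram tw w).Iso G := hw ▸ hZ.iso hB hi

/-- Cutting leaves the reading of the vertex unchanged and merely erases the labels of the cut
chords. -/
theorem Spells.onFlags [DecidableEq C] (hZ : G.Spells tw Z) (hB : BlockList tw Z a j m)
    (A : Finset C) : (G.onFlags (G.flagsOf Z A)).Spells tw (keepLabels A Z) := by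
  have hS := hZ.isEdgeSet_flagsOf hB A
  have hfst : (keepLabels A Z).map Prod.fst = Z.map Prod.fst := by
    rw [keepLabels, List.map_map]; rfl
  have hmem : ∀ f c, (f, some c) ∈ keepLabels A Z → (f, some c) ∈ Z ∧ c ∈ A := by
    intro f c h
    obtain ⟨d, h1, h2⟩ := mem_keepLabels.1 h
    rw [Option.filter_eq_some_iff] at h2
    exact ⟨h2.1 ▸ h1, by simpa using h2.2⟩
  refine ⟨?_, ?_, fun (f : G.Flag) hf => ?_, fun (f f' : G.Flag) c hf hf' hne => ?_⟩
  · exact hfst.symm ▸ hZ.cyc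
  · exact hfst.symm ▸ hZ.trans
  · obtain ⟨d, h1, h2⟩ := mem_keepLabels.1 hf
    refine onFlags_e_of_notMem hS ?_
    rintro ⟨c, hc, h | h⟩
    · rw [hZ.label_unique h1 h] at h2
      simp [Option.filter, hc] at h2
    · exact hZ.h_notMem h1 h
  · obtain ⟨h1, hc⟩ := hmem f c hf
    exact (onFlags_e_of_mem G (S := G.flagsOf Z A) ⟨c, hc, Or.inl h1⟩).trans
      (hZ.chord f f' c h1 (hmem f' c hf').1 hne)

end

theorem mem_canonicalChords_iff (j : ℕ) (ls : List ℕ) (m s : ℕ) (c : Chord) :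
    c ∈ canonicalChords j ls.length m ↔ some c ∈ canonicalWord j ls m s := by
  have hz : ∀ p, (∃ a, (a, p) ∈ ls.zipIdx) ↔ p < ls.length := by
    intro p
    constructor
    · rintro ⟨a, h⟩
      simpa using List.snd_lt_of_mem_zipIdx h
    · intro h
      exact ⟨ls[p], List.mk_mem_zipIdx_iff_getElem?.2 (List.getElem?_eq_getElem h)⟩
  simp only [canonicalChords, canonicalWord, Finset.mem_union, Finset.mem_image, Finset.mem_range,
    List.mem_append, List.mem_flatMap, List.mem_range, List.mem_cons, List.mem_replicate,
    Option.some.injEq, List.not_mem_nil, or_false, reduceCtorEq, and_false, false_or, Prod.exists]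
  cases c with
  | crossL p => simp
  | crossR p => simp
  | positive p => simp [← hz]
  | negative p => simp

theorem sum_of_subset_canonicalChords {j a m : ℕ} {A : Finset Chord}
    (hA : A ⊆ canonicalChords j a m) (g : Chord → ℕ) :
    ∑ c ∈ A, g c = ∑ p ∈ Finset.range j, (if .crossL p ∈ A then g (.crossL p) else 0) +
      ∑ p ∈ Finset.range j, (if .crossR p ∈ A then g (.crossR p) else 0) +
      ∑ p ∈ Finset.range a, (if .positive p ∈ A then g (.positive p) else 0) +
      ∑ p ∈ Finset.range m, (if .negative p ∈ A then g (.negative p) else 0) := by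
  have h1 : ∑ c ∈ A, g c = ∑ c ∈ canonicalChords j a m, if c ∈ A then g c else 0 := by
    rw [← Finset.sum_filter, Finset.filter_mem_eq_inter, Finset.inter_eq_right.2 hA]
  rw [h1, canonicalChords, Finset.sum_union, Finset.sum_union, Finset.sum_union,
    Finset.sum_image, Finset.sum_image, Finset.sum_image, Finset.sum_image]
  all_goals first
    | (intro x _ y _ h; injection h)
    | (rw [Finset.disjoint_left]; intro c h h'
       simp only [Finset.mem_union, Finset.mem_image] at h h'
       obtain ⟨p, -, rfl⟩ := h'
       simp at h)

theorem numNegative_eq {j a m : ℕ} {A : Finset Chord} (hA : A ⊆ canonicalChords j a m) :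
    numNegative A = ∑ p ∈ Finset.range m, if .negative p ∈ A then 1 else 0 := by
  rw [numNegative, Finset.card_filter, sum_of_subset_canonicalChords hA]
  simp [Chord.tw]

theorem numPairs_eq (j : ℕ) (A : Finset Chord) : numPairs j A =
    ∑ p ∈ Finset.range j, if .crossL p ∈ A ∧ .crossR p ∈ A then 1 else 0 := by
  rw [numPairs, Finset.card_filter]

/-- The third parameter of the weight, the number `a` of isolated positive chords, equals `A.card`
minus two for each complete crossing pair and one for each negative chord. A crossing pair with one
chord in `A` is counted in `a`. -/
theorem blockWord_restrictWord {j : ℕ} {ls : List ℕ} {m s : ℕ} {A : Finset Chord}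
    (hA : A ⊆ canonicalChords j ls.length m) : ∃ a,
      BlockWord Chord.tw (restrictWord A (canonicalWord j ls m s)) a (numPairs j A)
        (numNegative A) ∧ A.card = a + 2 * numPairs j A + numNegative A := by
  have h := blockWord_canonical (fun d => decide (d ∈ A)) j ls m s
  simp only [decide_eq_true_eq, decide_eq_decide, ← numPairs_eq, ← numNegative_eq hA] at h
  refine ⟨_, h, ?_⟩
  have key : ∑ p ∈ Finset.range j, (if .crossL p ∈ A then 1 else 0) +
      ∑ p ∈ Finset.range j, (if .crossR p ∈ A then 1 else 0) =
      ∑ p ∈ Finset.range j, (if Chord.crossL p ∈ A ↔ Chord.crossR p ∈ A then 0 else 1) +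
      2 * numPairs j A := by
    rw [numPairs_eq, Finset.mul_sum, ← Finset.sum_add_distrib, ← Finset.sum_add_distrib]
    refine Finset.sum_congr rfl fun p _ => ?_
    by_cases h1 : Chord.crossL p ∈ A <;> by_cases h2 : Chord.crossR p ∈ A <;> simp [h1, h2]
  rw [Finset.card_eq_sum_ones, sum_of_subset_canonicalChords hA, numNegative_eq hA, key]
  ring

theorem chordDiagram_isolated {C : Type} (tw : C → Bool) (w : List (Option C)) :
    (chordDiagram tw w).isolated = if (chordList tw w).length = 0 then 1 else 0 := by
  have : (chordList tw w).length = w.length := by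
    conv_rhs => rw [← chordList_map_snd (tw := tw) w, List.length_map]
  rw [this]
  rfl

theorem brPoly_canonical {R : Type*} [CommRing R] (j : ℕ) (ls : List ℕ) (m s : ℕ)
    (x y z b w t : R) : (chordDiagram Chord.tw (canonicalWord j ls m s)).brPoly x y z b w t =
      ∑ A ∈ (canonicalChords j ls.length m).powerset,
        weight 0 (chordDiagram Chord.tw (restrictWord A (canonicalWord j ls m s)))
          x y z b w t := by
  obtain ⟨a', j', m', hw⟩ := blockWord_canonicalWord j ls m s
  set W := canonicalWord j ls m s with hW
  have hZ := chordDiagram_spells hw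
  have hB := hw.blockList (chordList_map_snd (tw := Chord.tw) W)
  have hi := chordDiagram_isolated Chord.tw W
  have hV := hZ.numVertices hi
  have hr : (chordDiagram Chord.tw W).rank = 0 := by rw [rank, hV, numComponents_eq_one hV]
  have hK : ∀ c, c ∈ canonicalChords j ls.length m ↔ ∃ f, (f, some c) ∈ chordList Chord.tw W := by
    intro c
    have h0 : some c ∈ (chordList Chord.tw W).map Prod.snd ↔ some c ∈ W := by
      rw [chordList_map_snd]
    rw [mem_canonicalChords_iff j ls m s c, ← hW, ← h0, List.mem_map]
    constructor
    · rintro ⟨⟨f, d⟩, h, rfl⟩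
      exact ⟨f, h⟩
    · rintro ⟨f, h⟩
      exact ⟨(f, some c), h, rfl⟩
  rw [brPoly_eq_sum, hr, hZ.sum_edgeSets hB hK]
  refine Finset.sum_congr rfl fun A hA => ?_
  obtain ⟨a, hwA, -⟩ := blockWord_restrictWord (s := s) (Finset.mem_powerset.1 hA)
  have hsnd : (keepLabels A (chordList Chord.tw W)).map Prod.snd = restrictWord A W := by
    rw [map_snd_keepLabels, chordList_map_snd]
    rfl
  have hlen : (keepLabels A (chordList Chord.tw W)).length = (chordList Chord.tw W).length :=
    List.length_map _
  have hiso := (hZ.onFlags hB A).iso_of_eq hsnd (hwA.blockList hsnd)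
    (hi.trans (congrArg (fun n => if n = 0 then 1 else 0) hlen.symm))
  exact (hiso.sameNumbers.weight 0 x y z b w t).symm

/-- The weight `(y-1)^(a+2j+m) u^(2j+m+k) v^k w^t o^l` is regrouped as `m₁^a (uv)^k o^l (m₁ u w)^m
(m₁² u²)^j`. This requires `w^t = w^m`, where `t` is 0 or 1. -/
theorem scaledPoly_canonical {R : Type*} [CommRing R] (j : ℕ) (ls : List ℕ) (m s : ℕ)
    {α x y u v w o m₁ m₂ m₃ : R} (h1 : y - 1 = m₁) (h2 : m₁ * u * w = m₂)
    (h3 : m₁ ^ 2 * u ^ 2 = m₃) (hw : w = w ^ 2) :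
    scaledPoly α x y u v w o (chordDiagram Chord.tw (canonicalWord j ls m s)) =
      α * ∑ A ∈ (canonicalChords j ls.length m).powerset,
        m₁ ^ (A.card - 2 * numPairs j A - numNegative A) *
          ((u * v) ^ (chordDiagram Chord.tw (restrictWord A (canonicalWord j ls m s))).numBoundary *
            o ^ (chordDiagram Chord.tw
              (restrictWord A (canonicalWord j ls m s))).numHalfRibbons) *
          m₂ ^ numNegative A * m₃ ^ numPairs j A := by
  obtain ⟨a', j', m', hW⟩ := blockWord_canonicalWord j ls m s
  have hV := (chordDiagram_spells hW).numVertices (chordDiagram_isolated Chord.tw _)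
  rw [scaledPoly, numComponents_eq_one hV, pow_one, brPoly_canonical]
  congr 1
  refine Finset.sum_congr rfl fun A hA => ?_
  obtain ⟨a, hwA, hcard⟩ := blockWord_restrictWord (s := s) (Finset.mem_powerset.1 hA)
  rw [(chordDiagram_spells hwA).weight_eq (hwA.blockList (chordList_map_snd _))
    (chordDiagram_isolated Chord.tw _), h1, hcard,
    show a + 2 * numPairs j A + numNegative A - 2 * numPairs j A - numNegative A = a by omega,
    ← h2, ← h3]
  -- Idempotence lets `w` count negative chords although orientability only records whether there
  -- are any.
  have hpow : w ^ (if numNegative A = 0 then 0 else 1) = w ^ numNegative A := by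
    split_ifs with h
    · rw [h]
    · obtain ⟨n, hn⟩ := Nat.exists_eq_succ_of_ne_zero h
      have : ∀ n, w ^ (n + 1) = w := by
        intro n
        induction n with
        | zero => simp
        | succ n ih => rw [pow_succ, ih, ← sq, ← hw]
      rw [hn, pow_one, this]
  rw [hpow]
  ring

end HERG

namespace HERG

/-! ### Disjoint unions of bouquets -/

/-- Vertices map onto components, and the map is injective precisely when no edge joins two
vertices. Being a bouquet union thus becomes a numerical condition. -/
theorem isBouquetUnion_iff (G : HERG) :
    G.IsBouquetUnion ↔ G.numComponents = G.numVertices := by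
  let f : G.Vertex → G.Component := Quot.lift (fun a => Quot.mk _ a) (by
    rintro a b (h | h)
    exacts [Quot.sound (Or.inl h), Quot.sound (Or.inr (Or.inl h))])
  have hf : Function.Surjective f := by rintro ⟨a⟩; exact ⟨Quot.mk _ a, rfl⟩
  constructor
  · intro h
    refine congrArg (· + G.isolated) (Quot.card_congr_rel (α := G.Flag) ?_ ?_)
    · rintro a b (rfl | rfl | rfl)
      · exact Quot.sound (Or.inl rfl)
      · exact Quot.sound (Or.inr rfl)
      · by_cases ha : G.IsEdge a
        · exact (h a ha).2
        · rw [not_not.1 ha]; exact Quot.sound (Or.inr rfl)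
    · rintro a b (rfl | rfl)
      exacts [Quot.sound (Or.inl rfl), Quot.sound (Or.inr (Or.inl rfl))]
  · intro h x hx
    have hc : Nat.card G.Vertex = Nat.card G.Component := (Nat.add_right_cancel h).symm
    refine ⟨hx, ((Nat.bijective_iff_surjective_and_card f).2 ⟨hf, hc⟩).1 ?_⟩
    exact Quot.sound (r := fun a b : G.Flag => b = G.v a ∨ b = G.h a ∨ b = G.e a)
      (Or.inr (Or.inr rfl))

/-- One extra identification, of `x` with `G.h x`, makes the circles of `G` coarser than those of
the cut graph. -/
theorem numFaces_le_cut (G : HERG) (x : G.Flag) : G.numFaces ≤ (G.cut x).numFaces + 1 := by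
  classical
  let r : G.Flag → G.Flag → Prop := fun a b => b = G.v a ∨ b = G.e a
  let s : G.Flag → G.Flag → Prop := fun a b => r a b ∨ (a = x ∧ b = G.h x)
  have h1 := Quot.card_le_merge r x (G.h x)
  have h2 : Nat.card (Quot s) ≤ Nat.card (G.cut x).Face := by
    refine Quot.card_le_of_imp (α := G.Flag) ?_
    have ke : ∀ z, Quot.mk s (G.e z) = Quot.mk s z := fun z =>
      Quot.sound_symm (Or.inl (Or.inr rfl))
    have kx : Quot.mk s x = Quot.mk s (G.h x) := Quot.sound (Or.inr ⟨rfl, rfl⟩)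
    rintro a b (rfl | rfl)
    · exact Quot.sound (Or.inl (Or.inl rfl))
    · by_cases ha : a ∈ G.ribbonFlags x
      · have hb : (G.cut x).e a = G.h a := (cut_e G x a).trans (if_pos ha)
        refine Eq.trans ?_ (congrArg (Quot.mk s) hb).symm
        rcases ha with rfl | rfl | rfl | rfl
        · exact kx
        · rw [G.h_h]; exact kx.symm
        · rw [G.h_e, ke, ke]; exact kx
        · rw [G.h_h, G.h_e, ke, ke]; exact kx.symm
      · exact Quot.sound (Or.inl (Or.inr (by rw [cut_e, if_neg ha])))
  have h3 : (G.cut x).numFaces = Nat.card (G.cut x).Face + G.isolated := rfl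
  have h4 : Nat.card (Quot r) = Nat.card G.Face := rfl
  have h5 : Nat.card (Quot s) = Nat.card (Quot fun a b => r a b ∨ (a = x ∧ b = G.h x)) := rfl
  unfold numFaces at *
  omega

theorem isEmpty_isEdge {G : HERG} (h : G.numEdges = 0) (x : G.Flag) : ¬ G.IsEdge x := by
  intro hx
  have h1 := G.four_mul_numEdges
  have : 0 < Nat.card {x // G.IsEdge x} := Nat.card_pos_iff.2 ⟨⟨⟨x, hx⟩⟩, inferInstance⟩
  omega

theorem exists_isEdge {G : HERG} (h : 0 < G.numEdges) : ∃ x, G.IsEdge x := by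
  have h1 := G.four_mul_numEdges
  have : 0 < Nat.card {x // G.IsEdge x} := by omega
  obtain ⟨⟨⟨x, hx⟩⟩, -⟩ := Nat.card_pos_iff.1 this
  exact ⟨x, hx⟩

/-- Induction over cuts; without edges every circle surrounds a vertex. The bound ensures that the
exponent of `z` is not truncated in the proof of multiplicativity. -/
theorem numFaces_le (G : HERG) : G.numFaces ≤ G.numVertices + G.numEdges := by
  induction hn : G.numEdges generalizing G with
  | zero =>
    have he : ∀ x, G.e x = G.h x := fun x => not_not.1 (isEmpty_isEdge hn x)
    have : Nat.card G.Face = Nat.card G.Vertex := Quot.card_congr_rel (α := G.Flag)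
      (fun a b h => Quot.sound (by rwa [he] at h)) (fun a b h => Quot.sound (by rwa [he]))
    unfold numFaces numVertices
    omega
  | succ n ih =>
    obtain ⟨x, hx⟩ := exists_isEdge (G := G) (by omega)
    have h1 := ih (G.cut x) (by have := G.numEdges_cut x hx; omega)
    have h2 := G.numFaces_le_cut x
    have h3 : (G.cut x).numVertices = G.numVertices := rfl
    omega

/-- The quotient of a sum by a relation that does not mix the summands. -/
def _root_.Quot.sumEquiv {α β : Type*} {r : α ⊕ β → α ⊕ β → Prop} {r₁ : α → α → Prop}
    {r₂ : β → β → Prop} (h : ∀ a b, r a b ↔ Sum.LiftRel r₁ r₂ a b) :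
    Quot r ≃ Quot r₁ ⊕ Quot r₂ where
  toFun := Quot.lift (Sum.map (Quot.mk _) (Quot.mk _)) (fun a b hab => by
    obtain ⟨h'⟩ | ⟨h'⟩ := (h a b).1 hab
    exacts [congrArg Sum.inl (Quot.sound h'), congrArg Sum.inr (Quot.sound h')])
  invFun := Sum.elim
    (Quot.lift (fun a => Quot.mk _ (Sum.inl a)) fun _ _ hab => Quot.sound ((h _ _).2 (.inl hab)))
    (Quot.lift (fun a => Quot.mk _ (Sum.inr a)) fun _ _ hab => Quot.sound ((h _ _).2 (.inr hab)))
  left_inv := by rintro ⟨_ | _⟩ <;> rfl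
  right_inv := by rintro (c | c) <;> induction c using Quot.ind <;> rfl

section DisjointUnion

variable (G H : HERG)

theorem numVertices_disjointUnion :
    (G.disjointUnion H).numVertices = G.numVertices + H.numVertices := by
  have : Nat.card (G.disjointUnion H).Vertex = Nat.card G.Vertex + Nat.card H.Vertex := by
    rw [← Nat.card_sum]
    refine Nat.card_congr (Quot.sumEquiv ?_)
    rintro (a | a) (b | b) <;> simp [disjointUnion]
  have h : (G.disjointUnion H).isolated = G.isolated + H.isolated := rfl
  unfold numVertices
  omega

theorem numComponents_disjointUnion :
    (G.disjointUnion H).numComponents = G.numComponents + H.numComponents := by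
  have : Nat.card (G.disjointUnion H).Component = Nat.card G.Component + Nat.card H.Component := by
    rw [← Nat.card_sum]
    refine Nat.card_congr (Quot.sumEquiv ?_)
    rintro (a | a) (b | b) <;> simp [disjointUnion]
  have h : (G.disjointUnion H).isolated = G.isolated + H.isolated := rfl
  unfold numComponents
  omega

/-- The boundary circles of a disjoint union. -/
def faceSumEquiv : (G.disjointUnion H).Face ≃ G.Face ⊕ H.Face :=
  Quot.sumEquiv (by rintro (a | a) (b | b) <;> simp [disjointUnion])

theorem isExternal_faceSumEquiv_symm_inl (f : G.Face) :
    (G.disjointUnion H).IsExternal ((faceSumEquiv G H).symm (.inl f)) ↔ G.IsExternal f := by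
  constructor
  · rintro ⟨a | a, ha, ha'⟩
    · exact ⟨a, Sum.inl.inj ((Equiv.eq_symm_apply _).1 ha), Sum.inl.inj ha'⟩
    · exact (Sum.inr_ne_inl ((Equiv.eq_symm_apply _).1 ha)).elim
  · rintro ⟨a, rfl, ha⟩
    exact ⟨.inl a, rfl, congrArg Sum.inl ha⟩

theorem isExternal_faceSumEquiv_symm_inr (f : H.Face) :
    (G.disjointUnion H).IsExternal ((faceSumEquiv G H).symm (.inr f)) ↔ H.IsExternal f := by
  constructor
  · rintro ⟨a | a, ha, ha'⟩
    · exact (Sum.inl_ne_inr ((Equiv.eq_symm_apply _).1 ha)).elim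
    · exact ⟨a, Sum.inr.inj ((Equiv.eq_symm_apply _).1 ha), Sum.inr.inj ha'⟩
  · rintro ⟨a, rfl, ha⟩
    exact ⟨.inr a, rfl, congrArg Sum.inr ha⟩

theorem numBoundary_disjointUnion :
    (G.disjointUnion H).numBoundary = G.numBoundary + H.numBoundary := by
  unfold numBoundary
  rw [← Nat.card_sum]
  refine Nat.card_congr (((faceSumEquiv G H).symm.subtypeEquivOfSubtype.symm.trans
    Equiv.subtypeSum).trans (Equiv.sumCongr (Equiv.subtypeEquivRight fun f => ?_)
    (Equiv.subtypeEquivRight fun f => ?_)))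
  exacts [isExternal_faceSumEquiv_symm_inl G H f, isExternal_faceSumEquiv_symm_inr G H f]

theorem numFaces_disjointUnion :
    (G.disjointUnion H).numFaces = G.numFaces + H.numFaces := by
  have h := Nat.card_congr (faceSumEquiv G H)
  have h' : (G.disjointUnion H).isolated = G.isolated + H.isolated := rfl
  rw [Nat.card_sum] at h
  unfold numFaces
  omega

theorem numClosedFaces_disjointUnion :
    (G.disjointUnion H).numClosedFaces = G.numClosedFaces + H.numClosedFaces := by
  have h1 := numFaces_disjointUnion G H
  have h2 := numBoundary_disjointUnion G H
  rw [← numClosedFaces_add_numBoundary, ← numClosedFaces_add_numBoundary,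
    ← numClosedFaces_add_numBoundary] at h1
  omega

theorem numEdges_disjointUnion :
    (G.disjointUnion H).numEdges = G.numEdges + H.numEdges := by
  have h1 := (G.disjointUnion H).four_mul_numEdges
  have h2 : Nat.card {x // (G.disjointUnion H).IsEdge x} =
      Nat.card {x // G.IsEdge x} + Nat.card {x // H.IsEdge x} := by
    rw [← Nat.card_sum]
    exact Nat.card_congr (Equiv.subtypeSum.trans (Equiv.sumCongr
      (Equiv.subtypeEquivRight fun f => by simp [IsEdge, disjointUnion])
      (Equiv.subtypeEquivRight fun f => by simp [IsEdge, disjointUnion])))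
  have h3 := G.four_mul_numEdges
  have h4 := H.four_mul_numEdges
  omega

theorem numHalfRibbons_disjointUnion :
    (G.disjointUnion H).numHalfRibbons = G.numHalfRibbons + H.numHalfRibbons := by
  have h1 := (G.disjointUnion H).two_mul_numHalfRibbons
  have h2 : Nat.card {x // (G.disjointUnion H).e x = (G.disjointUnion H).h x} =
      Nat.card {x // G.e x = G.h x} + Nat.card {x // H.e x = H.h x} := by
    rw [← Nat.card_sum]
    exact Nat.card_congr (Equiv.subtypeSum.trans (Equiv.sumCongr
      (Equiv.subtypeEquivRight fun f => by simp [disjointUnion])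
      (Equiv.subtypeEquivRight fun f => by simp [disjointUnion])))
  have h3 := G.two_mul_numHalfRibbons
  have h4 := H.two_mul_numHalfRibbons
  omega

theorem orientable_disjointUnion :
    (G.disjointUnion H).Orientable ↔ G.Orientable ∧ H.Orientable := by
  constructor
  · rintro ⟨c, hc⟩
    exact ⟨⟨fun x => c (.inl x), fun x => hc (.inl x)⟩, ⟨fun x => c (.inr x), fun x => hc (.inr x)⟩⟩
  · rintro ⟨⟨c, hc⟩, ⟨d, hd⟩⟩
    refine ⟨Sum.elim c d, ?_⟩
    rintro (x | x)
    exacts [hc x, hd x]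

/-- Nonorientability of a union is a maximum, not a sum; the two differ only if both parts are
nonorientable, where `w ^ 2 = w` helps. -/
theorem pow_nonorientability_disjointUnion {R : Type*} [CommRing R] {w : R} (hw : w = w ^ 2) :
    w ^ (G.disjointUnion H).nonorientability = w ^ G.nonorientability * w ^ H.nonorientability := by
  unfold nonorientability
  by_cases h1 : G.Orientable <;> by_cases h2 : H.Orientable <;>
    simp [orientable_disjointUnion, h1, h2, ← pow_two, ← hw]

variable {G H}

theorem isBouquetUnion_onFlags {S : Set G.Flag} (hS : G.IsEdgeSet S) (hG : G.IsBouquetUnion) :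
    (G.onFlags S).IsBouquetUnion := by
  rw [isBouquetUnion_iff] at *
  have h1 := numComponents_le_onFlags hS
  have h2 := (G.onFlags S).numComponents_le_numVertices
  have h3 : (G.onFlags S).numVertices = G.numVertices := rfl
  omega

theorem IsBouquetUnion.rank_eq_zero (hG : G.IsBouquetUnion) : G.rank = 0 := by
  unfold rank; rw [(isBouquetUnion_iff G).1 hG, Nat.sub_self]

theorem isBouquetUnion_disjointUnion :
    (G.disjointUnion H).IsBouquetUnion ↔ G.IsBouquetUnion ∧ H.IsBouquetUnion := by
  simp only [isBouquetUnion_iff]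
  have h1 := numComponents_disjointUnion G H
  have h2 := numVertices_disjointUnion G H
  have h3 := G.numComponents_le_numVertices
  have h4 := H.numComponents_le_numVertices
  omega

/-- All ranks vanish, so every exponent except that of `w` is additive. The bound `hF` makes the
truncated subtraction in the exponent of `z` a true one. -/
theorem weight_disjointUnion {R : Type*} [CommRing R] (hG : G.IsBouquetUnion)
    (hH : H.IsBouquetUnion) (x y z s t : R) {w : R} (hw : w = w ^ 2) :
    weight 0 (G.disjointUnion H) x y z s w t = weight 0 G x y z s w t * weight 0 H x y z s w t := by
  have h1 := (isBouquetUnion_disjointUnion.2 ⟨hG, hH⟩).rank_eq_zero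
  have h2 := hG.rank_eq_zero
  have h3 := hH.rank_eq_zero
  have h4 := numEdges_disjointUnion G H
  have h5 := numComponents_disjointUnion G H
  have h6 := numClosedFaces_disjointUnion G H
  have hF : ∀ K : HERG, K.IsBouquetUnion → K.numClosedFaces ≤ K.numComponents + K.numEdges := by
    intro K hK
    have f1 := K.numFaces_le
    have f2 := K.numClosedFaces_add_numBoundary
    have f3 := (isBouquetUnion_iff K).1 hK
    omega
  have h7 := hF G hG
  have h8 := hF H hH
  unfold weight nullity
  rw [h1, h2, h3, numBoundary_disjointUnion, numHalfRibbons_disjointUnion,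
    pow_nonorientability_disjointUnion G H hw,
    show (G.disjointUnion H).numEdges - 0 = (G.numEdges - 0) + (H.numEdges - 0) by omega,
    show (G.disjointUnion H).numComponents + ((G.numEdges - 0) + (H.numEdges - 0)) -
      (G.disjointUnion H).numClosedFaces = (G.numComponents + (G.numEdges - 0) - G.numClosedFaces) +
        (H.numComponents + (H.numEdges - 0) - H.numClosedFaces) by omega]
  simp only [pow_add]
  ring

theorem _root_.Set.inl_mem_union_image {α β : Type*} {S : Set α} {T : Set β} {x : α} :
    (Sum.inl x : α ⊕ β) ∈ Sum.inl '' S ∪ Sum.inr '' T ↔ x ∈ S := by simp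

theorem _root_.Set.inr_mem_union_image {α β : Type*} {S : Set α} {T : Set β} {x : β} :
    (Sum.inr x : α ⊕ β) ∈ Sum.inl '' S ∪ Sum.inr '' T ↔ x ∈ T := by simp

theorem ribbonMap_inl : RibbonMap G (G.disjointUnion H) Sum.inl :=
  ⟨fun _ => rfl, fun _ => rfl, Sum.inl_injective⟩

theorem ribbonMap_inr : RibbonMap H (G.disjointUnion H) Sum.inr :=
  ⟨fun _ => rfl, fun _ => rfl, Sum.inr_injective⟩

theorem isEdgeSet_sum {S : Set G.Flag} {T : Set H.Flag} (hS : G.IsEdgeSet S) (hT : H.IsEdgeSet T) :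
    (G.disjointUnion H).IsEdgeSet (Sum.inl '' S ∪ Sum.inr '' T) := by
  rintro x (hx | hx)
  · obtain ⟨h1, h2, h3⟩ := ribbonMap_inl.image (H := G.disjointUnion H) hS x hx
    exact ⟨.inl h1, .inl h2, h3⟩
  · obtain ⟨h1, h2, h3⟩ := ribbonMap_inr.image (H := G.disjointUnion H) hT x hx
    exact ⟨.inr h1, .inr h2, h3⟩

theorem onFlags_disjointUnion_iso {S : Set G.Flag} {T : Set H.Flag} (hS : G.IsEdgeSet S)
    (hT : H.IsEdgeSet T) :
    ((G.disjointUnion H).onFlags (Sum.inl '' S ∪ Sum.inr '' T)).Iso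
      ((G.onFlags S).disjointUnion (H.onFlags T)) := by
  classical
  refine ⟨rfl, Equiv.refl _, fun x => ⟨rfl, rfl, (onFlags_e (isEdgeSet_sum hS hT) x).trans ?_⟩⟩
  rcases x with x | x
  · refine Eq.trans ?_ (congrArg Sum.inl (onFlags_e hS x)).symm
    by_cases hx : x ∈ S
    · exact (if_pos (Set.inl_mem_union_image.2 hx)).trans (congrArg Sum.inl (if_pos hx).symm)
    · exact (if_neg (mt Set.inl_mem_union_image.1 hx)).trans (congrArg Sum.inl (if_neg hx).symm)
  · refine Eq.trans ?_ (congrArg Sum.inr (onFlags_e hT x)).symm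
    by_cases hx : x ∈ T
    · exact (if_pos (Set.inr_mem_union_image.2 hx)).trans (congrArg Sum.inr (if_pos hx).symm)
    · exact (if_neg (mt Set.inr_mem_union_image.1 hx)).trans (congrArg Sum.inr (if_neg hx).symm)

theorem sum_edgeSets_disjointUnion {R : Type*} [AddCommMonoid R]
    (f : Set (G.disjointUnion H).Flag → R) :
    ∑ S ∈ (G.disjointUnion H).edgeSets, f S =
      ∑ p ∈ G.edgeSets ×ˢ H.edgeSets, f (Sum.inl '' p.1 ∪ Sum.inr '' p.2) := by
  have key : ∀ S : Set (G.Flag ⊕ H.Flag),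
      Sum.inl '' (Sum.inl ⁻¹' S) ∪ Sum.inr '' (Sum.inr ⁻¹' S) = S := by
    intro S; ext (x | x) <;> simp
  refine Finset.sum_bij' (fun S _ => (Sum.inl ⁻¹' S, Sum.inr ⁻¹' S))
    (fun p _ => Sum.inl '' p.1 ∪ Sum.inr '' p.2) (fun S hS => ?_) (fun p hp => ?_)
    (fun S _ => key S) (fun p _ => ?_) (fun S _ => congrArg f (key S).symm)
  · have hS := (mem_edgeSets _ _).1 hS
    rw [Finset.mem_product, mem_edgeSets, mem_edgeSets]
    exact ⟨ribbonMap_inl.preimage hS, ribbonMap_inr.preimage hS⟩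
  · rw [Finset.mem_product, mem_edgeSets, mem_edgeSets] at hp
    exact (mem_edgeSets _ _).2 (isEdgeSet_sum hp.1 hp.2)
  · exact Prod.ext (Set.ext fun x => Set.inl_mem_union_image)
      (Set.ext fun x => Set.inr_mem_union_image)

theorem scaledPoly_disjointUnion {R : Type*} [CommRing R] (hG : G.IsBouquetUnion)
    (hH : H.IsBouquetUnion) (α x y z s t : R) {w : R} (hw : w = w ^ 2) :
    scaledPoly α x y z s w t (G.disjointUnion H) =
      scaledPoly α x y z s w t G * scaledPoly α x y z s w t H := by
  unfold scaledPoly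
  rw [numComponents_disjointUnion, pow_add, mul_mul_mul_comm]
  congr 1
  rw [brPoly_eq_sum, brPoly_eq_sum, brPoly_eq_sum,
    (isBouquetUnion_disjointUnion.2 ⟨hG, hH⟩).rank_eq_zero, hG.rank_eq_zero, hH.rank_eq_zero,
    sum_edgeSets_disjointUnion, Finset.sum_mul_sum, ← Finset.sum_product']
  refine Finset.sum_congr rfl fun p hp => ?_
  rw [Finset.mem_product, mem_edgeSets, mem_edgeSets] at hp
  rw [(onFlags_disjointUnion_iso hp.1 hp.2).sameNumbers.weight]
  exact weight_disjointUnion (isBouquetUnion_onFlags hp.1 hG) (isBouquetUnion_onFlags hp.2 hH)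
    _ _ _ _ _ hw

theorem disjointUnion_comm (G H : HERG) : (G.disjointUnion H).Iso (H.disjointUnion G) :=
  ⟨Nat.add_comm _ _, Equiv.sumComm _ _, by rintro (x | x) <;> exact ⟨rfl, rfl, rfl⟩⟩

end DisjointUnion

/-! ### Decomposition into connected components -/

/-- A union of components. -/
def IsSaturated (G : HERG) (U : Set G.Flag) : Prop := ∀ x ∈ U, G.v x ∈ U ∧ G.h x ∈ U ∧ G.e x ∈ U

theorem IsSaturated.compl {G : HERG} {U : Set G.Flag} (hU : G.IsSaturated U) :
    G.IsSaturated Uᶜ := fun x hx =>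
  ⟨fun h => hx (by simpa [G.v_v] using (hU _ h).1), fun h => hx (by simpa [G.h_h] using (hU _ h).2.1),
    fun h => hx (by simpa [G.e_e] using (hU _ h).2.2)⟩

/-- The union of the components with flags in `U` and `n` isolated vertices. -/
def restrict (G : HERG) {U : Set G.Flag} (hU : G.IsSaturated U) (n : ℕ) : HERG where
  Flag := U
  v x := ⟨G.v x, (hU x x.2).1⟩
  h x := ⟨G.h x, (hU x x.2).2.1⟩
  e x := ⟨G.e x, (hU x x.2).2.2⟩
  isolated := n
  v_v x := Subtype.ext (G.v_v x)
  h_h x := Subtype.ext (G.h_h x)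
  e_e x := Subtype.ext (G.e_e x)
  v_ne x hx := G.v_ne x (congrArg Subtype.val hx)
  h_ne x hx := G.h_ne x (congrArg Subtype.val hx)
  e_ne x hx := G.e_ne x (congrArg Subtype.val hx)
  h_e x := Subtype.ext (G.h_e x)

theorem restrict_disjointUnion_iso (G : HERG) {U : Set G.Flag} (hU : G.IsSaturated U) {n m : ℕ}
    (h : n + m = G.isolated) : ((G.restrict hU n).disjointUnion (G.restrict hU.compl m)).Iso G := by
  classical
  refine ⟨h, Equiv.Set.sumCompl U, ?_⟩
  rintro (x | x) <;> exact ⟨rfl, rfl, rfl⟩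

theorem numVertices_pos_of_flag {G : HERG} (x : G.Flag) : 0 < G.numVertices :=
  Nat.add_pos_left (Nat.card_pos_iff.2 ⟨⟨G.vertexOf x⟩, inferInstance⟩) _

/-- If there is a vertex without ribbons, it is split off. Otherwise the flags of one vertex are
separated; they form a component because all edges are loops. -/
theorem IsBouquetUnion.exists_disjointUnion {G : HERG} (hG : G.IsBouquetUnion)
    (hV : 2 ≤ G.numVertices) :
    ∃ A B : HERG, (A.disjointUnion B).Iso G ∧ 0 < A.numVertices ∧ 0 < B.numVertices := by
  rcases Nat.eq_zero_or_pos G.isolated with h0 | h0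
  · have hc : 1 < Nat.card G.Vertex := by unfold numVertices at hV; omega
    have := Finite.one_lt_card_iff_nontrivial.1 hc
    obtain ⟨⟨a⟩, ⟨b⟩, hab⟩ := exists_pair_ne G.Vertex
    have hU : G.IsSaturated {y | G.vertexOf y = G.vertexOf a} := by
      intro y hy
      refine ⟨(G.vertexOf_v y).trans hy, (G.vertexOf_h y).trans hy, ?_⟩
      by_cases hy' : G.IsEdge y
      · exact (hG y hy').2.symm.trans hy
      · rw [not_not.1 hy']; exact (G.vertexOf_h y).trans hy
    refine ⟨_, _, G.restrict_disjointUnion_iso hU (n := 0) (m := 0) h0.symm, ?_, ?_⟩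
    · exact numVertices_pos_of_flag (G := G.restrict hU 0) ⟨a, rfl⟩
    · exact numVertices_pos_of_flag (G := G.restrict hU.compl 0) ⟨b, fun h => hab h.symm⟩
  · have hU : G.IsSaturated ∅ := fun x hx => hx.elim
    have hi := G.restrict_disjointUnion_iso hU (n := 1) (m := G.isolated - 1) (by omega)
    have h1 : (G.restrict hU 1).numVertices = 1 := by
      have : IsEmpty (G.restrict hU 1).Vertex := ⟨by rintro ⟨x⟩; exact x.2⟩
      unfold numVertices
      rw [Nat.card_of_isEmpty]; rfl
    have h2 := hi.sameNumbers.vertices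
    rw [numVertices_disjointUnion] at h2
    exact ⟨_, _, hi, by omega, by omega⟩

end HERG

/-! ### The empty graph -/

namespace HERG

/-- The definition of graphs admits no vertices at all; the only state is then empty and all
exponents are zero, matching `α ^ 0` in condition (3). -/
theorem brPoly_of_numVertices_eq_zero {R : Type*} [CommRing R] {G : HERG} (hG : G.numVertices = 0)
    (x y z s w t : R) : G.brPoly x y z s w t = 1 := by
  have hi : IsEmpty G.Flag := ⟨fun a => (numVertices_pos_of_flag a).ne' hG⟩
  have hempty : ∀ S : Set G.Flag, S = ∅ := fun S => Set.eq_empty_of_isEmpty S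
  have hs : G.edgeSets = {∅} := Finset.ext fun S => by
    rw [mem_edgeSets, Finset.mem_singleton, hempty S]
    exact iff_of_true (fun a => isEmptyElim a) rfl
  have hj : IsEmpty (G.onFlags ∅).Flag := hi
  have h0 : (G.onFlags ∅).numVertices = 0 := hG
  have h1 := (G.onFlags ∅).numComponents_le_numVertices
  have h2 := (G.onFlags ∅).four_mul_numEdges
  have h3 := (G.onFlags ∅).two_mul_numHalfRibbons
  have h4 := (G.onFlags ∅).numFaces_le
  have h5 := (G.onFlags ∅).numClosedFaces_add_numBoundary
  rw [Nat.card_of_isEmpty] at h2 h3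
  have hr : (G.onFlags ∅).rank = 0 := by unfold rank; omega
  have hr' : G.rank = 0 := by unfold rank; omega
  have ho : (G.onFlags ∅).nonorientability = 0 := if_pos ⟨isEmptyElim, isEmptyElim⟩
  rw [brPoly_eq_sum, hs, Finset.sum_singleton]
  unfold weight nullity
  rw [hr, hr', ho, show (G.onFlags ∅).numComponents = 0 by omega,
    show (G.onFlags ∅).numEdges = 0 by omega, show (G.onFlags ∅).numHalfRibbons = 0 by omega,
    show (G.onFlags ∅).numClosedFaces = 0 by omega, show (G.onFlags ∅).numBoundary = 0 by omega]
  simp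

theorem numHalfRibbons_eq_zero_of_numVertices_eq_zero {G : HERG} (hG : G.numVertices = 0) :
    G.numEdges = 0 ∧ G.numHalfRibbons = 0 := by
  have hi : IsEmpty G.Flag := ⟨fun a => (numVertices_pos_of_flag a).ne' hG⟩
  have h2 := G.four_mul_numEdges
  have h3 := G.two_mul_numHalfRibbons
  rw [Nat.card_of_isEmpty] at h2 h3
  omega

end HERG

/-! ### The polynomial and the size of classes, and invariance of differences under chord operations
-/

namespace HRClass

/-- The polynomial of a class. -/
noncomputable def scaledPoly {R : Type*} [CommRing R] (α x y z s w t : R) : HRClass → R :=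
  Quotient.lift (HERG.scaledPoly α x y z s w t) fun _ _ h =>
    HERG.scaledPoly_eq_of_class α x y z s w t (Quotient.sound h)

/-- The number of edges and vertices. -/
noncomputable def size : HRClass → ℕ :=
  Quotient.lift (fun G => G.numEdges + G.numVertices) fun G H h => by
    rw [HERG.numEdges_eq_of_class (G := G) (H := H) (Quotient.sound h),
      HERG.numVertices_eq_of_class (G := G) (H := H) (Quotient.sound h)]

theorem size_cut {G : HERG} {x : G.Flag} (hx : G.IsEdge x) :
    (of (G.cut x)).size + 1 = (of G).size := by
  have h1 := G.numEdges_cut x hx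
  have h2 : (G.cut x).numVertices = G.numVertices := rfl
  change (G.cut x).numEdges + (G.cut x).numVertices + 1 = G.numEdges + G.numVertices
  omega

theorem size_contract {G : HERG} {x : G.Flag} (hx : G.IsEdge x) (hx' : ¬ G.IsLoop x) :
    (of (G.contract x)).size + 2 = (of G).size := by
  have h1 := G.numEdges_contract x hx
  have h2 := HERG.numVertices_contract ((HERG.isLoop_iff hx).1 hx')
  change (G.contract x).numEdges + (G.contract x).numVertices + 2 = G.numEdges + G.numVertices
  omega

theorem isEdge_contract {G : HERG} {x y : G.Flag} (hy : G.IsEdge y) (hxy : y ∉ G.ribbonFlags x) :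
    (G.contract x).IsEdge ⟨y, hxy⟩ := fun h => hy (congrArg Subtype.val h)

theorem Related.size {D D' E E' : HRClass} (h : Related D D' E E') :
    D'.size + 1 = D.size ∧ E'.size + 1 = E.size ∧ D.size = E.size := by
  obtain ⟨G, a, b, hab, hba, -, ha, hb, hal, hbl, rfl, rfl, rfl, rfl⟩ := h
  have h1 := size_cut (isEdge_contract hb hab)
  have h2 := size_cut (isEdge_contract ha hba)
  have h3 := size_contract ha hal
  have h4 := size_contract hb hbl
  omega

theorem Related.mem {M : Set HRClass} (hM : MinorClosed M) {D D' E E' : HRClass}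
    (h : Related D D' E E') (hD : D ∈ M) (hE : E ∈ M) : D' ∈ M ∧ E' ∈ M := by
  obtain ⟨G, a, b, hab, hba, -, ha, hb, -, -, rfl, rfl, rfl, rfl⟩ := h
  exact ⟨hM.cut _ _ (isEdge_contract hb hab) hD, hM.cut _ _ (isEdge_contract ha hba) hE⟩

theorem Related.scaledPoly {R : Type*} [CommRing R] (α x y z s w t : R) {D D' E E' : HRClass}
    (h : Related D D' E E') :
    scaledPoly α x y z s w t D - scaledPoly α x y z s w t D' =
      scaledPoly α x y z s w t E - scaledPoly α x y z s w t E' := by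
  obtain ⟨G, a, b, hab, hba, hV, ha, hb, hal, hbl, rfl, rfl, rfl, rfl⟩ := h
  exact HERG.scaledPoly_of_related α x y z s w t hab hba hV ((HERG.isLoop_iff ha).1 hal)
    ((HERG.isLoop_iff hb).1 hbl) rfl rfl rfl rfl

/-- The difference of two maps that are compatible with chord operations is constant along a
sequence of rotations and twists if the maps agree on smaller diagrams. -/
theorem sub_eq_of_reflTransGen {R : Type*} [CommRing R] {M : Set HRClass} (hM : MinorClosed M)
    {F P : HRClass → R}
    (hF : ∀ D D' E E' : HRClass, Related D D' E E' → D ∈ M → E ∈ M → F D - F D' = F E - F E')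
    (hP : ∀ D D' E E' : HRClass, Related D D' E E' → P D - P D' = P E - P E')
    {D C : HRClass} (hFP : ∀ E ∈ M, E.size < D.size → F E = P E)
    (h : Relation.ReflTransGen (fun A B => Step A B ∧ A ∈ M ∧ B ∈ M) D C) :
    C.size = D.size ∧ F D - P D = F C - P C := by
  induction h with
  | refl => exact ⟨rfl, rfl⟩
  | @tail A B _ hAB ih =>
    obtain ⟨⟨A', B', hr⟩, hA, hB⟩ := hAB
    obtain ⟨h1, h2, h3⟩ := hr.size
    obtain ⟨hA', hB'⟩ := hr.mem hM hA hB
    have e1 := hFP A' hA' (by omega)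
    have e2 := hFP B' hB' (by omega)
    have e3 := hF _ _ _ _ hr hA hB
    have e4 := hP _ _ _ _ hr
    exact ⟨by omega, by rw [ih.2]; linear_combination e3 - e4 + e1 - e2⟩

end HRClass

/-! ### The universality theorem -/

open HRClass in
theorem mainTheorem5 {R : Type*} [CommRing R] (M : Set HRClass)
    (hminor : MinorClosed M) (hchord : ClosedUnderChordOperations M)
    (h10000 : canonical 0 [0] 0 0 ∈ M) (h10001 : canonical 0 [] 1 0 ∈ M)
    (h21000 : canonical 1 [] 0 0 ∈ M) (h001l0 : ∀ l, 1 ≤ l → canonical 0 [] 0 l ∈ M)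
    -- only the values of `F` on `M` matter
    (F : HRClass → R)
    (hrelated : ∀ D D' E E' : HRClass, Related D D' E E' → D ∈ M → E ∈ M →
      F D - F D' = F E - F E')
    (s q r : R) (sl : ℕ → R)
    (hs : s = F (canonical 1 [] 0 0)) (hq : q = F (canonical 0 [0] 0 0))
    (hr : r = F (canonical 0 [] 1 0)) (hsl : ∀ l, sl l = F (canonical 0 [] 0 l))
    (α : Rˣ) (x u v w o : R)
    -- (1) contraction and cut
    (hregular : ∀ (G : HERG) (e : G.Flag), of G ∈ M → G.IsRegular e →
      F (of G) = F (of (G.cut e)) + F (of (G.contract e)))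
    (hbridge : ∀ (G : HERG) (e : G.Flag), of G ∈ M → G.IsBridge e →
      F (of G) = (↑α⁻¹ : R) * (x - 1) * F (of (G.cut e)) + F (of (G.contract e)))
    -- (2) disjoint unions of bouquets, and the values on the canonical diagrams
    (hunion : ∀ G H : HERG, G.IsBouquetUnion → H.IsBouquetUnion →
      of G ∈ M → of H ∈ M → of (G.disjointUnion H) ∈ M →
      F (of (G.disjointUnion H)) = F (of G) * F (of H))
    (m₁ m₂ m₃ : R)
    (hm₁ : m₁ = (↑α⁻¹ : R) * (q - sl 2)) (hm₂ : m₂ = (↑α⁻¹ : R) * (r - sl 2))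
    (hm₃ : m₃ = (↑α⁻¹ : R) * (s - 2 * (↑α⁻¹ : R) ^ 2 * (q - sl 2) * sl 1 ^ 2 - sl 4))
    (hcanonical : ∀ (j : ℕ) (ls : List ℕ) (m t : ℕ), m ≤ 2 → canonical j ls m t ∈ M →
      F (canonical j ls m t) = (α : R) * ∑ A ∈ (canonicalChords j ls.length m).powerset,
        m₁ ^ (A.card - 2 * numPairs j A - numNegative A) *
          ((u * v) ^ (chordDiagram Chord.tw (restrictWord A (canonicalWord j ls m t))).numBoundary *
            o ^ (chordDiagram Chord.tw (restrictWord A (canonicalWord j ls m t))).numHalfRibbons) *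
          m₂ ^ numNegative A * m₃ ^ numPairs j A)
    -- (3) edgeless graphs without half-ribbons
    (hedgeless : ∀ G : HERG, of G ∈ M → G.numEdges = 0 → G.numHalfRibbons = 0 →
      F (of G) = (α : R) ^ G.numVertices)
    -- (4)
    (h4s : (q - sl 2) ^ 2 * u ^ 2 =
      (α : R) * (s - 2 * (↑α⁻¹ : R) ^ 2 * (q - sl 2) * sl 1 ^ 2 - sl 4))
    (h4r : (q - sl 2) * u * w = r - sl 2)
    (h4l : ∀ l, 1 ≤ l → sl l = (α : R) * (u * v * o ^ l))
    (h4w : w = w ^ 2) :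
    ∀ G : HERG, of G ∈ M →
      F (of G) = (α : R) ^ G.numComponents *
        G.brPoly x ((↑α⁻¹ : R) * (q - sl 2 + α)) u v w o := by
  -- The second argument of the polynomial is chosen to make `y - 1 = m₁`; the next two identities
  -- are the relations (4) divided by powers of `α`.
  have hy : (↑α⁻¹ : R) * (q - sl 2 + α) - 1 = m₁ := by
    rw [hm₁, mul_add, Units.inv_mul, add_sub_cancel_right]
  have hm₂' : m₁ * u * w = m₂ := by
    rw [hm₁, hm₂]; linear_combination (↑α⁻¹ : R) * h4r
  have hm₃' : m₁ ^ 2 * u ^ 2 = m₃ := by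
    rw [hm₁, hm₃]
    linear_combination (↑α⁻¹ : R) ^ 2 * h4s + (↑α⁻¹ : R) *
      (s - 2 * (↑α⁻¹ : R) ^ 2 * (q - sl 2) * sl 1 ^ 2 - sl 4) * α.inv_mul
  set y : R := (↑α⁻¹ : R) * (q - sl 2 + α)
  let P : HRClass → R := scaledPoly (α : R) x y u v w o
  suffices key : ∀ n : ℕ, ∀ G : HERG, (of G).size = n → of G ∈ M → F (of G) = P (of G) from
    fun G hG => key _ G rfl hG
  intro n
  induction n using Nat.strong_induction_on with
  | _ n ih =>
  intro G hn hG
  have ih' : ∀ H : HERG, of H ∈ M → (of H).size < n → F (of H) = P (of H) :=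
    fun H hH hlt => ih _ hlt H rfl hH
  by_cases hB : G.IsBouquetUnion
  · rcases Nat.lt_trichotomy G.numVertices 1 with hV | hV | hV
    · have hV : G.numVertices = 0 := by omega
      obtain ⟨h1, h2⟩ := HERG.numHalfRibbons_eq_zero_of_numVertices_eq_zero hV
      have hk : G.numComponents = 0 := by have := G.numComponents_le_numVertices; omega
      rw [hedgeless G hG h1 h2, hV]
      change _ = (α : R) ^ G.numComponents * G.brPoly x y u v w o
      rw [hk, HERG.brPoly_of_numVertices_eq_zero hV, mul_one]
    · obtain ⟨j, ls, m, t, hm, hD⟩ := HERG.exists_canonical hV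
      -- The diagram reached inside `M` may place its half-chords differently from the one found by
      -- slides; only `j` and `m ≤ 2` are needed, since the formula for canonical diagrams covers
      -- every placement.
      obtain ⟨C, ⟨ls', t', rfl, -, -, -, -⟩, hC⟩ := hchord _ _ _ _ _ _ hG
        ⟨_, ⟨ls, t, rfl, hm, rfl, rfl, rfl⟩, hD⟩
      have hCM : canonical j ls' m t' ∈ M := by
        rcases hC.cases_tail with h | ⟨_, -, h⟩
        exacts [h ▸ hG, h.2.2]
      -- All diagrams of the chain have the size of `G`, so the cut ones are smaller and the
      -- induction hypothesis makes `F - P` constant along the chain.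
      have h1 := (sub_eq_of_reflTransGen hminor (P := P) hrelated
        (fun _ _ _ _ => Related.scaledPoly _ _ _ _ _ _ _)
        (fun E hE hlt => by
          induction E using Quotient.inductionOn with
          | _ E => exact ih' E hE (hn ▸ hlt)) hC).2
      have h2 : F (canonical j ls' m t') = P (canonical j ls' m t') :=
        (hcanonical j ls' m t' hm hCM).trans
          (HERG.scaledPoly_canonical j ls' m t' hy hm₂' hm₃' h4w).symm
      rwa [h2, sub_self, sub_eq_zero] at h1
    · obtain ⟨A, B, hAB, hA, hB'⟩ := hB.exists_disjointUnion hV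
      have hV' := hAB.sameNumbers.vertices
      have hE := hAB.sameNumbers.edges
      rw [HERG.numVertices_disjointUnion] at hV'
      rw [HERG.numEdges_disjointUnion] at hE
      have hn' : G.numEdges + G.numVertices = n := hn
      have hU : of (A.disjointUnion B) ∈ M := hAB.of_eq ▸ hG
      have hU' : of (B.disjointUnion A) ∈ M := (HERG.disjointUnion_comm A B).of_eq ▸ hU
      have hAM := hminor.component A B hA hU
      have hBM := hminor.component B A hB' hU'
      have hb : A.IsBouquetUnion ∧ B.IsBouquetUnion := by
        rw [← HERG.isBouquetUnion_disjointUnion, HERG.isBouquetUnion_iff,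
          hAB.sameNumbers.components, hAB.sameNumbers.vertices, ← HERG.isBouquetUnion_iff]
        exact hB
      rw [← hAB.of_eq, hunion A B hb.1 hb.2 hAM hBM hU,
        ih' A hAM (by change A.numEdges + A.numVertices < n; omega),
        ih' B hBM (by change B.numEdges + B.numVertices < n; omega)]
      exact (HERG.scaledPoly_disjointUnion hb.1 hb.2 _ _ _ _ _ _ h4w).symm
  · obtain ⟨a, ha, hal⟩ : ∃ a, G.IsEdge a ∧ ¬ G.IsLoop a := by
      simpa [HERG.IsBouquetUnion] using hB
    have hP := HERG.scaledPoly_of_nonloop α x y u v w o ((HERG.isLoop_iff ha).1 hal)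
    have hcut := ih' _ (hminor.cut G a ha hG) (by have := size_cut ha; omega)
    have hcon := ih' _ (hminor.contract G a ha hG) (by have := size_contract ha hal; omega)
    have h1 := G.numComponents_le_cut a
    have h2 := G.numComponents_cut_le a
    refine Eq.trans ?_ hP.symm
    -- A cut creates at most one new component, so the exponent in the rule for `P` is 1 for a
    -- bridge and 0 for a regular edge.
    by_cases hbr : G.IsBridge a
    · have h3 := hbr.2
      rw [hbridge G a hG hbr, hcut, hcon,
        show (G.cut a).numComponents - G.numComponents = 1 by omega, pow_one]
      rfl
    · have h3 : ¬ G.numComponents < (G.cut a).numComponents := fun h => hbr ⟨ha, h⟩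
      rw [hregular G a hG ⟨ha, hbr, hal⟩, hcut, hcon,
        show (G.cut a).numComponents - G.numComponents = 0 by omega, pow_zero, one_mul]
      rfl
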